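/- Let $k$ be an algebraically closed field of characteristic $0$, $G$ a finite group, $A\subseteq G$ an abelian subgroup, and $A^*=\mathrm{Hom}(A,k^\times)$, written additively. For $\mu\in A^*$ let $P_\mu=\frac1{|A|}\sum_{a\in A}\mu(a)^{-1}a\in k[A]$, and for a $G$-module $X$ let $X[\mu]=\{x\in X: ax=\mu(a)x \text{ for all } a\in A\}$. **Dynamical twists.** A *dynamical twist* is a function $J:A^*\to k[G]\otimes k[G]$ such that every $J(\lambda)$ is invertible and commutes with $a\otimes a$ for all $a\in A$, $(\varepsilon\otimes\mathrm{id})J(\lambda)=(\mathrm{id}\otimes\varepsilon)J(\lambda)=1$, and $$(\Delta\otimes\mathrm{id})(J(\lambda))\cdot\sum_{\mu\in A^*}J(\lambda-\mu)\otimes P_\mu=(\mathrm{id}\otimes\Delta)(J(\lambda))\cdot(1\otimes J(\lambda)).$$ Twists $J,J'$ are *gauge equivalent* if there is a function $t:A^*\to k[G]$ with invertible values commuting with $A$ and $\varepsilon(t(\lambda))=1$, such that $J'(\lambda)=\Delta(t(\lambda)^{-1})\,J(\lambda)\,\bigl(\sum_\mu t(\lambda-\mu)\otimes P_\mu\bigr)(1\otimes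 t(\lambda))$ for all $\lambda$. **Dynamical data.** A *dynamical datum* for $(G,A)$ is a subgroup $K\subseteq G$ with projective representations $\pi_\lambda:K\to GL(V_\lambda)$, $V_\lambda\neq0$, $\lambda\in A^*$, that are irreducible (i.e. $\pi_\lambda(K)$ spans $\mathrm{End}_kV_\lambda$) and such that for all $\lambda,\mu$ the projective representation $V_\lambda\otimes V_\mu^*=\mathrm{Hom}_k(V_\mu,V_\lambda)$, on which $h\in K$ acts by $T\mapsto\pi_\lambda(h)T\pi_\mu(h)^{-1}$, is a linear representation and $\mathrm{Ind}_K^G(V_\lambda\otimes V_\mu^*)\cong\mathrm{Ind}_A^G(\lambda-\mu)$. An *isomorphism* $(K,\{V_\lambda\})\to(K',\{V'_\lambda\})$ consists of $g\in G$ with $gKg^{-1}=K'$, linear isomorphisms $\phi_\lambda:V_\lambda\to V'_\lambda$, and a function $\alpha:K\to k^\times$, the same for all $\lambda$, with $\pi'_\lambda(ghg^{-1})\phi_\lambda=\alpha(h)\,\phi_\lambda\pi_\lambda(h)$ for all $h\in K$, $\lambda\in A^*$. **From twists to data.** Let $J$ be a dynamical twist. Let $F_\mu[G]$ be the space of functions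 $f:G\to k$ with $f(ha)=f(h)\mu(a)$ for $h\in G$, $a\in A$, with the $G$-action $(h\circ f)(g)=f(h^{-1}g)$. Let $B_\lambda$ be $F_0[G]$ with the product $(f_1*f_2)(g)=(f_1\otimes f_2)((g\otimes g)J(\lambda))$, an associative algebra with unit the constant function $1$. By the same formula, with $J(\mu)$ in place of $J(\lambda)$, $F_{\mu-\lambda}[G]$ is a $B_\lambda$-$B_\mu$-bimodule. A datum $(K,\{V_\lambda\})$ *is obtained from* $J$ if there are minimal two-sided ideals $B^i_\lambda\subseteq B_\lambda$ ($\lambda\in A^*$), each having stabilizer $K$ in $G$ and such that $F^i_{\lambda\mu}:=B^i_\lambda F_{\mu-\lambda}[G]B^i_\mu\ne0$ for all $\lambda,\mu$; structures of simple $B^i_\lambda$-modules on the $V_\lambda$, such that $h\in K$ acts on $B_\lambda^i\cong\mathrm{End}_kV_\lambda$ by $\mathrm{Ad}\,\pi_\lambda(h)$; and isomorphisms of $B^i_\lambda$-$B^i_\mu$-bimodules $V_\lambda\otimes V_\mu^*\cong F^i_{\lambda\mu}$ that are also $K$-equivariant, for all $\lambda,\mu$. **From data to twists (exchange construction).** Let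 $(K,\{V_\lambda\})$ be a dynamical datum and choose isomorphisms of $G$-modules $\epsilon_{\lambda\mu}:\mathrm{Ind}_K^G(V_\lambda\otimes V_{\lambda-\mu}^*)\to\mathrm{Ind}_A^G\mu$. For a $G$-module $X$ and $x\in X[\mu]$ let $\Psi(\lambda,x):V_\lambda\to V_{\lambda-\mu}\otimes X$ be the map corresponding to $x$ under $$X[\mu]\cong\mathrm{Hom}_G(\mathrm{Ind}_A^G\mu,X)\cong\mathrm{Hom}_G(\mathrm{Ind}_K^G(V_\lambda\otimes V_{\lambda-\mu}^*),X)\cong\mathrm{Hom}_K(V_\lambda\otimes V_{\lambda-\mu}^*,X)\subseteq\mathrm{Hom}_k(V_\lambda,V_{\lambda-\mu}\otimes X),$$ where the second isomorphism is given by $\epsilon_{\lambda\mu}$ and the rest is canonical. The choice is normalized so that for the trivial $G$-module $k$ and $1\in k=k[0]$ one has $\Psi(\lambda,1)=\mathrm{id}_{V_\lambda}$. A dynamical twist $J$ *is obtained from* $(K,\{V_\lambda\})$ if for some such choice $$(\Psi(\lambda-\mu,y)\otimes\mathrm{id}_X)\circ\Psi(\lambda,x)=\Psi(\lambda,J(\lambda)(y\otimes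 x))$$ for all $\lambda,\mu,\nu\in A^*$, all $G$-modules $X,Y$ and all $x\in X[\mu]$, $y\in Y[\nu]$ (where $J(\lambda)(y\otimes x)\in(Y\otimes X)[\mu+\nu]$). **Theorem.** From every dynamical twist one obtains a dynamical datum, and from every dynamical datum one obtains a dynamical twist. There are well-defined maps $$D:\{\text{gauge equivalence classes of dynamical twists } A^*\to k[G]\otimes k[G]\}\to\{\text{isomorphism classes of dynamical data for }(G,A)\}$$ and $T$ in the opposite direction, such that $D([J])$ is the class of every datum obtained from $J$, and $T([K,\{V_\lambda\}])$ is the class of every twist obtained from $(K,\{V_\lambda\})$. The maps $D$ and $T$ are inverses of each other; in particular the two sets of classes are in bijection. -/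

import Mathlib

open scoped TensorProduct

noncomputable section

namespace DynTwist

universe u v w

variable {k : Type u} [Field k] {G : Type v} [Group G] {A : Subgroup G}

/-! ### Characters and the idempotents of `k[A]` -/

/-- The character group `A^*`, written multiplicatively: the sum `χ + ψ` of characters is
`χ * ψ`, the difference `χ - ψ` is `χ / ψ` and the zero character is `1`. -/
abbrev Dual (k : Type u) [Field k] {G : Type v} [Group G] (A : Subgroup G) : Type (max u v) :=
  A →* kˣ

/-- The idempotent `P_χ = |A|⁻¹ ∑_a χ(a)⁻¹ a` of `k[A]`, as an element of `k[G]`;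
it satisfies `a P_χ = χ(a) P_χ`. -/
def charIdem (χ : Dual k A) : MonoidAlgebra k G :=
  (Nat.card A : k)⁻¹ • ∑ᶠ a : A, MonoidAlgebra.single (a : G) (((χ a)⁻¹ : kˣ) : k)

/-! ### Dynamical twists -/

/-- `x : A^* → k[G]` has zero weight: its values commute with every `a ∈ A`. -/
def ZeroWeight₁ (x : Dual k A → MonoidAlgebra k G) : Prop :=
  ∀ (χ : Dual k A) (a : A), MonoidAlgebra.of k G a * x χ = x χ * MonoidAlgebra.of k G a

/-- `J : A^* → k[G] ⊗ k[G]` has zero weight: its values commute with `Δ(a) = a ⊗ a`, `a ∈ A`. -/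
def ZeroWeight₂ (J : Dual k A → MonoidAlgebra k G ⊗[k] MonoidAlgebra k G) : Prop :=
  ∀ (χ : Dual k A) (a : A),
    (MonoidAlgebra.of k G a ⊗ₜ[k] MonoidAlgebra.of k G a) * J χ =
      J χ * (MonoidAlgebra.of k G a ⊗ₜ[k] MonoidAlgebra.of k G a)

/-- For a function `F` on `A^*` with values in an algebra `M`, the element `F(χ - h)` of
`M ⊗ k[A] ⊆ M ⊗ k[G]`, where `h` is the weight of the last component: applying a character `ψ`
to the last component gives `F(χ - ψ)`. -/
def shiftByWeight {M : Type*} [AddCommGroup M] [Module k M] (F : Dual k A → M) (χ : Dual k A) :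
    M ⊗[k] MonoidAlgebra k G :=
  ∑ᶠ ψ : Dual k A, F (χ / ψ) ⊗ₜ[k] charIdem ψ

/-- Dynamical twists `J : A^* → k[G] ⊗ k[G]`. -/
structure DynamicalTwist (k : Type u) [Field k] {G : Type v} [Group G] (A : Subgroup G) where
  /-- the underlying function -/
  J : Dual k A → MonoidAlgebra k G ⊗[k] MonoidAlgebra k G
  zeroWeight : ZeroWeight₂ J
  isUnit : ∀ χ, IsUnit (J χ)
  /-- `J^{12,3}(χ) J^{12}(χ - h^{(3)}) = J^{1,23}(χ) J^{23}(χ)` -/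
  dynamical : ∀ χ,
    Algebra.TensorProduct.assoc k k k
        (MonoidAlgebra k G) (MonoidAlgebra k G) (MonoidAlgebra k G)
        (Algebra.TensorProduct.map (Bialgebra.comulAlgHom k (MonoidAlgebra k G))
            (AlgHom.id k (MonoidAlgebra k G)) (J χ) * shiftByWeight J χ) =
      Algebra.TensorProduct.map (AlgHom.id k (MonoidAlgebra k G))
          (Bialgebra.comulAlgHom k (MonoidAlgebra k G)) (J χ) *
        ((1 : MonoidAlgebra k G) ⊗ₜ[k] J χ)
  counit_left : ∀ χ,
    Algebra.TensorProduct.lid k (MonoidAlgebra k G)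
      (Algebra.TensorProduct.map (Bialgebra.counitAlgHom k (MonoidAlgebra k G))
        (AlgHom.id k (MonoidAlgebra k G)) (J χ)) = 1
  counit_right : ∀ χ,
    Algebra.TensorProduct.rid k k (MonoidAlgebra k G)
      (Algebra.TensorProduct.map (AlgHom.id k (MonoidAlgebra k G))
        (Bialgebra.counitAlgHom k (MonoidAlgebra k G)) (J χ)) = 1

/-- The element `t(χ - h^{(2)}) ⊗ t(χ)` of `k[G] ⊗ k[G]`. -/
def gaugeTensor (t : Dual k A → (MonoidAlgebra k G)ˣ) (χ : Dual k A) :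
    MonoidAlgebra k G ⊗[k] MonoidAlgebra k G :=
  shiftByWeight (fun ψ => (t ψ : MonoidAlgebra k G)) χ *
    ((1 : MonoidAlgebra k G) ⊗ₜ[k] (t χ : MonoidAlgebra k G))

/-- `t` is a gauge transformation. -/
def IsGauge (t : Dual k A → (MonoidAlgebra k G)ˣ) : Prop :=
  ZeroWeight₁ (fun χ => (t χ : MonoidAlgebra k G)) ∧
    ∀ χ, Bialgebra.counitAlgHom k (MonoidAlgebra k G) (t χ : MonoidAlgebra k G) = 1

/-- `J'` is gauge equivalent to `J`:
`J'(χ) = Δ(t(χ)⁻¹) J(χ) (t(χ - h^{(2)}) ⊗ t(χ))` for some gauge transformation `t`. -/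
def GaugeEquivalent (J J' : DynamicalTwist k A) : Prop :=
  ∃ t : Dual k A → (MonoidAlgebra k G)ˣ, IsGauge t ∧
    ∀ χ, J'.J χ =
      Bialgebra.comulAlgHom k (MonoidAlgebra k G)
          (((t χ)⁻¹ : (MonoidAlgebra k G)ˣ) : MonoidAlgebra k G) *
        J.J χ * gaugeTensor t χ

/-! ### Projective representations and dynamical data -/

/-- A map `π : K → GL(V)` is a projective representation: `π(g) π(h) = c(g, h) π(gh)` for some
`c : K × K → k^×` (which is then automatically a 2-cocycle when `V ≠ 0`). -/
def IsProjectiveRep {K : Type*} [Group K] {V : Type*} [AddCommGroup V] [Module k V]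
    (π : K → (V ≃ₗ[k] V)) : Prop :=
  ∃ c : K → K → kˣ, ∀ g h v, π g (π h v) = (c g h : k) • π (g * h) v

/-- A projective representation is irreducible if its image spans `End_k V`. -/
def IsIrreducibleProj {K : Type*} {V : Type*} [AddCommGroup V] [Module k V]
    (π : K → (V ≃ₗ[k] V)) : Prop :=
  Submodule.span k (Set.range fun g => (π g : V →ₗ[k] V)) = ⊤

/-- A subgroup `K ⊆ G` with projective irreducible representations `V_χ` (`χ ∈ A^*`) of `K`, such
that `V_χ ⊗ V_ψ^*` is linear for all `χ, ψ`. The space `V_χ ⊗ V_ψ^*` is realized as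
`Hom_k(V_ψ, V_χ)`, on which `h ∈ K` acts by `T ↦ π_χ(h) T π_ψ(h)⁻¹`.
(Finite-dimensionality is automatic for a finite group, by irreducibility.) -/
structure ProjectiveFamily (k : Type u) [Field k] {G : Type v} [Group G] (A : Subgroup G) where
  K : Subgroup G
  V : Dual k A → Type u
  [addCommGroup : ∀ χ, AddCommGroup (V χ)]
  [module : ∀ χ, Module k (V χ)]
  [finite : ∀ χ, Module.Finite k (V χ)]
  [nontrivial : ∀ χ, Nontrivial (V χ)]
  π : ∀ χ, K → (V χ ≃ₗ[k] V χ)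
  projective : ∀ χ, IsProjectiveRep (π χ)
  irreducible : ∀ χ, IsIrreducibleProj (π χ)
  linear : ∀ χ ψ (g h : K) (T : V ψ →ₗ[k] V χ),
    (π ψ g).arrowCongr (π χ g) ((π ψ h).arrowCongr (π χ h) T) =
      (π ψ (g * h)).arrowCongr (π χ (g * h)) T

attribute [instance] ProjectiveFamily.addCommGroup ProjectiveFamily.module
  ProjectiveFamily.finite ProjectiveFamily.nontrivial

/-- The linear representation `V_χ ⊗ V_ψ^* = Hom_k(V_ψ, V_χ)` of `K`. -/
def ProjectiveFamily.homRep (𝒱 : ProjectiveFamily k A) (χ ψ : Dual k A) :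
    Representation k 𝒱.K (𝒱.V ψ →ₗ[k] 𝒱.V χ) where
  toFun g := ((𝒱.π ψ g).arrowCongr (𝒱.π χ g)).toLinearMap
  map_one' := by
    ext1 T
    have h := 𝒱.linear χ ψ 1 1 T
    rw [mul_one] at h
    exact ((𝒱.π ψ 1).arrowCongr (𝒱.π χ 1)).injective h
  map_mul' g h := by
    ext1 T
    exact (𝒱.linear χ ψ g h T).symm

/-- The one-dimensional representation of `A` given by a character. -/
def charRep (χ : Dual k A) : Representation k A k where
  toFun a := ((χ a : kˣ) : k) • LinearMap.id
  map_one' := by ext; simp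
  map_mul' a b := by ext; simp [mul_comm]

/-- Dynamical data for `(G, A)`: moreover
`Ind_K^G (V_χ ⊗ V_ψ^*) ≅ Ind_A^G (χ - ψ)` for all `χ, ψ ∈ A^*`. -/
structure DynamicalDatum (k : Type u) [Field k] {G : Type v} [Group G] (A : Subgroup G) extends
    ProjectiveFamily k A where
  ind_iso : ∀ χ ψ : Dual k A, Nonempty
    ((Representation.ind K.subtype (toProjectiveFamily.homRep χ ψ)).Equiv
      (Representation.ind A.subtype (charRep (χ / ψ))))

/-- Isomorphism of dynamical data: an element `g ∈ G` with `g K g⁻¹ = K'` and projective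
isomorphisms `φ_χ` from `π_χ` to `π'_χ ∘ Ad_g`, with one multiplier function `α` for all `χ`. -/
def DatumIso (𝒟 𝒟' : DynamicalDatum k A) : Prop :=
  ∃ (g : G) (hK : ∀ h : G, h ∈ 𝒟.K ↔ g * h * g⁻¹ ∈ 𝒟'.K)
    (φ : ∀ χ, 𝒟.V χ ≃ₗ[k] 𝒟'.V χ) (α : 𝒟.K → kˣ),
    ∀ (χ : Dual k A) (h : 𝒟.K) (v : 𝒟.V χ),
      𝒟'.π χ ⟨g * h * g⁻¹, (hK h).1 h.2⟩ (φ χ v) = (α h : k) • φ χ (𝒟.π χ h v)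

/-! ### From twists to data: the algebras `B_χ` -/

/-- A function on `G`, extended to a linear functional on `k[G]`. -/
def evalFun (f : G → k) : MonoidAlgebra k G →ₗ[k] k :=
  Finsupp.linearCombination k f ∘ₗ (MonoidAlgebra.coeffLinearEquiv k).toLinearMap

/-- The functional `f₁ ⊗ f₂` on `k[G] ⊗ k[G]`. -/
def evalFun₂ (f₁ f₂ : G → k) : MonoidAlgebra k G ⊗[k] MonoidAlgebra k G →ₗ[k] k :=
  LinearMap.mul' k k ∘ₗ TensorProduct.map (evalFun f₁) (evalFun f₂)

/-- The function `g ↦ (f₁ ⊗ f₂)((g ⊗ g) x)` on `G`. With `x = J(χ)` this formula gives the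
multiplication of `B_χ` as well as the left and right actions on the bimodules `F_ψ[G]`. -/
def starMul (x : MonoidAlgebra k G ⊗[k] MonoidAlgebra k G) (f₁ f₂ : G → k) : G → k := fun g =>
  evalFun₂ f₁ f₂ ((MonoidAlgebra.of k G g ⊗ₜ[k] MonoidAlgebra.of k G g) * x)

/-- `F_χ[G]`, the functions with `f(ha) = f(h) χ(a)` for `h ∈ G`, `a ∈ A`. -/
def weightFun (χ : Dual k A) : Submodule k (G → k) where
  carrier := {f | ∀ (h : G) (a : A), f (h * a) = f h * ((χ a : kˣ) : k)}
  add_mem' hf hg h a := by simp [hf h a, hg h a, add_mul]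
  zero_mem' h a := by simp
  smul_mem' c f hf h a := by simp [hf h a, mul_assoc]

/-- The action of `G` on functions, `(g ∘ f)(x) = f(g⁻¹ x)`. -/
def shift (g : G) : (G → k) →ₗ[k] (G → k) :=
  LinearMap.funLeft k k fun x => g⁻¹ * x

/-- Two-sided ideals of the algebra `B_χ`, which is the space `F_0[G]` of right `A`-invariant
functions with the multiplication `f₁ *_χ f₂ (g) = (f₁ ⊗ f₂)((g ⊗ g) J(χ))`. -/
def IsTwoSidedIdeal (J : DynamicalTwist k A) (χ : Dual k A) (I : Submodule k (G → k)) : Prop :=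
  I ≤ weightFun (1 : Dual k A) ∧
    ∀ f ∈ weightFun (1 : Dual k A), ∀ x ∈ I,
      starMul (J.J χ) f x ∈ I ∧ starMul (J.J χ) x f ∈ I

/-- Minimal (nonzero) two-sided ideals of `B_χ`. -/
def IsMinimalIdeal (J : DynamicalTwist k A) (χ : Dual k A) : Submodule k (G → k) → Prop :=
  Minimal fun I => IsTwoSidedIdeal J χ I ∧ I ≠ ⊥

/-- Given minimal ideals `B_χ^i = I χ` of `B_χ`, the bimodule
`F^i_{χψ} = B_χ^i F_{ψ-χ}[G] B_ψ^i` inside the `B_χ`-`B_ψ`-bimodule `F_{ψ-χ}[G]`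
(both actions are given by `J(ψ)`). -/
def blockBimodule (J : DynamicalTwist k A) (I : Dual k A → Submodule k (G → k))
    (χ ψ : Dual k A) : Submodule k (G → k) :=
  Submodule.span k {y | ∃ f ∈ I χ, ∃ x ∈ weightFun (ψ / χ), ∃ f' ∈ I ψ,
    y = starMul (J.J ψ) (starMul (J.J ψ) f x) f'}

/-- A linear map `a : B_χ → End_k V` is a module structure on `V` over the (unital, associative)
algebra `B_χ`; the unit of `B_χ` is the constant function `1`. -/
def IsModuleAction (J : DynamicalTwist k A) (χ : Dual k A) {V : Type*} [AddCommGroup V]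
    [Module k V] (a : weightFun (1 : Dual k A) →ₗ[k] Module.End k V) : Prop :=
  (∀ e : weightFun (1 : Dual k A), (∀ g, (e : G → k) g = 1) → a e = 1) ∧
    ∀ f₁ f₂ f₃ : weightFun (1 : Dual k A),
      (f₃ : G → k) = starMul (J.J χ) f₁ f₂ → a f₃ = a f₁ * a f₂

/-- `V` is a simple module over the ideal `I` of `B_χ`: it is a simple `B_χ`-module on which `I`
acts non-trivially. -/
def IsSimpleOver (J : DynamicalTwist k A) (χ : Dual k A) (I : Submodule k (G → k)) {V : Type*}
    [AddCommGroup V] [Module k V] (a : weightFun (1 : Dual k A) →ₗ[k] Module.End k V) : Prop :=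
  IsModuleAction J χ a ∧ Nontrivial V ∧
    (∀ W : Submodule k V, (∀ f, ∀ x ∈ W, a f x ∈ W) → W = ⊥ ∨ W = ⊤) ∧
    ∃ f : weightFun (1 : Dual k A), (f : G → k) ∈ I ∧ a f ≠ 0

/-- The dynamical datum `𝒟` is obtained from the dynamical twist `J`: there are

* minimal two-sided ideals `I χ = B_χ^i` of the algebras `B_χ`, which correspond to each other under
  the identification of the sets of minimal ideals by means of the bimodules `F_{ψ-χ}[G]`
  (that is, a simple constituent of `F_{ψ-χ}[G]` belongs to `I χ` on the left and to `I ψ` on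
  the right), whose stabilizer in `G` is `K`;
* structures `a χ` of simple `B_χ^i`-modules on `V_χ` such that `g ∈ K` acts on
  `B_χ^i ≅ End_k V_χ` by `Ad π_χ(g)`;
* isomorphisms `σ χ ψ : V_χ ⊗ V_ψ^* ≅ F^i_{χψ}` of `B_χ^i`-`B_ψ^i`-bimodules that are
  also isomorphisms of representations of `K`. -/
def IsDatumOf (J : DynamicalTwist k A) (𝒟 : DynamicalDatum k A) : Prop :=
  ∃ (I : Dual k A → Submodule k (G → k))
    (a : ∀ χ, weightFun (1 : Dual k A) →ₗ[k] Module.End k (𝒟.V χ))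
    (σ : ∀ χ ψ, (𝒟.V ψ →ₗ[k] 𝒟.V χ) →ₗ[k] (G → k)),
    (∀ χ, IsMinimalIdeal J χ (I χ)) ∧
    (∀ χ ψ, blockBimodule J I χ ψ ≠ ⊥) ∧
    (∀ χ g, g ∈ 𝒟.K ↔ (I χ).map (shift g) = I χ) ∧
    (∀ χ, IsSimpleOver J χ (I χ) (a χ)) ∧
    (∀ χ (g : 𝒟.K) (f f' : weightFun (1 : Dual k A)), (f : G → k) ∈ I χ →
      (f' : G → k) = shift (g : G) (f : G → k) →
        a χ f' = (𝒟.π χ g).arrowCongr (𝒟.π χ g) (a χ f)) ∧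
    (∀ χ ψ, Function.Injective (σ χ ψ) ∧
      LinearMap.range (σ χ ψ) = blockBimodule J I χ ψ) ∧
    (∀ χ ψ (f : weightFun (1 : Dual k A)) (T : 𝒟.V ψ →ₗ[k] 𝒟.V χ),
      σ χ ψ (a χ f ∘ₗ T) = starMul (J.J ψ) f (σ χ ψ T)) ∧
    (∀ χ ψ (f : weightFun (1 : Dual k A)) (T : 𝒟.V ψ →ₗ[k] 𝒟.V χ),
      σ χ ψ (T ∘ₗ a ψ f) = starMul (J.J ψ) (σ χ ψ T) f) ∧
    (∀ χ ψ (g : 𝒟.K) (T : 𝒟.V ψ →ₗ[k] 𝒟.V χ),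
      σ χ ψ (𝒟.homRep χ ψ g T) = shift (g : G) (σ χ ψ T))

/-! ### From data to twists: the exchange construction -/

/-- The weight subspace `X[χ]` of a `G`-module `X`. -/
def weightSpace {X : Type*} [AddCommGroup X] [Module k X] (ρ : Representation k G X)
    (χ : Dual k A) : Submodule k X where
  carrier := {x | ∀ a : A, ρ a x = ((χ a : kˣ) : k) • x}
  add_mem' hx hy a := by simp [hx a, hy a]
  zero_mem' a := by simp
  smul_mem' c x hx a := by simp [hx a, smul_comm c]

/-- Frobenius reciprocity `X[χ] ≅ Hom_G(Ind_A^G χ, X)`: the `G`-homomorphism that sends the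
generator `1 ⊗ 1` of `Ind_A^G χ` to `x`. (In the model of `Ind` used here, `IndV.mk g c` is
the element `g⁻¹ ⊗ c` of `k[G] ⊗_{k[A]} k`.) -/
def frobeniusHom {X : Type*} [AddCommGroup X] [Module k X] (ρ : Representation k G X)
    (χ : Dual k A) (x : weightSpace ρ χ) :
    Representation.IndV A.subtype (charRep χ) →ₗ[k] X :=
  Representation.Coinvariants.lift _
    (TensorProduct.lift <|
      (Finsupp.lift (k →ₗ[k] X) k G fun g => LinearMap.toSpanSingleton k X (ρ g⁻¹ (x : X))) ∘ₗ
        (MonoidAlgebra.coeffLinearEquiv k).toLinearMap)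
    (fun a => by
      have hx : ρ (a : G)⁻¹ (x : X) = (((χ a)⁻¹ : kˣ) : k) • (x : X) := by
        simpa using x.2 a⁻¹
      ext g
      simp [charRep, hx, Representation.ofMulAction_single])

/-- A choice, for all `χ, ψ`, of isomorphisms
`ε_{χψ} : Ind_K^G (V_χ ⊗ V_ψ^*) ≅ Ind_A^G (χ - ψ)` of `G`-modules. -/
abbrev IndIsos (𝒟 : DynamicalDatum k A) : Type _ :=
  ∀ χ ψ : Dual k A,
    (Representation.ind 𝒟.K.subtype (𝒟.homRep χ ψ)).Equiv
      (Representation.ind A.subtype (charRep (χ / ψ)))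

/-- The `K`-homomorphism `V_χ ⊗ V_ψ^* → X` that corresponds to `x ∈ X[χ - ψ]` under
`Hom_K(V_χ ⊗ V_ψ^*, X) ≅ Hom_G(Ind_K^G(V_χ ⊗ V_ψ^*), X) ≅ Hom_G(Ind_A^G(χ - ψ), X) ≅ X[χ - ψ]`,
the middle isomorphism being given by `ε_{χψ}`. -/
def exchangeHom {𝒟 : DynamicalDatum k A} (ε : IndIsos 𝒟) (χ ψ : Dual k A)
    {X : Type*} [AddCommGroup X] [Module k X] (ρ : Representation k G X)
    (x : weightSpace ρ (χ / ψ)) : (𝒟.V ψ →ₗ[k] 𝒟.V χ) →ₗ[k] X :=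
  frobeniusHom ρ (χ / ψ) x ∘ₗ (ε χ ψ).toLinearMap ∘ₗ
    Representation.IndV.mk 𝒟.K.subtype (𝒟.homRep χ ψ) 1

/-- The homomorphism `Ψ(χ, x) : V_χ → V_ψ ⊗ X` determined by `x ∈ X[χ - ψ]`: it corresponds to
`exchangeHom` under `Hom(V_χ, V_ψ ⊗ X) ≅ Hom(V_χ ⊗ V_ψ^*, X)`, i.e.
`v ↦ ∑_i b_i ⊗ F(v ⊗ b_i^*)` for dual bases `b_i`, `b_i^*` of `V_ψ`, `V_ψ^*`. -/
def Psi {𝒟 : DynamicalDatum k A} (ε : IndIsos 𝒟) (χ ψ : Dual k A)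
    {X : Type*} [AddCommGroup X] [Module k X] (ρ : Representation k G X)
    (x : weightSpace ρ (χ / ψ)) : 𝒟.V χ →ₗ[k] 𝒟.V ψ ⊗[k] X :=
  ∑ i, TensorProduct.mk k (𝒟.V ψ) X (Module.finBasis k (𝒟.V ψ) i) ∘ₗ
    exchangeHom ε χ ψ ρ x ∘ₗ LinearMap.smulRightₗ ((Module.finBasis k (𝒟.V ψ)).coord i)

/-- The action of `k[G] ⊗ k[G]` on `Y ⊗ X` for `G`-modules `Y` and `X`. -/
def tensorAct {Y X : Type*} [AddCommGroup Y] [Module k Y] [AddCommGroup X] [Module k X]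
    (ρY : Representation k G Y) (ρX : Representation k G X) :
    MonoidAlgebra k G ⊗[k] MonoidAlgebra k G →ₐ[k] Module.End k (Y ⊗[k] X) :=
  (Module.endTensorEndAlgHom (R := k) (S := k) (A := k) (M := Y) (N := X)).comp
    (Algebra.TensorProduct.map ρY.asAlgebraHom ρX.asAlgebraHom)

theorem one_mem_weightSpace (χ : Dual k A) :
    (1 : k) ∈ weightSpace (Representation.trivial k G k) (χ / χ) := by
  intro a
  simp

/-- The dynamical twist `J` is obtained from the dynamical datum `𝒟` by the exchange construction:
for some choice of the isomorphisms `ε`, normalized so that `Ψ(χ, 1) : V_χ → V_χ ⊗ k` is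
`v ↦ v ⊗ 1` for the trivial `G`-module `k`, one has
`(Ψ(ψ, y) ⊗ id) ∘ Ψ(χ, x) = Ψ(χ, J(χ) (y ⊗ x))` as maps `V_χ → V_ω ⊗ Y ⊗ X`,
for all `G`-modules `X`, `Y` and all `x ∈ X[χ - ψ]`, `y ∈ Y[ψ - ω]`; in particular
`J(χ) (y ⊗ x)` lies in `(Y ⊗ X)[χ - ω]`. -/
def IsExchangeTwist (𝒟 : DynamicalDatum k A) (J : DynamicalTwist k A) : Prop :=
  ∃ ε : IndIsos 𝒟,
    (∀ χ (v : 𝒟.V χ),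
      Psi ε χ χ (Representation.trivial k G k) ⟨1, one_mem_weightSpace χ⟩ v = v ⊗ₜ[k] (1 : k)) ∧
    ∀ (X Y : Type (max u v)) [AddCommGroup X] [Module k X] [AddCommGroup Y] [Module k Y]
      (ρX : Representation k G X) (ρY : Representation k G Y) (χ ψ ω : Dual k A)
      (x : weightSpace ρX (χ / ψ)) (y : weightSpace ρY (ψ / ω)),
      ∃ hz : tensorAct ρY ρX (J.J χ) ((y : Y) ⊗ₜ[k] (x : X)) ∈
          weightSpace (ρY.tprod ρX) (χ / ω),
        (TensorProduct.assoc k (𝒟.V ω) Y X).toLinearMap ∘ₗ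
            (Psi ε ψ ω ρY y).rTensor X ∘ₗ Psi ε χ ψ ρX x =
          Psi ε χ ω (ρY.tprod ρX) ⟨_, hz⟩

/-! ### Equivalence classes -/

theorem of_mul_charIdem [Finite G] (χ : Dual k A) (a : A) :
    MonoidAlgebra.of k G a * charIdem χ = ((χ a : kˣ) : k) • charIdem χ := by
  have := Fintype.ofFinite A
  rw [charIdem, finsum_eq_sum_of_fintype, mul_smul_comm, smul_comm]
  congr 1
  rw [Finset.mul_sum, Finset.smul_sum]
  refine Fintype.sum_equiv (Equiv.mulLeft a) _ _ fun b => ?_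
  simp [MonoidAlgebra.single_mul_single, mul_comm ((χ b : kˣ) : k)⁻¹]

theorem charIdem_mul_charIdem [Finite G] [CharZero k] (χ ψ : Dual k A) [Decidable (χ = ψ)] :
    charIdem χ * charIdem ψ = if χ = ψ then charIdem ψ else 0 := by
  have hc : (Nat.card A : k) ≠ 0 := by exact_mod_cast Nat.card_pos.ne'
  have := Fintype.ofFinite A
  have h1 : charIdem χ * charIdem ψ =
      ((Nat.card A : k)⁻¹ * ∑ a : A, (((χ⁻¹ * ψ) a : kˣ) : k)) • charIdem ψ := by
    conv_lhs => rw [charIdem, finsum_eq_sum_of_fintype]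
    rw [smul_mul_assoc, mul_smul, Finset.sum_mul, Finset.sum_smul]
    congr 1
    refine Finset.sum_congr rfl fun a _ => ?_
    have : MonoidAlgebra.single (a : G) (((χ a)⁻¹ : kˣ) : k) =
        (((χ a)⁻¹ : kˣ) : k) • MonoidAlgebra.of k G a := by simp
    rw [this, smul_mul_assoc, of_mul_charIdem, smul_smul]
    simp
  rw [h1]
  split_ifs with h
  · subst h
    simp [Nat.card_eq_fintype_card] at hc ⊢
  · obtain ⟨b, hb⟩ : ∃ b, (χ⁻¹ * ψ) b ≠ 1 := by
      by_contra! hcon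
      exact h (by
        have : χ⁻¹ * ψ = 1 := MonoidHom.ext hcon
        exact inv_mul_eq_one.1 this)
    have : ∑ a : A, (((χ⁻¹ * ψ) a : kˣ) : k) = 0 := by
      have key : (((χ⁻¹ * ψ) b : kˣ) : k) * ∑ a : A, (((χ⁻¹ * ψ) a : kˣ) : k) =
          ∑ a : A, (((χ⁻¹ * ψ) a : kˣ) : k) := by
        rw [Finset.mul_sum]
        refine Fintype.sum_equiv (Equiv.mulLeft b) _ _ fun a => ?_
        rw [Equiv.coe_mulLeft, map_mul, Units.val_mul]
      have hb' : (((χ⁻¹ * ψ) b : kˣ) : k) - 1 ≠ 0 := by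
        intro h0
        exact hb (Units.ext (by simpa using sub_eq_zero.1 h0))
      have := sub_eq_zero.2 key
      rw [← sub_one_mul] at this
      exact (mul_eq_zero.1 this).resolve_left hb'
    rw [this]
    simp

theorem sum_charIdem [Finite G] [CharZero k] [IsAlgClosed k] [IsMulCommutative A]
    [Fintype (Dual k A)] : ∑ χ : Dual k A, charIdem χ = 1 := by
  classical
  have hc : (Nat.card A : k) ≠ 0 := by exact_mod_cast Nat.card_pos.ne'
  have := Fintype.ofFinite A
  let _ : CommGroup A := { mul_comm := fun a b => mul_comm' a b }
  have : NeZero ((Monoid.exponent A : ℕ) : k) :=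
    ⟨by exact_mod_cast Monoid.exponent_ne_zero_of_finite⟩
  have horth : ∀ a : A, ∑ χ : Dual k A, (((χ a)⁻¹ : kˣ) : k) =
      if a = 1 then (Nat.card A : k) else 0 := by
    intro a
    split_ifs with h
    · subst h
      have := CommGroup.card_monoidHom_of_hasEnoughRootsOfUnity A k
      rw [← this, Nat.card_eq_fintype_card]
      simp
    · obtain ⟨ψ, hψ⟩ := CommGroup.exists_apply_ne_one_of_hasEnoughRootsOfUnity A k h
      have key : (((ψ a)⁻¹ : kˣ) : k) * ∑ χ : Dual k A, (((χ a)⁻¹ : kˣ) : k) =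
          ∑ χ : Dual k A, (((χ a)⁻¹ : kˣ) : k) := by
        rw [Finset.mul_sum]
        refine Fintype.sum_equiv (Equiv.mulLeft ψ) _ _ fun χ => ?_
        simp [mul_comm]
      have hb' : (((ψ a)⁻¹ : kˣ) : k) - 1 ≠ 0 := by
        intro h0
        exact hψ (inv_eq_one.1 (Units.ext (by simpa using sub_eq_zero.1 h0)))
      have := sub_eq_zero.2 key
      rw [← sub_one_mul] at this
      exact (mul_eq_zero.1 this).resolve_left hb'
  simp only [charIdem, finsum_eq_sum_of_fintype]
  rw [← Finset.smul_sum, Finset.sum_comm]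
  have : ∀ a : A, ∑ χ : Dual k A, MonoidAlgebra.single (a : G) (((χ a)⁻¹ : kˣ) : k) =
      (if a = 1 then (Nat.card A : k) else 0) • MonoidAlgebra.single (a : G) (1 : k) := by
    intro a
    rw [← horth, Finset.sum_smul]
    exact Finset.sum_congr rfl fun χ _ => by simp
  rw [Finset.sum_congr rfl fun a _ => this a, Finset.sum_eq_single 1]
  · rw [if_pos rfl, smul_smul, inv_mul_cancel₀ hc, one_smul]
    rfl
  · intro a _ ha
    rw [if_neg ha, zero_smul]
  · simp

theorem ZeroWeight₁.charIdem_comm [Finite G] {x : Dual k A → MonoidAlgebra k G} (hx : ZeroWeight₁ x)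
    (χ ψ : Dual k A) : charIdem ψ * x χ = x χ * charIdem ψ := by
  have := Fintype.ofFinite A
  rw [charIdem, finsum_eq_sum_of_fintype, smul_mul_assoc, mul_smul_comm, Finset.sum_mul,
    Finset.mul_sum]
  congr 1
  refine Finset.sum_congr rfl fun a _ => ?_
  have : MonoidAlgebra.single (a : G) (((ψ a)⁻¹ : kˣ) : k) =
      (((ψ a)⁻¹ : kˣ) : k) • MonoidAlgebra.of k G a := by simp
  rw [this, smul_mul_assoc, mul_smul_comm, hx]

theorem gaugeTensor_one [Finite G] [CharZero k] [IsAlgClosed k] [IsMulCommutative A]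
    (χ : Dual k A) : gaugeTensor (1 : Dual k A → (MonoidAlgebra k G)ˣ) χ = 1 := by
  have := Fintype.ofFinite (Dual k A)
  simp only [gaugeTensor, shiftByWeight, finsum_eq_sum_of_fintype, Pi.one_apply, Units.val_one]
  rw [← TensorProduct.tmul_sum, sum_charIdem, ← Algebra.TensorProduct.one_def, one_mul]

theorem gaugeTensor_mul [Finite G] [CharZero k] {t s : Dual k A → (MonoidAlgebra k G)ˣ}
    (ht : IsGauge t) (χ : Dual k A) :
    gaugeTensor (t * s) χ = gaugeTensor t χ * gaugeTensor s χ := by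
  classical
  have := Fintype.ofFinite (Dual k A)
  simp only [gaugeTensor, shiftByWeight, finsum_eq_sum_of_fintype, Pi.mul_apply, Units.val_mul]
  have hcomm : ∀ ψ : Dual k A, charIdem ψ * (t χ : MonoidAlgebra k G) = t χ * charIdem ψ :=
    fun ψ => ZeroWeight₁.charIdem_comm ht.1 χ ψ
  simp only [Finset.sum_mul, Finset.mul_sum, Algebra.TensorProduct.tmul_mul_tmul, mul_one]
  refine Finset.sum_congr rfl fun ψ _ => ?_
  have : ∀ ω : Dual k A, charIdem ω * (t χ : MonoidAlgebra k G) * (charIdem ψ * s χ) =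
      if ω = ψ then charIdem ψ * (t χ * s χ : MonoidAlgebra k G) else 0 := by
    intro ω
    rw [hcomm ω, mul_assoc, ← mul_assoc (charIdem ω), charIdem_mul_charIdem]
    split_ifs with h
    · rw [← mul_assoc, ← hcomm ψ, mul_assoc]
    · simp
  simp only [this]
  rw [Finset.sum_eq_single ψ]
  · simp
  · intro ω _ h
    simp [h]
  · simp

theorem IsGauge.one : IsGauge (1 : Dual k A → (MonoidAlgebra k G)ˣ) :=
  ⟨fun χ a => by simp, fun χ => by simp⟩

theorem IsGauge.mul {t s : Dual k A → (MonoidAlgebra k G)ˣ} (ht : IsGauge t) (hs : IsGauge s) :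
    IsGauge (t * s) := by
  refine ⟨fun χ a => ?_, fun χ => ?_⟩
  · have h1 := ht.1 χ a
    have h2 := hs.1 χ a
    simp only [Pi.mul_apply, Units.val_mul] at h1 h2 ⊢
    rw [← mul_assoc, h1, mul_assoc, h2, mul_assoc]
  · rw [Pi.mul_apply, Units.val_mul, map_mul, ht.2, hs.2, mul_one]

theorem IsGauge.inv {t : Dual k A → (MonoidAlgebra k G)ˣ} (ht : IsGauge t) : IsGauge t⁻¹ := by
  refine ⟨fun χ a => ?_, fun χ => ?_⟩
  · have h1 : Commute (MonoidAlgebra.of k G (a : G)) (t χ : MonoidAlgebra k G) := ht.1 χ a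
    exact h1.units_inv_right
  · have h := congrArg (Bialgebra.counitAlgHom k (MonoidAlgebra k G)) (t χ).mul_inv
    rw [map_mul, ht.2, one_mul, map_one] at h
    exact h

/-- Gauge equivalence of dynamical twists is an equivalence relation. -/
def gaugeSetoid (k : Type u) [Field k] [IsAlgClosed k] [CharZero k] {G : Type v} [Group G]
    [Finite G] (A : Subgroup G) [IsMulCommutative A] : Setoid (DynamicalTwist k A) where
  r := GaugeEquivalent
  iseqv :=
    { refl := fun J => ⟨1, IsGauge.one, fun χ => by
        rw [gaugeTensor_one]; simp⟩
      symm := by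
        rintro J J' ⟨t, ht, h⟩
        refine ⟨t⁻¹, ht.inv, fun χ => ?_⟩
        have h1 : gaugeTensor t χ * gaugeTensor t⁻¹ χ = 1 := by
          rw [← gaugeTensor_mul ht, mul_inv_cancel, gaugeTensor_one]
        rw [h χ, mul_assoc, mul_assoc, h1, mul_one, ← mul_assoc, ← map_mul]
        simp
      trans := by
        rintro J J' J'' ⟨t, ht, h⟩ ⟨s, hs, h'⟩
        refine ⟨t * s, ht.mul hs, fun χ => ?_⟩
        rw [h' χ, h χ, gaugeTensor_mul ht, Pi.mul_apply, mul_inv_rev, Units.val_mul, map_mul]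
        simp only [mul_assoc] }

/-- Isomorphism of dynamical data is an equivalence relation. -/
def datumSetoid (k : Type u) [Field k] {G : Type v} [Group G] (A : Subgroup G) :
    Setoid (DynamicalDatum k A) where
  r := DatumIso
  iseqv :=
    { refl := fun 𝒟 => ⟨1, fun h => by simp, fun χ => LinearEquiv.refl k _, 1, fun χ h v => by
        simp⟩
      symm := by
        rintro 𝒟 𝒟' ⟨g, hK, φ, α, h⟩
        have hK' : ∀ x : G, x ∈ 𝒟'.K ↔ g⁻¹ * x * g⁻¹⁻¹ ∈ 𝒟.K := fun x => by
          rw [hK, show g * (g⁻¹ * x * g⁻¹⁻¹) * g⁻¹ = x by group]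
        refine ⟨g⁻¹, hK', fun χ => (φ χ).symm,
          fun x => (α ⟨g⁻¹ * x * g⁻¹⁻¹, (hK' x).1 x.2⟩)⁻¹, fun χ x v => ?_⟩
        have h1 := h χ ⟨g⁻¹ * x * g⁻¹⁻¹, (hK' x).1 x.2⟩ ((φ χ).symm v)
        have hx : (⟨g * (g⁻¹ * x * g⁻¹⁻¹) * g⁻¹,
            (hK _).1 ((hK' x).1 x.2)⟩ : 𝒟'.K) = x := Subtype.ext (by group)
        simp only [hx, LinearEquiv.apply_symm_apply] at h1
        rw [h1, map_smul, LinearEquiv.symm_apply_apply, smul_smul, ← Units.val_mul,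
          inv_mul_cancel, Units.val_one, one_smul]
      trans := by
        rintro 𝒟 𝒟' 𝒟'' ⟨g, hK, φ, α, h⟩ ⟨g', hK', φ', α', h'⟩
        have hK'' : ∀ x : G, x ∈ 𝒟.K ↔ g' * g * x * (g' * g)⁻¹ ∈ 𝒟''.K := fun x => by
          rw [hK, hK', show g' * (g * x * g⁻¹) * g'⁻¹ = g' * g * x * (g' * g)⁻¹ by group]
        refine ⟨g' * g, hK'', fun χ => (φ χ).trans (φ' χ),
          fun x => α' ⟨g * x * g⁻¹, (hK x).1 x.2⟩ * α x, fun χ x v => ?_⟩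
        have h1 := h χ x v
        have h2 := h' χ ⟨g * x * g⁻¹, (hK x).1 x.2⟩ (φ χ v)
        have hx : (⟨g' * (g * x * g⁻¹) * g'⁻¹, (hK' _).1 ((hK x).1 x.2)⟩ : 𝒟''.K) =
            ⟨g' * g * x * (g' * g)⁻¹, (hK'' x).1 x.2⟩ := Subtype.ext (by group)
        simp only [hx] at h2
        rw [LinearEquiv.trans_apply, h2, h1, map_smul, smul_smul, Units.val_mul,
          LinearEquiv.trans_apply] }

/-- Gauge equivalence classes of dynamical twists. -/
abbrev TwistClass (k : Type u) [Field k] [IsAlgClosed k] [CharZero k] {G : Type v} [Group G]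
    [Finite G] (A : Subgroup G) [IsMulCommutative A] : Type _ :=
  Quotient (gaugeSetoid k A)

/-- Isomorphism classes of dynamical data. -/
abbrev DatumClass (k : Type u) [Field k] {G : Type v} [Group G] (A : Subgroup G) : Type _ :=
  Quotient (datumSetoid k A)

end DynTwist

end

open scoped TensorProduct

set_option linter.unusedSectionVars false

noncomputable section

namespace DynTwist

universe u v w

variable {k : Type u} [Field k] {G : Type v} [Group G] {A : Subgroup G}

/-! ### Functionals on `k[G]` and its tensor powers -/

/-! A twist J makes the spaces F_{ψ-χ}[G] the morphism spaces of a k-linear category with object set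
A^*. Composition F_{ψ-χ}[G] × F_{ω-ψ}[G] → F_{ω-χ}[G] is the product defined by J(ω), the dynamical
equation is its associativity (`starMul_assoc`), the counit conditions say that the constant
function 1 is a unit, and G acts by left translations. For fixed ω the pairs (ψ-χ, ω-ψ) run through
all pairs of weights, so these products determine J(ω).

Both constructions are compared with one relation between twists and data, `HasFiberRep J 𝒟`: there
are multiplicative maps τ_{χψ} : F_{ψ-χ}[G] → Hom(V_ψ, V_χ) such that f ↦ (g ↦ τ_{χψ}(g ∘ f))
identifies F_{ψ-χ}[G] with the K-equivariant functions on G, that is, with the coinduced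
representation. Thus the category is coinduced from the full matrix category of the V_χ with its
action of K.

This relation is the same as `IsDatumOf` (`isDatumOf_iff`): functions supported on K form the
minimal ideals and the bimodules between them. It is also the same as `IsExchangeTwist`
(`isExchangeTwist_iff`): under the trace pairing, τ_{χψ} is the transpose of a map u_{χψ} : Hom(V_χ,
V_ψ) → k[G]. The conditions on τ as a fibre map translate into u coming from an isomorphism of
induced representations, and multiplicativity of τ becomes the exchange relation
(`IsDualFamily.map_mul_iff`).

The bijection is then formal, given four facts. Every twist has a datum (`exists_hasFiberRep`): a
simple module over the category gives surjective maps onto all Hom(V_ψ, V_χ) by Burnside's theorem,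
and invertibility of J, as a Galois property, shows that the translates of these maps have no common
kernel. Every datum has a twist (`exists_twist_hasFiberRep`): composition of equivariant functions
is transported to functions on G, and Schur orthogonality proves that the resulting J is invertible.
Two data of one twist are isomorphic (`HasFiberRep.datumIso`), because a translate of one
representation has the same kernel as the other. Two twists of one datum are gauge equivalent
(`HasFiberRep.gaugeEquivalent`), because two fibre maps differ by right multiplication with elements
t(ψ) of k[G]. -/

@[simp]
theorem evalFun_single (f : G → k) (g : G) (c : k) :
    evalFun f (MonoidAlgebra.single g c) = c * f g := by
  simp [evalFun]

@[simp]
theorem evalFun_of (f : G → k) (g : G) : evalFun f (MonoidAlgebra.of k G g) = f g := by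
  simp

theorem monoidAlgebra_induction {p : MonoidAlgebra k G → Prop} (x : MonoidAlgebra k G)
    (of : ∀ g, p (MonoidAlgebra.of k G g)) (add : ∀ x y, p x → p y → p (x + y))
    (smul : ∀ (c : k) x, p x → p (c • x)) : p x := by
  induction x using MonoidAlgebra.induction_on with
  | of g => exact of g
  | add x y hx hy => exact add x y hx hy
  | smul c x hx => exact smul c x hx

theorem tensor_induction {p : MonoidAlgebra k G ⊗[k] MonoidAlgebra k G → Prop}
    (x : MonoidAlgebra k G ⊗[k] MonoidAlgebra k G)
    (of : ∀ g h, p (MonoidAlgebra.of k G g ⊗ₜ[k] MonoidAlgebra.of k G h))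
    (add : ∀ x y, p x → p y → p (x + y)) (smul : ∀ (c : k) x, p x → p (c • x)) : p x := by
  induction x using TensorProduct.induction_on with
  | zero => simpa using smul 0 _ (of 1 1)
  | add x y hx hy => exact add x y hx hy
  | tmul x y =>
    induction x using monoidAlgebra_induction with
    | add x y hx hy => rw [TensorProduct.add_tmul]; exact add _ _ hx hy
    | smul c x hx => rw [← TensorProduct.smul_tmul']; exact smul _ _ hx
    | of g =>
      induction y using monoidAlgebra_induction with
      | add x y hx hy => rw [TensorProduct.tmul_add]; exact add _ _ hx hy
      | smul c x hx => rw [TensorProduct.tmul_smul]; exact smul _ _ hx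
      | of h => exact of g h

theorem evalFun_add (f f' : G → k) (x : MonoidAlgebra k G) :
    evalFun (f + f') x = evalFun f x + evalFun f' x := by
  induction x using monoidAlgebra_induction with
  | of g => simp only [evalFun_of, Pi.add_apply]
  | add x y hx hy => rw [map_add, hx, hy, map_add, map_add]; ring
  | smul c x hx => rw [map_smul, hx, map_smul, map_smul, smul_add]

theorem evalFun_smul (c : k) (f : G → k) (x : MonoidAlgebra k G) :
    evalFun (c • f) x = c * evalFun f x := by
  induction x using monoidAlgebra_induction with
  | of g => simp only [evalFun_of, Pi.smul_apply, smul_eq_mul]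
  | add x y hx hy => rw [map_add, hx, hy, map_add]; ring
  | smul d x hx => rw [map_smul, hx, map_smul, smul_eq_mul, smul_eq_mul]; ring

/-- The pairing `(G → k) × k[G] → k`. -/
def evalPairing (k : Type u) [Field k] (G : Type v) [Group G] :
    (G → k) →ₗ[k] MonoidAlgebra k G →ₗ[k] k where
  toFun := evalFun
  map_add' f f' := LinearMap.ext fun x => evalFun_add f f' x
  map_smul' c f := LinearMap.ext fun x => evalFun_smul c f x

@[simp]
theorem evalPairing_apply (f : G → k) : evalPairing k G f = evalFun f := rfl

theorem evalFun_sum {ι : Type*} (s : Finset ι) (f : ι → G → k) (x : MonoidAlgebra k G) :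
    evalFun (∑ i ∈ s, f i) x = ∑ i ∈ s, evalFun (f i) x := by
  simp only [← evalPairing_apply, map_sum, LinearMap.sum_apply]

theorem evalFun_ext {x y : MonoidAlgebra k G} (h : ∀ f : G → k, evalFun f x = evalFun f y) :
    x = y := by
  classical
  have key : ∀ (g : G) (z : MonoidAlgebra k G), evalFun (Pi.single g 1) z = z.coeff g := by
    intro g z
    induction z using monoidAlgebra_induction with
    | of a => simp [Pi.single_apply, Finsupp.single_apply, eq_comm]
    | add x y hx hy => simp [hx, hy]
    | smul c x hx => simp [hx]
  ext g
  rw [← key, ← key, h]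

/-- The functional on `k[G]` corresponding to a function, in the other direction. -/
theorem evalFun_of_functional (Φ : MonoidAlgebra k G →ₗ[k] k) (x : MonoidAlgebra k G) :
    evalFun (fun g => Φ (MonoidAlgebra.of k G g)) x = Φ x := by
  induction x using monoidAlgebra_induction with
  | of g => simp only [evalFun_of]
  | add x y hx hy => rw [map_add, hx, hy, map_add]
  | smul c x hx => rw [map_smul, hx, map_smul]

@[simp]
theorem evalFun₂_tmul (f₁ f₂ : G → k) (x y : MonoidAlgebra k G) :
    evalFun₂ f₁ f₂ (x ⊗ₜ[k] y) = evalFun f₁ x * evalFun f₂ y := by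
  simp [evalFun₂]

/-- The functional `f₁ ⊗ f₂ ⊗ f₃` on `k[G] ⊗ k[G] ⊗ k[G]`. -/
def evalFun₃ (f₁ f₂ f₃ : G → k) :
    MonoidAlgebra k G ⊗[k] (MonoidAlgebra k G ⊗[k] MonoidAlgebra k G) →ₗ[k] k :=
  LinearMap.mul' k k ∘ₗ TensorProduct.map (evalFun f₁) (evalFun₂ f₂ f₃)

@[simp]
theorem evalFun₃_tmul (f₁ f₂ f₃ : G → k) (x : MonoidAlgebra k G)
    (y : MonoidAlgebra k G ⊗[k] MonoidAlgebra k G) :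
    evalFun₃ f₁ f₂ f₃ (x ⊗ₜ[k] y) = evalFun f₁ x * evalFun₂ f₂ f₃ y := by
  simp [evalFun₃]

theorem evalFun₂_add_left (f f' h : G → k) :
    evalFun₂ (f + f') h = evalFun₂ f h + evalFun₂ f' h := by
  ext x y
  simp [add_mul]

theorem evalFun₂_add_right (h f f' : G → k) :
    evalFun₂ h (f + f') = evalFun₂ h f + evalFun₂ h f' := by
  ext x y
  simp [mul_add]

theorem evalFun₂_smul_left (c : k) (f h : G → k) : evalFun₂ (c • f) h = c • evalFun₂ f h := by
  ext x y
  simp [mul_assoc]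

theorem evalFun₂_smul_right (c : k) (h f : G → k) : evalFun₂ h (c • f) = c • evalFun₂ h f := by
  ext x y
  simp [mul_left_comm]

/-- The map `(f₁, f₂) ↦ f₁ ⊗ f₂` as a bilinear map. -/
def evalPairing₂ (k : Type u) [Field k] (G : Type v) [Group G] :
    (G → k) →ₗ[k] (G → k) →ₗ[k] (MonoidAlgebra k G ⊗[k] MonoidAlgebra k G →ₗ[k] k) :=
  LinearMap.mk₂ k evalFun₂ evalFun₂_add_left evalFun₂_smul_left evalFun₂_add_right
    evalFun₂_smul_right

@[simp]
theorem evalPairing₂_apply (f₁ f₂ : G → k) : evalPairing₂ k G f₁ f₂ = evalFun₂ f₁ f₂ := rfl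

theorem starMul_of_tmul_of (a b : G) (f₁ f₂ : G → k) (g : G) :
    starMul (MonoidAlgebra.of k G a ⊗ₜ[k] MonoidAlgebra.of k G b) f₁ f₂ g =
      f₁ (g * a) * f₂ (g * b) := by
  rw [starMul, Algebra.TensorProduct.tmul_mul_tmul, ← map_mul, ← map_mul, evalFun₂_tmul,
    evalFun_of, evalFun_of]

/-- `starMul x` as a bilinear map. -/
def starMulₗ (x : MonoidAlgebra k G ⊗[k] MonoidAlgebra k G) :
    (G → k) →ₗ[k] (G → k) →ₗ[k] (G → k) :=
  LinearMap.mk₂ k (starMul x)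
    (fun f f' h => by ext g; simp [starMul, evalFun₂_add_left])
    (fun c f h => by ext g; simp [starMul, evalFun₂_smul_left])
    (fun h f f' => by ext g; simp [starMul, evalFun₂_add_right])
    (fun c f h => by ext g; simp [starMul, evalFun₂_smul_right])

theorem starMulₗ_apply (x : MonoidAlgebra k G ⊗[k] MonoidAlgebra k G) (f₁ f₂ : G → k) :
    starMulₗ x f₁ f₂ = starMul x f₁ f₂ := rfl

theorem starMul_zero_left (x : MonoidAlgebra k G ⊗[k] MonoidAlgebra k G) (f : G → k) :
    starMul x 0 f = 0 := by
  rw [← starMulₗ_apply, map_zero, LinearMap.zero_apply]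

theorem starMul_zero_right (x : MonoidAlgebra k G ⊗[k] MonoidAlgebra k G) (f : G → k) :
    starMul x f 0 = 0 := by
  rw [← starMulₗ_apply, map_zero]

theorem starMul_sum_left {ι : Type*} (s : Finset ι)
    (x : MonoidAlgebra k G ⊗[k] MonoidAlgebra k G) (f : ι → G → k) (h : G → k) :
    starMul x (∑ i ∈ s, f i) h = ∑ i ∈ s, starMul x (f i) h := by
  simp only [← starMulₗ_apply, map_sum, LinearMap.sum_apply]

theorem starMul_sum_right {ι : Type*} (s : Finset ι)
    (x : MonoidAlgebra k G ⊗[k] MonoidAlgebra k G) (h : G → k) (f : ι → G → k) :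
    starMul x h (∑ i ∈ s, f i) = ∑ i ∈ s, starMul x h (f i) := by
  simp only [← starMulₗ_apply, map_sum]

theorem starMul_smul_left (c : k) (x : MonoidAlgebra k G ⊗[k] MonoidAlgebra k G) (f h : G → k) :
    starMul x (c • f) h = c • starMul x f h := by
  simp only [← starMulₗ_apply, map_smul, LinearMap.smul_apply]

theorem starMul_add (x y : MonoidAlgebra k G ⊗[k] MonoidAlgebra k G) (f h : G → k) :
    starMul (x + y) f h = starMul x f h + starMul y f h := by
  ext g
  simp [starMul, mul_add]

theorem starMul_smul (c : k) (x : MonoidAlgebra k G ⊗[k] MonoidAlgebra k G) (f h : G → k) :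
    starMul (c • x) f h = c • starMul x f h := by
  ext g
  simp only [starMul, mul_smul_comm, map_smul, Pi.smul_apply]

@[simp]
theorem shift_apply (g : G) (f : G → k) (x : G) : shift g f x = f (g⁻¹ * x) := rfl

theorem shift_one (f : G → k) : shift (1 : G) f = f := by
  ext x; simp

theorem shift_mul (g h : G) (f : G → k) : shift (g * h) f = shift g (shift h f) := by
  ext x; simp [mul_assoc]

theorem shift_starMul (g : G) (x : MonoidAlgebra k G ⊗[k] MonoidAlgebra k G) (f₁ f₂ : G → k) :
    shift g (starMul x f₁ f₂) = starMul x (shift g f₁) (shift g f₂) := by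
  induction x using tensor_induction with
  | of a b => ext x; simp only [shift_apply, starMul_of_tmul_of, mul_assoc]
  | add x y hx hy => rw [starMul_add, map_add, hx, hy, starMul_add]
  | smul c x hx => rw [starMul_smul, map_smul, hx, starMul_smul]

theorem evalFun_shift (g : G) (f : G → k) (x : MonoidAlgebra k G) :
    evalFun (shift g f) x = evalFun f (MonoidAlgebra.of k G g⁻¹ * x) := by
  induction x using monoidAlgebra_induction with
  | of h => rw [evalFun_of, ← map_mul, evalFun_of, shift_apply]
  | add x y hx hy => rw [map_add, hx, hy, mul_add, map_add]
  | smul c x hx => rw [map_smul, hx, mul_smul_comm, map_smul]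

theorem shift_mem_weightFun {χ : Dual k A} {f : G → k} (hf : f ∈ weightFun χ) (g : G) :
    shift g f ∈ weightFun χ := fun h a => by
  rw [shift_apply, shift_apply, ← mul_assoc, hf]

theorem one_mem_weightFun : (1 : G → k) ∈ weightFun (1 : Dual k A) := fun h a => by simp

theorem shift_const (g : G) : shift g (1 : G → k) = 1 := by
  ext x; simp

/-! ### Weights -/

theorem evalFun_mul_of {χ : Dual k A} {f : G → k} (hf : f ∈ weightFun χ) (x : MonoidAlgebra k G)
    (a : A) : evalFun f (x * MonoidAlgebra.of k G a) = ((χ a : kˣ) : k) * evalFun f x := by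
  induction x using monoidAlgebra_induction with
  | of g => rw [← map_mul, evalFun_of, evalFun_of, hf, mul_comm]
  | add x y hx hy => rw [add_mul, map_add, hx, hy, map_add]; ring
  | smul c x hx => rw [smul_mul_assoc, map_smul, hx, map_smul, smul_eq_mul, smul_eq_mul]; ring

theorem evalFun₂_mul_of {χ ψ : Dual k A} {f₁ f₂ : G → k} (h₁ : f₁ ∈ weightFun χ)
    (h₂ : f₂ ∈ weightFun ψ) (x : MonoidAlgebra k G ⊗[k] MonoidAlgebra k G) (a : A) :
    evalFun₂ f₁ f₂ (x * (MonoidAlgebra.of k G a ⊗ₜ[k] MonoidAlgebra.of k G a)) =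
      (((χ * ψ) a : kˣ) : k) * evalFun₂ f₁ f₂ x := by
  induction x using tensor_induction with
  | of g h =>
    rw [Algebra.TensorProduct.tmul_mul_tmul, evalFun₂_tmul, evalFun_mul_of h₁, evalFun_mul_of h₂,
      evalFun₂_tmul, MonoidHom.mul_apply, Units.val_mul]
    ring
  | add x y hx hy => rw [add_mul, map_add, hx, hy, map_add]; ring
  | smul c x hx => rw [smul_mul_assoc, map_smul, hx, map_smul, smul_eq_mul, smul_eq_mul]; ring

theorem starMul_mem_weightFun {J : Dual k A → MonoidAlgebra k G ⊗[k] MonoidAlgebra k G}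
    (hJ : ZeroWeight₂ J) (ω : Dual k A) {χ ψ : Dual k A} {f₁ f₂ : G → k}
    (h₁ : f₁ ∈ weightFun χ) (h₂ : f₂ ∈ weightFun ψ) :
    starMul (J ω) f₁ f₂ ∈ weightFun (χ * ψ) := fun g a => by
  rw [starMul, map_mul (MonoidAlgebra.of k G), ← Algebra.TensorProduct.tmul_mul_tmul, mul_assoc, hJ, ← mul_assoc,
    evalFun₂_mul_of h₁ h₂, mul_comm]
  rfl

/-! ### Decomposition of functions on a finite group into weight spaces. -/

section Finite

variable [Finite G]

theorem evalFun_mul_charIdem [CharZero k] {χ : Dual k A} {f : G → k} (hf : f ∈ weightFun χ)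
    (x : MonoidAlgebra k G) : evalFun f (x * charIdem χ) = evalFun f x := by
  have hc : (Nat.card A : k) ≠ 0 := by exact_mod_cast Nat.card_pos.ne'
  have := Fintype.ofFinite A
  have h : charIdem χ = (Nat.card A : k)⁻¹ •
      ∑ a : A, (((χ a)⁻¹ : kˣ) : k) • MonoidAlgebra.of k G (a : G) := by
    simp [charIdem, finsum_eq_sum_of_fintype]
  rw [h, mul_smul_comm, Finset.mul_sum, map_smul, map_sum]
  have : ∀ a : A, evalFun f (x * (((χ a)⁻¹ : kˣ) : k) • MonoidAlgebra.of k G (a : G)) =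
      evalFun f x := fun a => by
    rw [mul_smul_comm, map_smul, evalFun_mul_of hf, smul_eq_mul, ← mul_assoc]
    simp
  simp only [this, Finset.sum_const, Finset.card_univ, nsmul_eq_mul, smul_eq_mul]
  rw [← Nat.card_eq_fintype_card, ← mul_assoc, inv_mul_cancel₀ hc, one_mul]

theorem evalFun_mul_charIdem_of_ne [CharZero k] {χ ψ : Dual k A} {f : G → k}
    (hf : f ∈ weightFun χ) (h : χ ≠ ψ) (x : MonoidAlgebra k G) :
    evalFun f (x * charIdem ψ) = 0 := by
  classical
  rw [← evalFun_mul_charIdem hf, mul_assoc, charIdem_mul_charIdem, if_neg h.symm, mul_zero,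
    map_zero]

/-- The projection of the space of functions on `G` to the subspace `F_χ[G]`. -/
def weightProj (χ : Dual k A) : (G → k) →ₗ[k] (G → k) :=
  LinearMap.pi fun g => (evalPairing k G).flip (MonoidAlgebra.of k G g * charIdem χ)

theorem weightProj_apply (χ : Dual k A) (f : G → k) (g : G) :
    weightProj χ f g = evalFun f (MonoidAlgebra.of k G g * charIdem χ) := rfl

theorem weightProj_mem [IsMulCommutative A] (χ : Dual k A) (f : G → k) :
    weightProj χ f ∈ weightFun χ := fun h a => by
  rw [weightProj_apply, weightProj_apply, map_mul (MonoidAlgebra.of k G), mul_assoc, of_mul_charIdem, mul_smul_comm,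
    map_smul, smul_eq_mul, mul_comm]

theorem evalFun_weightProj (χ : Dual k A) (f : G → k) (x : MonoidAlgebra k G) :
    evalFun (weightProj χ f) x = evalFun f (x * charIdem χ) := by
  induction x using monoidAlgebra_induction with
  | of g => rw [evalFun_of, weightProj_apply]
  | add x y hx hy => rw [add_mul, map_add, hx, hy, map_add]
  | smul c x hx => rw [smul_mul_assoc, map_smul, hx, map_smul]

theorem weightProj_of_mem [CharZero k] {χ : Dual k A} {f : G → k} (hf : f ∈ weightFun χ) :
    weightProj χ f = f := by
  ext g
  rw [weightProj_apply, evalFun_mul_charIdem hf, evalFun_of]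

theorem sum_weightProj [CharZero k] [IsAlgClosed k] [IsMulCommutative A] [Fintype (Dual k A)]
    (f : G → k) : ∑ χ : Dual k A, weightProj χ f = f := by
  ext g
  rw [Finset.sum_apply]
  simp only [weightProj_apply]
  rw [← map_sum, ← Finset.mul_sum, sum_charIdem, mul_one, evalFun_of]

end Finite

/-! ### Quotients of characters -/

theorem dual_div_div_cancel (χ ψ : Dual k A) : χ / (χ / ψ) = ψ := div_div_cancel χ ψ

theorem dual_div_mul_div (χ ψ ω : Dual k A) : ψ / χ * (ω / ψ) = ω / χ :=
  (mul_comm (ψ / χ) (ω / ψ)).trans (div_mul_div_cancel ω ψ χ)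

theorem dual_div_self (χ : Dual k A) : χ / χ = 1 := div_self' χ

theorem dual_div_eq_one {χ ψ : Dual k A} : χ / ψ = 1 ↔ χ = ψ :=
  div_eq_one (a := χ) (b := ψ)

/-! ### The axioms of a twist in terms of the products of functions -/

/-- The product of functions is the transpose of x ↦ Δ(x) y. This is how every occurrence of Δ in
the axioms of a twist is turned into a product of functions. -/
theorem evalFun₂_comul (f₁ f₂ : G → k) (x : MonoidAlgebra k G)
    (y : MonoidAlgebra k G ⊗[k] MonoidAlgebra k G) :
    evalFun₂ f₁ f₂ (Bialgebra.comulAlgHom k (MonoidAlgebra k G) x * y) =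
      evalFun (starMul y f₁ f₂) x := by
  induction x using monoidAlgebra_induction with
  | of g =>
    rw [evalFun_of, starMul]
    simp
  | add x x' hx hx' => rw [map_add, add_mul, map_add, hx, hx', map_add]
  | smul c x hx => rw [map_smul, smul_mul_assoc, map_smul, hx, map_smul]

/-- The element `x^{12,3} y^{12}` of the triple tensor product. -/
def leftTriple (x y : MonoidAlgebra k G ⊗[k] MonoidAlgebra k G) :
    MonoidAlgebra k G ⊗[k] (MonoidAlgebra k G ⊗[k] MonoidAlgebra k G) :=
  Algebra.TensorProduct.assoc k k k (MonoidAlgebra k G) (MonoidAlgebra k G) (MonoidAlgebra k G)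
    (Algebra.TensorProduct.map (Bialgebra.comulAlgHom k (MonoidAlgebra k G))
      (AlgHom.id k (MonoidAlgebra k G)) x * (y ⊗ₜ[k] (1 : MonoidAlgebra k G)))

/-- The element `x^{1,23} y^{23}` of the triple tensor product. -/
def rightTriple (x y : MonoidAlgebra k G ⊗[k] MonoidAlgebra k G) :
    MonoidAlgebra k G ⊗[k] (MonoidAlgebra k G ⊗[k] MonoidAlgebra k G) :=
  Algebra.TensorProduct.map (AlgHom.id k (MonoidAlgebra k G))
    (Bialgebra.comulAlgHom k (MonoidAlgebra k G)) x * ((1 : MonoidAlgebra k G) ⊗ₜ[k] y)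

theorem evalFun₃_leftTriple (x y : MonoidAlgebra k G ⊗[k] MonoidAlgebra k G)
    (f₁ f₂ f₃ : G → k) :
    evalFun₃ f₁ f₂ f₃ (leftTriple x y) = evalFun₂ (starMul y f₁ f₂) f₃ x := by
  have key : ∀ (z : MonoidAlgebra k G ⊗[k] MonoidAlgebra k G) (w : MonoidAlgebra k G),
      evalFun₃ f₁ f₂ f₃ (Algebra.TensorProduct.assoc k k k (MonoidAlgebra k G)
        (MonoidAlgebra k G) (MonoidAlgebra k G) (z ⊗ₜ[k] w)) =
        evalFun₂ f₁ f₂ z * evalFun f₃ w := by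
    intro z w
    induction z using TensorProduct.induction_on with
    | zero => simp
    | tmul a b => simp [mul_assoc]
    | add a b ha hb => simp only [TensorProduct.add_tmul, map_add, ha, hb, add_mul]
  rw [leftTriple]
  induction x using TensorProduct.induction_on with
  | zero => simp
  | tmul a b =>
    rw [Algebra.TensorProduct.map_tmul, Algebra.TensorProduct.tmul_mul_tmul, key, evalFun₂_comul,
      evalFun₂_tmul]
    simp
  | add a b ha hb => simp only [map_add, add_mul, ha, hb]

theorem evalFun₃_rightTriple (x y : MonoidAlgebra k G ⊗[k] MonoidAlgebra k G)
    (f₁ f₂ f₃ : G → k) :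
    evalFun₃ f₁ f₂ f₃ (rightTriple x y) = evalFun₂ f₁ (starMul y f₂ f₃) x := by
  rw [rightTriple]
  induction x using TensorProduct.induction_on with
  | zero => simp
  | tmul a b =>
    rw [Algebra.TensorProduct.map_tmul, Algebra.TensorProduct.tmul_mul_tmul, evalFun₃_tmul,
      evalFun₂_comul, evalFun₂_tmul]
    simp
  | add a b ha hb => simp only [map_add, add_mul, ha, hb]

section Finite

variable [Finite G]

theorem evalFun₂_ext {x y : MonoidAlgebra k G ⊗[k] MonoidAlgebra k G}
    (h : ∀ f₁ f₂ : G → k, evalFun₂ f₁ f₂ x = evalFun₂ f₁ f₂ y) : x = y := by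
  classical
  have := Fintype.ofFinite G
  have expand : ∀ z : MonoidAlgebra k G ⊗[k] MonoidAlgebra k G,
      z = ∑ a : G, ∑ b : G, evalFun₂ (Pi.single a 1) (Pi.single b 1) z •
        (MonoidAlgebra.of k G a ⊗ₜ[k] MonoidAlgebra.of k G b) := by
    intro z
    induction z using tensor_induction with
    | of g h =>
      simp only [evalFun₂_tmul, evalFun_of, Pi.single_apply]
      simp [ite_smul]
    | add x y hx hy =>
      simp only [map_add, add_smul, Finset.sum_add_distrib]
      rw [← hx, ← hy]
    | smul c x hx =>
      simp only [map_smul, smul_assoc, ← Finset.smul_sum]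
      rw [← hx]
  rw [expand x, expand y]
  simp only [h]

theorem evalFun₃_ext
    {x y : MonoidAlgebra k G ⊗[k] (MonoidAlgebra k G ⊗[k] MonoidAlgebra k G)}
    (h : ∀ f₁ f₂ f₃ : G → k, evalFun₃ f₁ f₂ f₃ x = evalFun₃ f₁ f₂ f₃ y) : x = y := by
  classical
  have := Fintype.ofFinite G
  have expand : ∀ z : MonoidAlgebra k G ⊗[k] (MonoidAlgebra k G ⊗[k] MonoidAlgebra k G),
      z = ∑ a : G, ∑ b : G, ∑ c : G,
        evalFun₃ (Pi.single a 1) (Pi.single b 1) (Pi.single c 1) z •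
        (MonoidAlgebra.of k G a ⊗ₜ[k] (MonoidAlgebra.of k G b ⊗ₜ[k] MonoidAlgebra.of k G c)) := by
    intro z
    induction z using TensorProduct.induction_on with
    | zero => simp
    | tmul x y =>
      induction x using monoidAlgebra_induction with
      | of a =>
        induction y using tensor_induction with
        | of g h =>
          simp only [evalFun₃_tmul, evalFun₂_tmul, evalFun_of, Pi.single_apply]
          simp [ite_smul]
        | add x y hx hy =>
          simp only [TensorProduct.tmul_add, map_add, add_smul, Finset.sum_add_distrib]
          rw [← hx, ← hy]
        | smul c x hx =>
          simp only [TensorProduct.tmul_smul, map_smul, smul_assoc, ← Finset.smul_sum]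
          rw [← hx]
      | add x y hx hy =>
        simp only [TensorProduct.add_tmul, map_add, add_smul, Finset.sum_add_distrib]
        rw [← hx, ← hy]
      | smul c x hx =>
        simp only [← TensorProduct.smul_tmul', map_smul, smul_assoc, ← Finset.smul_sum]
        rw [← hx]
    | add x y hx hy =>
      simp only [map_add, add_smul, Finset.sum_add_distrib]
      rw [← hx, ← hy]
  rw [expand x, expand y]
  simp only [h]

section

variable [CharZero k] [IsAlgClosed k] [IsMulCommutative A]

/-- The functions on G are the sum of the spaces F_χ[G], so a tensor is determined by its values on
functionals of pure weight. Only for these does the shift by a weight in the axioms reduce to a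
single value of J. -/
theorem evalFun₂_ext_weight {x y : MonoidAlgebra k G ⊗[k] MonoidAlgebra k G}
    (h : ∀ (χ ψ : Dual k A), ∀ f₁ ∈ weightFun χ, ∀ f₂ ∈ weightFun ψ,
      evalFun₂ f₁ f₂ x = evalFun₂ f₁ f₂ y) : x = y := by
  have := Fintype.ofFinite (Dual k A)
  refine evalFun₂_ext fun f₁ f₂ => ?_
  rw [← sum_weightProj (A := A) f₁, ← sum_weightProj (A := A) f₂]
  simp only [← evalPairing₂_apply, map_sum, LinearMap.sum_apply]
  exact Finset.sum_congr rfl fun χ _ => Finset.sum_congr rfl fun ψ _ =>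
    h _ _ _ (weightProj_mem _ _) _ (weightProj_mem _ _)

theorem evalFun₃_ext_weight
    {x y : MonoidAlgebra k G ⊗[k] (MonoidAlgebra k G ⊗[k] MonoidAlgebra k G)}
    (h : ∀ (χ ψ ω : Dual k A), ∀ f₁ ∈ weightFun χ, ∀ f₂ ∈ weightFun ψ, ∀ f₃ ∈ weightFun ω,
      evalFun₃ f₁ f₂ f₃ x = evalFun₃ f₁ f₂ f₃ y) : x = y := by
  have := Fintype.ofFinite (Dual k A)
  have h1 : ∀ (s : Finset (Dual k A)) (f : Dual k A → G → k) (f₂ f₃ : G → k) z,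
      evalFun₃ (∑ i ∈ s, f i) f₂ f₃ z = ∑ i ∈ s, evalFun₃ (f i) f₂ f₃ z := by
    intro s f f₂ f₃ z
    induction z using TensorProduct.induction_on with
    | zero => simp
    | tmul x y => simp only [evalFun₃_tmul, evalFun_sum, Finset.sum_mul]
    | add x y hx hy => simp only [map_add, hx, hy, Finset.sum_add_distrib]
  have h2 : ∀ (s : Finset (Dual k A)) (f : Dual k A → G → k) (f₁ f₃ : G → k) z,
      evalFun₃ f₁ (∑ i ∈ s, f i) f₃ z = ∑ i ∈ s, evalFun₃ f₁ (f i) f₃ z := by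
    intro s f f₂ f₃ z
    induction z using TensorProduct.induction_on with
    | zero => simp
    | tmul x y =>
      simp only [evalFun₃_tmul, ← evalPairing₂_apply, map_sum, LinearMap.sum_apply, Finset.mul_sum]
    | add x y hx hy => simp only [map_add, hx, hy, Finset.sum_add_distrib]
  have h3 : ∀ (s : Finset (Dual k A)) (f : Dual k A → G → k) (f₁ f₂ : G → k) z,
      evalFun₃ f₁ f₂ (∑ i ∈ s, f i) z = ∑ i ∈ s, evalFun₃ f₁ f₂ (f i) z := by
    intro s f f₂ f₃ z
    induction z using TensorProduct.induction_on with
    | zero => simp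
    | tmul x y =>
      simp only [evalFun₃_tmul, ← evalPairing₂_apply, map_sum, LinearMap.sum_apply, Finset.mul_sum]
    | add x y hx hy => simp only [map_add, hx, hy, Finset.sum_add_distrib]
  refine evalFun₃_ext fun f₁ f₂ f₃ => ?_
  rw [← sum_weightProj (A := A) f₁, ← sum_weightProj (A := A) f₂, ← sum_weightProj (A := A) f₃]
  simp only [h1, h2, h3]
  exact Finset.sum_congr rfl fun χ _ => Finset.sum_congr rfl fun ψ _ =>
    Finset.sum_congr rfl fun ω _ =>
    h _ _ _ _ (weightProj_mem _ _) _ (weightProj_mem _ _) _ (weightProj_mem _ _)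

end

/-- On functionals of weight `ψ` in the last component, `F(χ - h^{(3)})` acts as `F(χ - ψ)`. -/
theorem evalFun₃_mul_shiftByWeight [CharZero k]
    (J : Dual k A → MonoidAlgebra k G ⊗[k] MonoidAlgebra k G)
    (χ ψ : Dual k A) (f₁ f₂ : G → k) {f₃ : G → k} (h₃ : f₃ ∈ weightFun ψ)
    (x : MonoidAlgebra k G ⊗[k] MonoidAlgebra k G) :
    evalFun₃ f₁ f₂ f₃ (Algebra.TensorProduct.assoc k k k
        (MonoidAlgebra k G) (MonoidAlgebra k G) (MonoidAlgebra k G)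
        (Algebra.TensorProduct.map (Bialgebra.comulAlgHom k (MonoidAlgebra k G))
            (AlgHom.id k (MonoidAlgebra k G)) x * shiftByWeight J χ)) =
      evalFun₃ f₁ f₂ f₃ (leftTriple x (J (χ / ψ))) := by
  classical
  have := Fintype.ofFinite (Dual k A)
  have key : ∀ (z : MonoidAlgebra k G ⊗[k] MonoidAlgebra k G) (w : MonoidAlgebra k G),
      evalFun₃ f₁ f₂ f₃ (Algebra.TensorProduct.assoc k k k (MonoidAlgebra k G)
        (MonoidAlgebra k G) (MonoidAlgebra k G) (z ⊗ₜ[k] w)) =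
        evalFun₂ f₁ f₂ z * evalFun f₃ w := by
    intro z w
    induction z using TensorProduct.induction_on with
    | zero => simp
    | tmul a b => simp [mul_assoc]
    | add a b ha hb => simp only [TensorProduct.add_tmul, map_add, ha, hb, add_mul]
  rw [leftTriple, shiftByWeight, finsum_eq_sum_of_fintype]
  induction x using TensorProduct.induction_on with
  | zero => simp
  | tmul a b =>
    rw [Algebra.TensorProduct.map_tmul, Finset.mul_sum, map_sum, map_sum]
    simp only [Algebra.TensorProduct.tmul_mul_tmul, key, AlgHom.id_apply, mul_one]
    rw [Finset.sum_eq_single ψ]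
    · rw [evalFun_mul_charIdem h₃]
    · intro ω _ hω
      rw [evalFun_mul_charIdem_of_ne h₃ hω.symm, mul_zero]
    · simp
  | add a b ha hb => simp only [map_add, add_mul, ha, hb]

/-- The product commutes with left translations, so its value at g is its value at 1 on translated
factors. Identities between products thus reduce to identities of functionals. -/
theorem starMul_eq_evalFun₂_shift (x : MonoidAlgebra k G ⊗[k] MonoidAlgebra k G)
    (f₁ f₂ : G → k) (g : G) :
    starMul x f₁ f₂ g = evalFun₂ (shift g⁻¹ f₁) (shift g⁻¹ f₂) x := by
  have := congrFun (shift_starMul g⁻¹ x f₁ f₂) 1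
  rw [shift_apply, mul_one, inv_inv] at this
  rw [this, starMul, map_one, ← Algebra.TensorProduct.one_def, one_mul]

/-- The products of functions are associative, in the sense appropriate for dynamical twists. -/
theorem starMul_assoc [CharZero k] (J : DynamicalTwist k A) {ω ψ : Dual k A} (f₁ f₂ : G → k)
    {f₃ : G → k} (h₃ : f₃ ∈ weightFun (ω / ψ)) :
    starMul (J.J ω) (starMul (J.J ψ) f₁ f₂) f₃ = starMul (J.J ω) f₁ (starMul (J.J ω) f₂ f₃) := by
  ext g
  -- After translation to the identity, both sides are f₁ ⊗ f₂ ⊗ f₃ evaluated on the two sides of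
  -- the dynamical equation. The weight ω-ψ of f₃ turns J(ω - h^{(3)}) into J(ω-(ω-ψ)) = J(ψ).
  rw [starMul_eq_evalFun₂_shift, starMul_eq_evalFun₂_shift, shift_starMul, shift_starMul,
    ← evalFun₃_leftTriple, ← evalFun₃_rightTriple, rightTriple, ← J.dynamical,
    evalFun₃_mul_shiftByWeight _ _ _ _ _ (shift_mem_weightFun h₃ _), dual_div_div_cancel]

theorem evalFun₂_one_left (f : G → k) (x : MonoidAlgebra k G ⊗[k] MonoidAlgebra k G) :
    evalFun₂ 1 f x = evalFun f (Algebra.TensorProduct.lid k (MonoidAlgebra k G)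
      (Algebra.TensorProduct.map (Bialgebra.counitAlgHom k (MonoidAlgebra k G))
        (AlgHom.id k (MonoidAlgebra k G)) x)) := by
  induction x using tensor_induction with
  | of a b => simp
  | add x y hx hy => simp only [map_add, hx, hy]
  | smul c x hx => simp only [map_smul, hx]

theorem evalFun₂_one_right (f : G → k) (x : MonoidAlgebra k G ⊗[k] MonoidAlgebra k G) :
    evalFun₂ f 1 x = evalFun f (Algebra.TensorProduct.rid k k (MonoidAlgebra k G)
      (Algebra.TensorProduct.map (AlgHom.id k (MonoidAlgebra k G))
        (Bialgebra.counitAlgHom k (MonoidAlgebra k G)) x)) := by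
  induction x using tensor_induction with
  | of a b => simp
  | add x y hx hy => simp only [map_add, hx, hy]
  | smul c x hx => simp only [map_smul, hx]

theorem one_starMul (J : DynamicalTwist k A) (ω : Dual k A) (f : G → k) :
    starMul (J.J ω) 1 f = f := by
  ext g
  rw [starMul_eq_evalFun₂_shift, shift_const, evalFun₂_one_left, J.counit_left,
    ← map_one (MonoidAlgebra.of k G), evalFun_of, shift_apply, inv_inv, mul_one]

/-- The product maps `F_{ψ-χ}[G] ⊗ F_{ω-ψ}[G]` to `F_{ω-χ}[G]`. -/
theorem starMul_mem (J : DynamicalTwist k A) {χ ψ ω : Dual k A} (θ : Dual k A) {f f' : G → k}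
    (h : f ∈ weightFun (ψ / χ)) (h' : f' ∈ weightFun (ω / ψ)) :
    starMul (J.J θ) f f' ∈ weightFun (ω / χ) := by
  have := starMul_mem_weightFun J.zeroWeight θ h h'
  rwa [dual_div_mul_div] at this

theorem one_mem_weightFun_div (χ : Dual k A) : (1 : G → k) ∈ weightFun (χ / χ) := by
  rw [dual_div_self]
  exact one_mem_weightFun

end Finite

/-! ### Linear algebra -/

section LinearAlgebra

/-- A linear map factors through a linear map that is surjective on a subspace `F` if it vanishes
on the elements of `F` killed by the latter. -/
theorem exists_linear_factor {E H H' : Type*} [AddCommGroup E] [Module k E] [AddCommGroup H]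
    [Module k H] [AddCommGroup H'] [Module k H'] (F : Submodule k E) (τ : E →ₗ[k] H)
    (τ' : E →ₗ[k] H') (hτ : ∀ T, ∃ f ∈ F, τ f = T) (hker : ∀ f ∈ F, τ f = 0 → τ' f = 0) :
    ∃ ρ : H →ₗ[k] H', ∀ f ∈ F, τ' f = ρ (τ f) := by
  have hsurj : LinearMap.range (τ.domRestrict F) = ⊤ := LinearMap.range_eq_top.2 fun T => by
    obtain ⟨f, hf, rfl⟩ := hτ T
    exact ⟨⟨f, hf⟩, rfl⟩
  obtain ⟨s, hs⟩ := (τ.domRestrict F).exists_rightInverse_of_surjective hsurj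
  refine ⟨τ' ∘ₗ F.subtype ∘ₗ s, fun f hf => ?_⟩
  have h1 : τ (s (τ f)) = τ f := LinearMap.congr_fun hs (τ f)
  have h2 := hker (f - s (τ f)) (F.sub_mem hf (s (τ f)).2) (by rw [map_sub, h1, sub_self])
  rw [map_sub, sub_eq_zero] at h2
  exact h2

/-- A linear section of a linear map that is surjective on a subspace. -/
theorem exists_linear_section {E H : Type*} [AddCommGroup E] [Module k E] [AddCommGroup H]
    [Module k H] (F : Submodule k E) (τ : E →ₗ[k] H) (hτ : ∀ T, ∃ f ∈ F, τ f = T) :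
    ∃ s : H →ₗ[k] E, ∀ T, s T ∈ F ∧ τ (s T) = T := by
  have hsurj : LinearMap.range (τ.domRestrict F) = ⊤ := LinearMap.range_eq_top.2 fun T => by
    obtain ⟨f, hf, rfl⟩ := hτ T
    exact ⟨⟨f, hf⟩, rfl⟩
  obtain ⟨s, hs⟩ := (τ.domRestrict F).exists_rightInverse_of_surjective hsurj
  exact ⟨F.subtype ∘ₗ s, fun T => ⟨(s T).2, LinearMap.congr_fun hs T⟩⟩

theorem exists_dual_eq_one {V : Type*} [AddCommGroup V] [Module k V] {v : V} (hv : v ≠ 0) :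
    ∃ ξ : V →ₗ[k] k, ξ v = 1 := by
  obtain ⟨ξ, hξ⟩ : ∃ ξ : Module.Dual k V, ξ v ≠ 0 := by
    by_contra! h
    exact hv ((Module.forall_dual_apply_eq_zero_iff k v).1 h)
  exact ⟨(ξ v)⁻¹ • ξ, by simp [hξ]⟩

theorem linearMap_eq_sum_smulRight {V W : Type*} [AddCommGroup V] [Module k V] [Module.Finite k V]
    [AddCommGroup W] [Module k W] (T : V →ₗ[k] W) :
    T = ∑ i, ((Module.finBasis k V).coord i).smulRight (T (Module.finBasis k V i)) := by
  refine (Module.finBasis k V).ext fun j => ?_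
  rw [LinearMap.sum_apply, Finset.sum_eq_single j]
  · simp
  · intro i _ hi
    simp [hi.symm]
  · simp

theorem mem_of_smulRight_mem {V W : Type*} [AddCommGroup V] [Module k V] [Module.Finite k V]
    [AddCommGroup W] [Module k W] (N : Submodule k (V →ₗ[k] W))
    (h : ∀ (ξ : V →ₗ[k] k) (w : W), ξ.smulRight w ∈ N) (T : V →ₗ[k] W) : T ∈ N := by
  rw [linearMap_eq_sum_smulRight T]
  exact N.sum_mem fun i _ => h _ _

theorem linearMap_ext_smulRight {V W X : Type*} [AddCommGroup V] [Module k V] [Module.Finite k V]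
    [AddCommGroup W] [Module k W] [AddCommGroup X] [Module k X] {Φ Φ' : (V →ₗ[k] W) →ₗ[k] X}
    (h : ∀ (ξ : V →ₗ[k] k) (w : W), Φ (ξ.smulRight w) = Φ' (ξ.smulRight w)) : Φ = Φ' := by
  ext1 T
  exact mem_of_smulRight_mem (LinearMap.eqLocus Φ Φ') h T

/-- The products `a T b` with a fixed nonzero `T` span all linear maps. -/
theorem mem_of_sandwich_mem {V W V' W' : Type*} [AddCommGroup V] [Module k V]
    [AddCommGroup W] [Module k W] [AddCommGroup V'] [Module k V'] [AddCommGroup W'] [Module k W']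
    [Module.Finite k V'] {T : V →ₗ[k] W} (hT : T ≠ 0) (N : Submodule k (V' →ₗ[k] W'))
    (h : ∀ (a : W →ₗ[k] W') (b : V' →ₗ[k] V), a ∘ₗ T ∘ₗ b ∈ N) (S : V' →ₗ[k] W') : S ∈ N := by
  refine mem_of_smulRight_mem N (fun ξ w => ?_) S
  obtain ⟨v, hv⟩ : ∃ v, T v ≠ 0 := by
    by_contra! h
    exact hT (LinearMap.ext h)
  obtain ⟨η, hη⟩ := exists_dual_eq_one (k := k) hv
  convert h (η.smulRight w) (ξ.smulRight v) using 1
  ext x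
  simp [hη]

theorem exists_linearMap_apply_eq {V W : Type*} [AddCommGroup V] [Module k V]
    [AddCommGroup W] [Module k W] {v : V} (hv : v ≠ 0) (w : W) : ∃ T : V →ₗ[k] W, T v = w := by
  obtain ⟨ξ, hξ⟩ := exists_dual_eq_one (k := k) hv
  exact ⟨ξ.smulRight w, by simp [hξ]⟩

/-- A nonzero multiplicative family of linear maps `Hom(V_j, V_i) → Hom(V'_j, V'_i)` that acts
transitively on the nonzero vectors is given by conjugation with isomorphisms `V_i ≅ V'_i`. -/
theorem exists_intertwiner {ι : Type*} {V V' : ι → Type*} [∀ i, AddCommGroup (V i)]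
    [∀ i, Module k (V i)] [∀ i, Module.Finite k (V i)] [∀ i, AddCommGroup (V' i)]
    [∀ i, Module k (V' i)] (ρ : ∀ i j, (V j →ₗ[k] V i) →ₗ[k] (V' j →ₗ[k] V' i))
    (hmul : ∀ i j l (S : V j →ₗ[k] V i) (T : V l →ₗ[k] V j), ρ i l (S ∘ₗ T) = ρ i j S ∘ₗ ρ j l T)
    (hne : ∃ i j T, ρ i j T ≠ 0)
    (htrans : ∀ i j (x : V' j) (y : V' i), x ≠ 0 → ∃ T, ρ i j T x = y) :
    ∃ φ : ∀ i, V i ≃ₗ[k] V' i, ∀ i j (T : V j →ₗ[k] V i) (v : V j),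
      ρ i j T (φ j v) = φ i (T v) := by
  obtain ⟨i₀, j₀, T₀, hT₀⟩ := hne
  obtain ⟨ξ, v₀, hne⟩ : ∃ (ξ : V j₀ →ₗ[k] k) (v : V i₀), ρ i₀ j₀ (ξ.smulRight v) ≠ 0 := by
    by_contra! h
    refine hT₀ (LinearMap.congr_fun (?_ : ρ i₀ j₀ = 0) T₀)
    exact linearMap_ext_smulRight fun ξ v => by rw [h, LinearMap.zero_apply]
  obtain ⟨x, hx⟩ : ∃ x, ρ i₀ j₀ (ξ.smulRight v₀) x ≠ 0 := by
    by_contra! h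
    exact hne (LinearMap.ext h)
  -- The rank one maps v ⊗ ξ with the functional ξ fixed form a copy of V_i, a column of the matrix
  -- category. Applying their images to x gives an intertwiner, nonzero at v₀ by the choice of x.
  let φ : ∀ i, V i →ₗ[k] V' i := fun i =>
    LinearMap.applyₗ x ∘ₗ ρ i j₀ ∘ₗ LinearMap.smulRightₗ ξ
  have hφ : ∀ i v, φ i v = ρ i j₀ (ξ.smulRight v) x := fun i v => rfl
  have hint : ∀ i j (T : V j →ₗ[k] V i) (v : V j), ρ i j T (φ j v) = φ i (T v) := by
    intro i j T v
    rw [hφ, hφ, ← LinearMap.comp_apply, ← hmul]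
    congr 2
    ext w
    simp
  have hv₀ : φ i₀ v₀ ≠ 0 := hx
  have hinj : ∀ i, Function.Injective (φ i) := fun i => by
    rw [injective_iff_map_eq_zero]
    intro w hw
    by_contra hw0
    obtain ⟨T, hT⟩ := exists_linearMap_apply_eq (k := k) hw0 v₀
    exact hv₀ (by rw [← hT, ← hint, hw, map_zero])
  have hsurj : ∀ i, Function.Surjective (φ i) := fun i w => by
    obtain ⟨T, hT⟩ := htrans i i₀ _ w hv₀
    exact ⟨T v₀, by rw [← hint, hT]⟩
  exact ⟨fun i => LinearEquiv.ofBijective (φ i) ⟨hinj i, hsurj i⟩, hint⟩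

/-- A family of maps that commutes with all linear maps is a scalar. -/
theorem exists_scalar {ι : Type*} [Nonempty ι] {V : ι → Type*} [∀ i, AddCommGroup (V i)]
    [∀ i, Module k (V i)] [∀ i, Nontrivial (V i)] (c : ∀ i, V i →ₗ[k] V i)
    (h : ∀ i j (T : V j →ₗ[k] V i), c i ∘ₗ T = T ∘ₗ c j) : ∃ a : k, ∀ i v, c i v = a • v := by
  obtain ⟨i₀⟩ := ‹Nonempty ι›
  obtain ⟨v₀, hv₀⟩ := exists_ne (0 : V i₀)
  obtain ⟨ξ, hξ⟩ := exists_dual_eq_one (k := k) hv₀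
  refine ⟨ξ (c i₀ v₀), fun i v => ?_⟩
  have := LinearMap.congr_fun (h i i₀ (ξ.smulRight v)) v₀
  simpa [hξ] using this

theorem exists_unit_scalar {ι : Type*} [Nonempty ι] {V : ι → Type*} [∀ i, AddCommGroup (V i)]
    [∀ i, Module k (V i)] [∀ i, Nontrivial (V i)] (c : ∀ i, V i ≃ₗ[k] V i)
    (h : ∀ i j (T : V j →ₗ[k] V i) (v : V j), c i (T v) = T (c j v)) :
    ∃ a : kˣ, ∀ i v, c i v = (a : k) • v := by
  obtain ⟨a, ha⟩ := exists_scalar (fun i => (c i).toLinearMap) fun i j T => LinearMap.ext (h i j T)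
  have ha0 : a ≠ 0 := by
    rintro rfl
    obtain ⟨i₀⟩ := ‹Nonempty ι›
    obtain ⟨v₀, hv₀⟩ := exists_ne (0 : V i₀)
    exact hv₀ ((c i₀).injective (by simpa using ha i₀ v₀))
  exact ⟨Units.mk0 a ha0, ha⟩

/-- Burnside's theorem: a subalgebra of `End V` without invariant subspaces is everything. -/
theorem subalgebra_eq_top_of_irreducible [IsAlgClosed k] {E : Type*} [AddCommGroup E] [Module k E]
    [Module.Finite k E] [Nontrivial E] (S : Subalgebra k (Module.End k E))
    (h : ∀ U : Submodule k E, (∀ s ∈ S, ∀ x ∈ U, s x ∈ U) → U = ⊥ ∨ U = ⊤) : S = ⊤ := by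
  classical
  have hsimple : IsSimpleModule S E :=
    { eq_bot_or_eq_top := fun U => by
        rcases h (U.restrictScalars k) (fun s hs x hx => U.smul_mem (⟨s, hs⟩ : S) hx) with h | h
        · left
          exact (Submodule.restrictScalars_eq_bot_iff k _ _).1 h
        · right
          exact (Submodule.restrictScalars_eq_top_iff k _ _).1 h }
  have hsurj := (IsSimpleModule.algebraMap_end_bijective_of_isAlgClosed (A := S) (V := E) k).2
  rw [eq_top_iff]
  rintro f -
  -- By Schur's lemma the commutant of S consists of scalars, so every linear f commutes with it.
  -- The density theorem then gives an element of S that agrees with f on a basis.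
  let f' : Module.End (Module.End S E) E :=
    { toFun := f
      map_add' := map_add f
      map_smul' := fun t x => by
        obtain ⟨c, rfl⟩ := hsurj t
        simp }
  obtain ⟨s, hs⟩ := jacobson_density f' (Finset.univ.image (Module.finBasis k E))
  have : f = s := (Module.finBasis k E).ext fun i =>
    hs _ (Finset.mem_image_of_mem _ (Finset.mem_univ i))
  rw [this]
  exact s.2

/-- Averaging a linear map over a finite group acting on source and target. -/
def average {K : Type*} [Fintype K] {V W : Type*} [AddCommGroup V] [Module k V]
    [AddCommGroup W] [Module k W] (π : K → V ≃ₗ[k] V) (π' : K → W ≃ₗ[k] W) (n : V →ₗ[k] W) :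
    V →ₗ[k] W :=
  ∑ x, (π x).arrowCongr (π' x) n

theorem average_comm {K : Type*} [Group K] [Fintype K] {V W : Type*} [AddCommGroup V] [Module k V]
    [AddCommGroup W] [Module k W] (π : K → V ≃ₗ[k] V) (π' : K → W ≃ₗ[k] W)
    (hlin : ∀ g h (T : V →ₗ[k] W), (π g).arrowCongr (π' g) ((π h).arrowCongr (π' h) T) =
      (π (g * h)).arrowCongr (π' (g * h)) T) (n : V →ₗ[k] W) (h : K) :
    (π h).arrowCongr (π' h) (average π π' n) = average π π' n := by
  rw [average, map_sum]
  exact Fintype.sum_equiv (Equiv.mulLeft h) _ _ fun x => hlin _ _ _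

theorem average_smulRight_apply {K : Type*} [Fintype K] {V W : Type*} [AddCommGroup V]
    [Module k V] [AddCommGroup W] [Module k W] (π : K → V ≃ₗ[k] V) (π' : K → W ≃ₗ[k] W)
    (φ : V →ₗ[k] k) (v : W) (w : V) :
    average π π' (φ.smulRight v) w = ∑ x, φ ((π x).symm w) • π' x v := by
  simp [average, LinearEquiv.arrowCongr_apply]

/-- Schur's lemma for two representations without intertwining operators. -/
theorem sum_smul_eq_zero {K : Type*} [Group K] [Fintype K] {V W : Type*} [AddCommGroup V]
    [Module k V] [AddCommGroup W] [Module k W] (π : K → V ≃ₗ[k] V) (π' : K → W ≃ₗ[k] W)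
    (hlin : ∀ g h (T : V →ₗ[k] W), (π g).arrowCongr (π' g) ((π h).arrowCongr (π' h) T) =
      (π (g * h)).arrowCongr (π' (g * h)) T)
    (hinv : ∀ T : V →ₗ[k] W, (∀ h, (π h).arrowCongr (π' h) T = T) → T = 0)
    (φ : V →ₗ[k] k) (v : W) (w : V) : ∑ x, φ ((π x).symm w) • π' x v = 0 := by
  rw [← average_smulRight_apply, hinv _ (average_comm π π' hlin _), LinearMap.zero_apply]

/-- Schur orthogonality for a representation whose intertwining operators are scalars. -/
theorem finrank_smul_sum_smul {K : Type*} [Group K] [Fintype K] {V : Type*} [AddCommGroup V]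
    [Module k V] [Module.Finite k V] (π : K → V ≃ₗ[k] V)
    (hlin : ∀ g h (T : V →ₗ[k] V), (π g).arrowCongr (π g) ((π h).arrowCongr (π h) T) =
      (π (g * h)).arrowCongr (π (g * h)) T)
    (hinv : ∀ T : V →ₗ[k] V, (∀ h, (π h).arrowCongr (π h) T = T) → ∃ c : k, T = c • LinearMap.id)
    (φ : V →ₗ[k] k) (v w : V) :
    (Module.finrank k V : k) • ∑ x, φ ((π x).symm w) • π x v = ((Fintype.card K : k) * φ v) • w := by
  -- The average of the rank one operator φ ⊗ v is a scalar c. Each conjugate has trace φ(v), so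
  -- comparison of traces gives dim V · c = |K| φ(v), with no division needed.
  obtain ⟨c, hc⟩ := hinv _ (average_comm π π hlin (φ.smulRight v))
  have htr : LinearMap.trace k V (average π π (φ.smulRight v)) = Fintype.card K * φ v := by
    have : ∀ x, LinearMap.trace k V ((π x).arrowCongr (π x) (φ.smulRight v)) = φ v := fun x => by
      exact (LinearMap.trace_conj' _ (π x)).trans (LinearMap.trace_smulRight φ v)
    rw [average, map_sum, Finset.sum_congr rfl fun x _ => this x]
    simp
  rw [← average_smulRight_apply, hc, ← htr, hc, LinearMap.smul_apply, LinearMap.id_apply,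
    map_smul, LinearMap.trace_id, smul_smul, smul_eq_mul, mul_comm c]

end LinearAlgebra

/-! ### Fibre maps

A family of maps `τ_{χψ} : F_{ψ-χ}[G] → Hom(V_ψ, V_χ)` is a fibre map if
`f ↦ (g ↦ τ_{χψ}(g ∘ f))` identifies `F_{ψ-χ}[G]` with the `K`-equivariant functions on `G` with
values in `Hom(V_ψ, V_χ)`. -/

section FiberMap

variable {V : Dual k A → Type w} [∀ χ, AddCommGroup (V χ)] [∀ χ, Module k (V χ)]

/-- The elements of `F_{ψ-χ}[G]` that are supported on `K`. -/
def fiberSupport (K : Subgroup G) (τ : ∀ χ ψ, (G → k) →ₗ[k] (V ψ →ₗ[k] V χ)) (χ ψ : Dual k A) :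
    Submodule k (G → k) where
  carrier := {f | f ∈ weightFun (ψ / χ) ∧ ∀ g, g ∉ K → τ χ ψ (shift g f) = 0}
  add_mem' hf hf' := ⟨Submodule.add_mem _ hf.1 hf'.1, fun g hg => by
    rw [map_add, map_add, hf.2 g hg, hf'.2 g hg, add_zero]⟩
  zero_mem' := ⟨Submodule.zero_mem _, fun g _ => by rw [map_zero, map_zero]⟩
  smul_mem' c f hf := ⟨Submodule.smul_mem _ c hf.1, fun g hg => by
    rw [map_smul, map_smul, hf.2 g hg, smul_zero]⟩

/-- The maps `τ_{χψ}` identify `F_{ψ-χ}[G]` with the coinduced representation of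
`Hom(V_ψ, V_χ)`. -/
structure IsFiberMap (K : Subgroup G) (π : ∀ χ, K → V χ ≃ₗ[k] V χ)
    (τ : ∀ χ ψ, (G → k) →ₗ[k] (V ψ →ₗ[k] V χ)) : Prop where
  equivariant : ∀ (χ ψ : Dual k A) (h : K), ∀ f ∈ weightFun (ψ / χ),
    τ χ ψ (shift (h : G) f) = (π ψ h).arrowCongr (π χ h) (τ χ ψ f)
  injective : ∀ χ ψ : Dual k A, ∀ f ∈ weightFun (ψ / χ), (∀ g, τ χ ψ (shift g f) = 0) → f = 0
  surjective : ∀ (χ ψ : Dual k A) (T : V ψ →ₗ[k] V χ), ∃ f ∈ fiberSupport K τ χ ψ, τ χ ψ f = T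

/-- A fibre map that is multiplicative for the products defined by `J`. -/
structure IsFiberRep (J : Dual k A → MonoidAlgebra k G ⊗[k] MonoidAlgebra k G) (K : Subgroup G)
    (π : ∀ χ, K → V χ ≃ₗ[k] V χ) (τ : ∀ χ ψ, (G → k) →ₗ[k] (V ψ →ₗ[k] V χ)) : Prop extends
    IsFiberMap K π τ where
  map_one : ∀ χ, τ χ χ 1 = LinearMap.id
  map_mul : ∀ χ ψ ω : Dual k A, ∀ f ∈ weightFun (ψ / χ), ∀ f' ∈ weightFun (ω / ψ),
    τ χ ω (starMul (J ω) f f') = τ χ ψ f ∘ₗ τ ψ ω f'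

theorem smul_one_of_shift_eq {F : G → k} (h : ∀ g, shift g F = F) : F = F 1 • (1 : G → k) := by
  ext g
  have := congrFun (h g) g
  rw [shift_apply, inv_mul_cancel] at this
  simp [this]

theorem eq_zero_of_const_mem {α : Dual k A} (hα : α ≠ 1) {c : k}
    (h : c • (1 : G → k) ∈ weightFun α) : c = 0 := by
  by_contra hc
  refine hα (MonoidHom.ext fun a => Units.ext ?_)
  have := h 1 a
  simp only [Pi.smul_apply, Pi.one_apply, smul_eq_mul, mul_one] at this
  exact (mul_left_cancel₀ hc ((mul_one c).trans this)).symm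

namespace IsFiberMap

variable {K : Subgroup G} {π : ∀ χ, K → V χ ≃ₗ[k] V χ}
  {τ : ∀ χ ψ, (G → k) →ₗ[k] (V ψ →ₗ[k] V χ)} (hτ : IsFiberMap K π τ)

include hτ


/-- For f supported on K, equivariance determines τ(g ∘ f) from τ(f) when g ∈ K, and support makes
it zero otherwise. Hence τ is injective on supported functions, which makes `lift` its inverse
there. -/
theorem eq_zero_of_mem_support {χ ψ : Dual k A} {f : G → k} (hf : f ∈ fiberSupport K τ χ ψ)
    (h0 : τ χ ψ f = 0) : f = 0 := by
  refine hτ.injective χ ψ f hf.1 fun g => ?_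
  by_cases hg : g ∈ K
  · rw [hτ.equivariant χ ψ ⟨g, hg⟩ f hf.1, h0, map_zero]
  · exact hf.2 g hg

theorem eq_of_mem_support {χ ψ : Dual k A} {f f' : G → k} (hf : f ∈ fiberSupport K τ χ ψ)
    (hf' : f' ∈ fiberSupport K τ χ ψ) (h : τ χ ψ f = τ χ ψ f') : f = f' :=
  sub_eq_zero.1 (hτ.eq_zero_of_mem_support (Submodule.sub_mem _ hf hf')
    (by rw [map_sub, h, sub_self]))

/-- The section of `τ_{χψ}` with values in the functions supported on `K`. -/
def lift (χ ψ : Dual k A) : (V ψ →ₗ[k] V χ) →ₗ[k] (G → k) :=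
  (exists_linear_section _ _ (hτ.surjective χ ψ)).choose

theorem lift_mem_support (χ ψ : Dual k A) (T : V ψ →ₗ[k] V χ) :
    hτ.lift χ ψ T ∈ fiberSupport K τ χ ψ :=
  ((exists_linear_section _ _ (hτ.surjective χ ψ)).choose_spec T).1

theorem lift_mem (χ ψ : Dual k A) (T : V ψ →ₗ[k] V χ) : hτ.lift χ ψ T ∈ weightFun (ψ / χ) :=
  (hτ.lift_mem_support χ ψ T).1

theorem map_shift_lift_of_notMem (χ ψ : Dual k A) (T : V ψ →ₗ[k] V χ) {g : G} (hg : g ∉ K) :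
    τ χ ψ (shift g (hτ.lift χ ψ T)) = 0 :=
  (hτ.lift_mem_support χ ψ T).2 g hg

@[simp]
theorem map_lift (χ ψ : Dual k A) (T : V ψ →ₗ[k] V χ) : τ χ ψ (hτ.lift χ ψ T) = T :=
  ((exists_linear_section _ _ (hτ.surjective χ ψ)).choose_spec T).2

theorem lift_map {χ ψ : Dual k A} {f : G → k} (hf : f ∈ fiberSupport K τ χ ψ) :
    hτ.lift χ ψ (τ χ ψ f) = f :=
  hτ.eq_of_mem_support (hτ.lift_mem_support _ _ _) hf (hτ.map_lift _ _ _)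

theorem shift_mem_support {χ ψ : Dual k A} {f : G → k} (hf : f ∈ fiberSupport K τ χ ψ) (h : K) :
    shift (h : G) f ∈ fiberSupport K τ χ ψ := by
  refine ⟨shift_mem_weightFun hf.1 _, fun g hg => ?_⟩
  rw [← shift_mul]
  exact hf.2 _ fun hgh => hg ((K.mul_mem_cancel_right h.2).1 hgh)

theorem linear (χ ψ : Dual k A) (g h : K) (T : V ψ →ₗ[k] V χ) :
    (π ψ g).arrowCongr (π χ g) ((π ψ h).arrowCongr (π χ h) T) =
      (π ψ (g * h)).arrowCongr (π χ (g * h)) T := by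
  obtain ⟨f, hf, rfl⟩ := hτ.surjective χ ψ T
  rw [← hτ.equivariant χ ψ h f hf.1, ← hτ.equivariant _ _ _ _ (shift_mem_weightFun hf.1 _),
    ← hτ.equivariant _ _ _ _ hf.1, Subgroup.coe_mul, shift_mul]

section Finite

variable [Finite G]

/-- The element of `F_{ψ-χ}[G]` corresponding to an equivariant function. -/
def coindLift (χ ψ : Dual k A) : (G → V ψ →ₗ[k] V χ) →ₗ[k] (G → k) :=
  letI := Fintype.ofFinite G
  (Nat.card K : k)⁻¹ • ∑ g : G, shift g⁻¹ ∘ₗ hτ.lift χ ψ ∘ₗ LinearMap.proj g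

theorem coindLift_mem (χ ψ : Dual k A) (φ : G → V ψ →ₗ[k] V χ) :
    hτ.coindLift χ ψ φ ∈ weightFun (ψ / χ) := by
  let _ := Fintype.ofFinite G
  rw [coindLift, LinearMap.smul_apply, LinearMap.sum_apply]
  exact Submodule.smul_mem _ _ (Submodule.sum_mem _ fun g _ =>
    shift_mem_weightFun (hτ.lift_mem _ _ _) _)

/-- The summand with index g contributes at x only if x g⁻¹ ∈ K, and by equivariance of φ its
contribution is then φ(x). There are |K| such g, which explains the normalizing factor. -/
theorem map_shift_coindLift [CharZero k] (χ ψ : Dual k A) (φ : G → V ψ →ₗ[k] V χ)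
    (hφ : ∀ (h : K) (g : G), φ (h * g) = (π ψ h).arrowCongr (π χ h) (φ g)) (x : G) :
    τ χ ψ (shift x (hτ.coindLift χ ψ φ)) = φ x := by
  classical
  let _ := Fintype.ofFinite G
  have hc : (Nat.card K : k) ≠ 0 := by exact_mod_cast Nat.card_pos.ne'
  have h1 : ∀ y : G, τ χ ψ (shift y (hτ.lift χ ψ (φ (y⁻¹ * x)))) =
      if y ∈ K then φ x else 0 := by
    intro y
    split_ifs with hy
    · rw [hτ.equivariant χ ψ ⟨y, hy⟩ _ (hτ.lift_mem _ _ _), hτ.map_lift, ← hφ]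
      simp
    · exact hτ.map_shift_lift_of_notMem _ _ _ hy
  have h2 : ∑ g : G, τ χ ψ (shift x (shift g⁻¹ (hτ.lift χ ψ (φ g)))) = (Nat.card K : k) • φ x := by
    rw [← Equiv.sum_comp ((Equiv.inv G).trans (Equiv.mulRight x))]
    have : ∀ y : G, τ χ ψ (shift x (shift (((Equiv.inv G).trans (Equiv.mulRight x)) y)⁻¹
        (hτ.lift χ ψ (φ (((Equiv.inv G).trans (Equiv.mulRight x)) y))))) =
        if y ∈ K then φ x else 0 := fun y => by
      rw [← h1, ← shift_mul]
      simp
    rw [Finset.sum_congr rfl fun y _ => this y, ← Finset.sum_filter, Finset.sum_const,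
      Nat.card_eq_fintype_card, Fintype.card_subtype, Nat.cast_smul_eq_nsmul]
  rw [coindLift, LinearMap.smul_apply, LinearMap.sum_apply, map_smul, map_smul, map_sum, map_sum]
  simp only [LinearMap.comp_apply, LinearMap.proj_apply]
  rw [h2, smul_smul, inv_mul_cancel₀ hc, one_smul]

theorem coindLift_eq [CharZero k] {χ ψ : Dual k A} {f : G → k} (hf : f ∈ weightFun (ψ / χ)) :
    hτ.coindLift χ ψ (fun g => τ χ ψ (shift g f)) = f := by
  refine sub_eq_zero.1 (hτ.injective χ ψ _
    (Submodule.sub_mem _ (hτ.coindLift_mem χ ψ _) hf) fun g => ?_)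
  rw [map_sub, map_sub, hτ.map_shift_coindLift, sub_self]
  intro h g
  rw [shift_mul, hτ.equivariant _ _ _ _ (shift_mem_weightFun hf _)]

/-- Frobenius reciprocity: a K-invariant T corresponds to the constant equivariant function T on G,
hence to a G-invariant element of F_{ψ-χ}[G]. Such an element is a constant function c · 1, and so T
is a multiple of τ(1). -/
theorem exists_const_of_invariant [CharZero k] (χ ψ : Dual k A) (T : V ψ →ₗ[k] V χ)
    (hT : ∀ h, (π ψ h).arrowCongr (π χ h) T = T) :
    ∃ c : k, c • (1 : G → k) ∈ weightFun (ψ / χ) ∧ T = c • τ χ ψ 1 := by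
  have h1 := hτ.map_shift_coindLift χ ψ (fun _ => T) (fun h _ => (hT h).symm)
  have h2 := smul_one_of_shift_eq (F := hτ.coindLift χ ψ fun _ => T) fun g =>
    sub_eq_zero.1 (hτ.injective χ ψ _ (Submodule.sub_mem _
      (shift_mem_weightFun (hτ.coindLift_mem χ ψ _) g) (hτ.coindLift_mem χ ψ _)) fun x => by
        rw [map_sub, map_sub, ← shift_mul, h1, h1, sub_self])
  have h3 := hτ.coindLift_mem χ ψ fun _ => T
  have h4 := h1 1
  rw [shift_one] at h4
  rw [h2] at h3 h4
  exact ⟨_, h3, h4.symm.trans (map_smul _ _ _)⟩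

theorem eq_zero_of_invariant [CharZero k] {χ ψ : Dual k A} (hne : χ ≠ ψ) (T : V ψ →ₗ[k] V χ)
    (hT : ∀ h, (π ψ h).arrowCongr (π χ h) T = T) : T = 0 := by
  obtain ⟨c, hc, rfl⟩ := hτ.exists_const_of_invariant χ ψ T hT
  rw [eq_zero_of_const_mem (fun h => hne (dual_div_eq_one.1 h).symm) hc, zero_smul]

theorem scalar_of_invariant [CharZero k] (hone : ∀ χ, τ χ χ 1 = LinearMap.id) {χ : Dual k A}
    (T : V χ →ₗ[k] V χ) (hT : ∀ h, (π χ h).arrowCongr (π χ h) T = T) :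
    ∃ c : k, T = c • LinearMap.id := by
  obtain ⟨c, -, hc⟩ := hτ.exists_const_of_invariant χ χ T hT
  exact ⟨c, by rw [hc, hone]⟩

/-- Schur orthogonality for the representations `π_χ`. -/
theorem exists_orthogonality [CharZero k] [∀ χ, Module.Finite k (V χ)] [∀ χ, Nontrivial (V χ)]
    (hone : ∀ χ, τ χ χ 1 = LinearMap.id) (χ : Dual k A) (φ : V χ →ₗ[k] k) (w : V χ) :
    ∃ a : K → k, (∀ v, ∑ᶠ x, a x • π χ x v = φ v • w) ∧
      ∀ ψ, ψ ≠ χ → ∀ v : V ψ, ∑ᶠ x, a x • π ψ x v = 0 := by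
  have := Fintype.ofFinite K
  have hK : (Fintype.card K : k) ≠ 0 := by exact_mod_cast Fintype.card_pos.ne'
  refine ⟨fun x => ((Fintype.card K : k)⁻¹ * Module.finrank k (V χ)) * φ ((π χ x).symm w),
    fun v => ?_, fun ψ hψ v => ?_⟩
  · rw [finsum_eq_sum_of_fintype]
    have := finrank_smul_sum_smul (π χ) (hτ.linear χ χ) (hτ.scalar_of_invariant hone) φ v w
    simp only [mul_smul]
    rw [← Finset.smul_sum, ← Finset.smul_sum, this, smul_smul, inv_mul_cancel_left₀ hK]
  · rw [finsum_eq_sum_of_fintype]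
    have := sum_smul_eq_zero (π χ) (π ψ) (hτ.linear ψ χ) (hτ.eq_zero_of_invariant hψ) φ v w
    simp only [mul_smul]
    rw [← Finset.smul_sum, ← Finset.smul_sum, this, smul_zero, smul_zero]

/-- The representations `π_χ` are irreducible. -/
theorem irreducible [CharZero k] [∀ χ, Module.Finite k (V χ)] [∀ χ, Nontrivial (V χ)]
    (hone : ∀ χ, τ χ χ 1 = LinearMap.id) (χ : Dual k A) : IsIrreducibleProj (π χ) := by
  refine eq_top_iff.2 fun T _ => mem_of_smulRight_mem _ (fun φ w => ?_) T
  have := Fintype.ofFinite K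
  obtain ⟨a, ha, -⟩ := hτ.exists_orthogonality hone χ φ w
  have : φ.smulRight w = ∑ x, a x • (π χ x : V χ →ₗ[k] V χ) := by
    ext v
    rw [LinearMap.smulRight_apply, ← ha, finsum_eq_sum_of_fintype, LinearMap.sum_apply]
    rfl
  rw [this]
  exact Submodule.sum_mem _ fun x _ => Submodule.smul_mem _ _ (Submodule.subset_span ⟨x, rfl⟩)

end Finite

end IsFiberMap

namespace IsFiberRep

variable [Finite G] [CharZero k] {J : DynamicalTwist k A} {K : Subgroup G}
  {π : ∀ χ, K → V χ ≃ₗ[k] V χ} {τ : ∀ χ ψ, (G → k) →ₗ[k] (V ψ →ₗ[k] V χ)}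
  (hτ : IsFiberRep J.J K π τ)

include hτ


/-- Translation is multiplicative and so is τ; one factor whose translate is killed kills the
translate of the product. The functions supported on K are therefore an ideal of the category. -/
theorem starMul_mem_support_right {χ ψ ω : Dual k A} {f f' : G → k} (hf : f ∈ weightFun (ψ / χ))
    (hf' : f' ∈ fiberSupport K τ ψ ω) : starMul (J.J ω) f f' ∈ fiberSupport K τ χ ω := by
  refine ⟨starMul_mem J ω hf hf'.1, fun g hg => ?_⟩
  rw [shift_starMul, hτ.map_mul _ ψ _ _ (shift_mem_weightFun hf g) _ (shift_mem_weightFun hf'.1 g),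
    hf'.2 g hg, LinearMap.comp_zero]

theorem starMul_mem_support_left {χ ψ ω : Dual k A} {f f' : G → k}
    (hf : f ∈ fiberSupport K τ χ ψ) (hf' : f' ∈ weightFun (ω / ψ)) :
    starMul (J.J ω) f f' ∈ fiberSupport K τ χ ω := by
  refine ⟨starMul_mem J ω hf.1 hf', fun g hg => ?_⟩
  rw [shift_starMul, hτ.map_mul _ ψ _ _ (shift_mem_weightFun hf.1 g) _ (shift_mem_weightFun hf' g),
    hf.2 g hg, LinearMap.zero_comp]

theorem starMul_lift {χ ψ ω : Dual k A} {f : G → k} (hf : f ∈ weightFun (ψ / χ))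
    (T : V ω →ₗ[k] V ψ) :
    starMul (J.J ω) f (hτ.lift ψ ω T) = hτ.lift χ ω (τ χ ψ f ∘ₗ T) := by
  refine hτ.eq_of_mem_support (hτ.starMul_mem_support_right hf (hτ.lift_mem_support _ _ _))
    (hτ.lift_mem_support _ _ _) ?_
  rw [hτ.map_mul _ _ _ _ hf _ (hτ.lift_mem _ _ _), hτ.map_lift, hτ.map_lift]

theorem lift_starMul {χ ψ ω : Dual k A} {f : G → k} (T : V ψ →ₗ[k] V χ)
    (hf : f ∈ weightFun (ω / ψ)) :
    starMul (J.J ω) (hτ.lift χ ψ T) f = hτ.lift χ ω (T ∘ₗ τ ψ ω f) := by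
  refine hτ.eq_of_mem_support (hτ.starMul_mem_support_left (hτ.lift_mem_support _ _ _) hf)
    (hτ.lift_mem_support _ _ _) ?_
  rw [hτ.map_mul _ _ _ _ (hτ.lift_mem _ _ _) _ hf, hτ.map_lift, hτ.map_lift]

theorem lift_starMul_lift (χ ψ ω : Dual k A) (S : V ψ →ₗ[k] V χ) (T : V ω →ₗ[k] V ψ) :
    starMul (J.J ω) (hτ.lift χ ψ S) (hτ.lift ψ ω T) = hτ.lift χ ω (S ∘ₗ T) := by
  rw [hτ.starMul_lift (hτ.lift_mem _ _ _), hτ.map_lift]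

/-- `K` is the stabilizer of the kernel of `τ_{χχ}`. -/
theorem mem_iff_stabilizes [∀ χ, Nontrivial (V χ)] (χ : Dual k A) (g : G) :
    g ∈ K ↔ ∀ f ∈ weightFun (χ / χ), τ χ χ f = 0 → τ χ χ (shift g f) = 0 := by
  refine ⟨fun hg f hf h0 => ?_, fun h => ?_⟩
  · rw [hτ.equivariant χ χ ⟨g, hg⟩ f hf, h0, map_zero]
  · by_contra hg
    -- With e the lift of the identity, 1 - e lies in the kernel. For g outside K the translate of e
    -- is killed, so the translate of 1 - e is sent to the identity, which is not zero.
    have := h (1 - hτ.lift χ χ LinearMap.id)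
      (Submodule.sub_mem _ (one_mem_weightFun_div χ) (hτ.lift_mem _ _ _))
      (by rw [map_sub, hτ.map_one, hτ.map_lift, sub_self])
    rw [map_sub, shift_const, map_sub, hτ.map_one, hτ.map_shift_lift_of_notMem _ _ _ hg,
      sub_zero] at this
    exact one_ne_zero (α := Module.End k (V χ)) this

/-- Transport of a fibre representation along a conjugation and projective isomorphisms. -/
theorem transport {V' : Dual k A → Type*} [∀ χ, AddCommGroup (V' χ)] [∀ χ, Module k (V' χ)]
    {K' : Subgroup G} {π' : ∀ χ, K' → V' χ ≃ₗ[k] V' χ} (g : G)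
    (hK : ∀ h : G, h ∈ K ↔ g * h * g⁻¹ ∈ K') (φ : ∀ χ, V χ ≃ₗ[k] V' χ)
    (hφ : ∀ χ ψ (h : K) (T : V ψ →ₗ[k] V χ),
      (φ ψ).arrowCongr (φ χ) ((π ψ h).arrowCongr (π χ h) T) =
      (π' ψ ⟨g * h * g⁻¹, (hK h).1 h.2⟩).arrowCongr (π' χ ⟨g * h * g⁻¹, (hK h).1 h.2⟩)
        ((φ ψ).arrowCongr (φ χ) T)) :
    IsFiberRep J.J K' π'
      (fun χ ψ => ((φ ψ).arrowCongr (φ χ)).toLinearMap ∘ₗ τ χ ψ ∘ₗ shift g⁻¹) where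
  equivariant χ ψ h f hf := by
    have hh : g⁻¹ * (h : G) * g ∈ K := by
      rw [hK]
      simp [mul_assoc]
    have key := hφ χ ψ ⟨_, hh⟩ (τ χ ψ (shift g⁻¹ f))
    have hx : (⟨g * ((⟨_, hh⟩ : K) : G) * g⁻¹, (hK _).1 hh⟩ : K') = h := Subtype.ext (by
      simp [mul_assoc])
    rw [hx] at key
    simp only [LinearMap.comp_apply, LinearEquiv.coe_coe]
    rw [← key, ← hτ.equivariant _ _ _ _ (shift_mem_weightFun hf _), ← shift_mul, ← shift_mul]
    simp [mul_assoc]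
  injective χ ψ f hf h := hτ.injective χ ψ f hf fun x => by
    have := h (g * x)
    simp only [LinearMap.comp_apply, LinearEquiv.coe_coe] at this
    rw [← shift_mul, inv_mul_cancel_left] at this
    exact ((φ ψ).arrowCongr (φ χ)).map_eq_zero_iff.1 this
  surjective χ ψ T := by
    refine ⟨shift g (hτ.lift χ ψ (((φ ψ).arrowCongr (φ χ)).symm T)),
      ⟨shift_mem_weightFun (hτ.lift_mem _ _ _) _, fun x hx => ?_⟩, ?_⟩
    · simp only [LinearMap.comp_apply, LinearEquiv.coe_coe]
      rw [← shift_mul, ← shift_mul, hτ.map_shift_lift_of_notMem, map_zero]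
      rw [hK]
      simpa [mul_assoc] using hx
    · simp only [LinearMap.comp_apply, LinearEquiv.coe_coe]
      rw [← shift_mul, inv_mul_cancel, shift_one, hτ.map_lift, LinearEquiv.apply_symm_apply]
  map_one χ := by
    simp only [LinearMap.comp_apply, LinearEquiv.coe_coe]
    rw [shift_const, hτ.map_one]
    ext v
    simp [LinearEquiv.arrowCongr_apply]
  map_mul χ ψ ω f hf f' hf' := by
    simp only [LinearMap.comp_apply, LinearEquiv.coe_coe]
    rw [shift_starMul, hτ.map_mul _ ψ _ _ (shift_mem_weightFun hf _) _
      (shift_mem_weightFun hf' _)]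
    exact LinearEquiv.arrowCongr_comp _ _ _ _ _

end IsFiberRep

end FiberMap

/-! ### Uniqueness of fibre representations -/

section FullRep

variable {V : Dual k A → Type w} [∀ χ, AddCommGroup (V χ)] [∀ χ, Module k (V χ)]

/-- A multiplicative and surjective family of maps `F_{ψ-χ}[G] → Hom(V_ψ, V_χ)`. -/
structure IsFullRep (J : DynamicalTwist k A) (τ : ∀ χ ψ, (G → k) →ₗ[k] (V ψ →ₗ[k] V χ)) :
    Prop where
  map_one : ∀ χ, τ χ χ 1 = LinearMap.id
  map_mul : ∀ χ ψ ω : Dual k A, ∀ f ∈ weightFun (ψ / χ), ∀ f' ∈ weightFun (ω / ψ),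
    τ χ ω (starMul (J.J ω) f f') = τ χ ψ f ∘ₗ τ ψ ω f'
  surjective : ∀ (χ ψ : Dual k A) (T : V ψ →ₗ[k] V χ), ∃ f ∈ weightFun (ψ / χ), τ χ ψ f = T

theorem IsFiberRep.isFullRep {J : DynamicalTwist k A} {K : Subgroup G}
    {π : ∀ χ, K → V χ ≃ₗ[k] V χ} {τ : ∀ χ ψ, (G → k) →ₗ[k] (V ψ →ₗ[k] V χ)}
    (hτ : IsFiberRep J.J K π τ) : IsFullRep J τ where
  map_one := hτ.map_one
  map_mul := hτ.map_mul
  surjective χ ψ T := ⟨_, hτ.lift_mem χ ψ T, hτ.map_lift χ ψ T⟩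

theorem IsFullRep.comp_shift {J : DynamicalTwist k A}
    {τ : ∀ χ ψ, (G → k) →ₗ[k] (V ψ →ₗ[k] V χ)} (hτ : IsFullRep J τ) (g : G) :
    IsFullRep J fun χ ψ => τ χ ψ ∘ₗ shift g where
  map_one χ := by rw [LinearMap.comp_apply, shift_const, hτ.map_one]
  map_mul χ ψ ω f hf f' hf' := by
    simp only [LinearMap.comp_apply]
    rw [shift_starMul, hτ.map_mul _ ψ _ _ (shift_mem_weightFun hf _) _
      (shift_mem_weightFun hf' _)]
  surjective χ ψ T := by
    obtain ⟨f, hf, rfl⟩ := hτ.surjective χ ψ T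
    refine ⟨shift g⁻¹ f, shift_mem_weightFun hf _, ?_⟩
    rw [LinearMap.comp_apply, ← shift_mul, mul_inv_cancel, shift_one]

/-- Two full representations, the kernel of one of which contains the kernel of the other one,
are isomorphic. -/
theorem IsFullRep.exists_intertwiner [Finite G] [CharZero k] {J : DynamicalTwist k A}
    {V' : Dual k A → Type*}
    [∀ χ, AddCommGroup (V' χ)] [∀ χ, Module k (V' χ)] [∀ χ, Module.Finite k (V χ)]
    {τ : ∀ χ ψ, (G → k) →ₗ[k] (V ψ →ₗ[k] V χ)} (hτ : IsFullRep J τ)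
    {τ' : ∀ χ ψ, (G → k) →ₗ[k] (V' ψ →ₗ[k] V' χ)} (hτ' : IsFullRep J τ') {χ₀ : Dual k A}
    [Nontrivial (V' χ₀)]
    (hker : ∀ χ ψ : Dual k A, ∀ f ∈ weightFun (ψ / χ), τ χ ψ f = 0 → τ' χ ψ f = 0) :
    ∃ φ : ∀ χ, V χ ≃ₗ[k] V' χ, ∀ (χ ψ : Dual k A), ∀ f ∈ weightFun (ψ / χ), ∀ v,
      τ' χ ψ f (φ ψ v) = φ χ (τ χ ψ f v) := by
  choose ρ hρ using fun χ ψ => exists_linear_factor _ (τ χ ψ) (τ' χ ψ) (hτ.surjective χ ψ)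
    (hker χ ψ)
  have hmul : ∀ χ ψ ω (S : V ψ →ₗ[k] V χ) (T : V ω →ₗ[k] V ψ),
      ρ χ ω (S ∘ₗ T) = ρ χ ψ S ∘ₗ ρ ψ ω T := by
    intro χ ψ ω S T
    obtain ⟨f, hf, rfl⟩ := hτ.surjective χ ψ S
    obtain ⟨f', hf', rfl⟩ := hτ.surjective ψ ω T
    rw [← hτ.map_mul _ _ _ _ hf _ hf', ← hρ _ _ _ (starMul_mem J ω hf hf'), ← hρ _ _ _ hf,
      ← hρ _ _ _ hf', hτ'.map_mul _ _ _ _ hf _ hf']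
  have hne : ∃ χ ψ T, ρ χ ψ T ≠ 0 := by
    refine ⟨χ₀, χ₀, LinearMap.id, ?_⟩
    rw [← hτ.map_one, ← hρ _ _ _ (one_mem_weightFun_div _), hτ'.map_one]
    exact one_ne_zero (α := Module.End k (V' χ₀))
  have htrans : ∀ χ ψ (x : V' ψ) (y : V' χ), x ≠ 0 → ∃ T, ρ χ ψ T x = y := by
    intro χ ψ x y hx
    obtain ⟨T', hT'⟩ := exists_linearMap_apply_eq (k := k) hx y
    obtain ⟨f, hf, rfl⟩ := hτ'.surjective χ ψ T'
    exact ⟨τ χ ψ f, by rw [← hρ _ _ _ hf, hT']⟩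
  obtain ⟨φ, hφ⟩ := DynTwist.exists_intertwiner ρ hmul hne htrans
  exact ⟨φ, fun χ ψ f hf v => by rw [hρ χ ψ f hf, hφ]⟩

/-- Two projective actions implementing the same action on functions differ by scalars. -/
theorem exists_scalar_of_equivariant {J : DynamicalTwist k A} [∀ χ, Nontrivial (V χ)]
    {τ : ∀ χ ψ, (G → k) →ₗ[k] (V ψ →ₗ[k] V χ)} (hτ : IsFullRep J τ) (h : G)
    (p q : ∀ χ, V χ ≃ₗ[k] V χ)
    (hp : ∀ χ ψ : Dual k A, ∀ f ∈ weightFun (ψ / χ), ∀ v,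
      τ χ ψ (shift h f) (p ψ v) = p χ (τ χ ψ f v))
    (hq : ∀ χ ψ : Dual k A, ∀ f ∈ weightFun (ψ / χ), ∀ v,
      τ χ ψ (shift h f) (q ψ v) = q χ (τ χ ψ f v)) :
    ∃ a : kˣ, ∀ χ v, q χ v = (a : k) • p χ v := by
  obtain ⟨a, ha⟩ := exists_unit_scalar (fun χ => (p χ).symm.trans (q χ)) fun χ ψ T v => by
    obtain ⟨f, hf, rfl⟩ := (hτ.comp_shift h).surjective χ ψ T
    obtain ⟨w, rfl⟩ := (p ψ).surjective v
    simp only [LinearEquiv.trans_apply, LinearMap.comp_apply]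
    rw [hp _ _ _ hf, LinearEquiv.symm_apply_apply, LinearEquiv.symm_apply_apply, hq _ _ _ hf]
  refine ⟨a, fun χ v => ?_⟩
  rw [← ha]
  simp

variable [Finite G] [CharZero k] {J : DynamicalTwist k A} [∀ χ, Module.Finite k (V χ)]

/-- The translates of the unit of the support ideal sum up to a multiple of `1`, so some translate
acts nontrivially in any other full representation. -/
theorem IsFiberRep.exists_shift_lift_ne_zero {K : Subgroup G} {π : ∀ χ, K → V χ ≃ₗ[k] V χ}
    {τ : ∀ χ ψ, (G → k) →ₗ[k] (V ψ →ₗ[k] V χ)} (hτ : IsFiberRep J.J K π τ)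
    (χ : Dual k A) {H : Type*} [AddCommGroup H] [Module k H] (Φ : (G → k) →ₗ[k] H)
    (hΦ : Φ 1 ≠ 0) : ∃ g, Φ (shift g (hτ.lift χ χ LinearMap.id)) ≠ 0 := by
  by_contra! hcon
  refine hΦ ?_
  have h1 := hτ.coindLift_eq (one_mem_weightFun_div (G := G) χ)
  have h2 : (fun g : G => τ χ χ (shift g 1)) = fun _ => LinearMap.id := by
    ext1 g
    rw [shift_const, hτ.map_one]
  rw [← h1, h2, IsFiberMap.coindLift, LinearMap.smul_apply, LinearMap.sum_apply, map_smul, map_sum]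
  simp [hcon]

/-- The data underlying two fibre representations of the same twist are isomorphic. -/
theorem IsFiberRep.exists_iso {V' : Dual k A → Type*} [∀ χ, AddCommGroup (V' χ)]
    [∀ χ, Module k (V' χ)] [∀ χ, Nontrivial (V χ)] [∀ χ, Nontrivial (V' χ)]
    {K : Subgroup G} {π : ∀ χ, K → V χ ≃ₗ[k] V χ}
    {τ : ∀ χ ψ, (G → k) →ₗ[k] (V ψ →ₗ[k] V χ)} (hτ : IsFiberRep J.J K π τ)
    {K' : Subgroup G} {π' : ∀ χ, K' → V' χ ≃ₗ[k] V' χ}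
    {τ' : ∀ χ ψ, (G → k) →ₗ[k] (V' ψ →ₗ[k] V' χ)} (hτ' : IsFiberRep J.J K' π' τ') :
    ∃ (g : G) (hK : ∀ h : G, h ∈ K ↔ g * h * g⁻¹ ∈ K')
    (φ : ∀ χ, V χ ≃ₗ[k] V' χ) (α : K → kˣ),
    ∀ (χ : Dual k A) (h : K) (v : V χ),
      π' χ ⟨g * h * g⁻¹, (hK h).1 h.2⟩ (φ χ v) = (α h : k) • φ χ (π χ h v) := by
  -- Two fibre representations need not have equal kernels, only kernels that are translates of each
  -- other. This g, for which τ' does not kill the translate of the unit e of the support ideal,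
  -- makes them match.
  obtain ⟨g, hg⟩ := hτ.exists_shift_lift_ne_zero 1 (τ' 1 1) (by
    rw [hτ'.map_one]
    exact one_ne_zero (α := Module.End k (V' 1)))
  have hfull := hτ'.isFullRep.comp_shift g
  have hker : ∀ χ ψ : Dual k A, ∀ f ∈ weightFun (ψ / χ), τ χ ψ f = 0 →
      (τ' χ ψ ∘ₗ shift g) f = 0 := by
    intro χ ψ f hf h0
    by_contra hne
    obtain ⟨w, hw⟩ : ∃ w, (τ' χ ψ ∘ₗ shift g) f w ≠ 0 := by
      by_contra! h
      exact hne (LinearMap.ext h)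
    obtain ⟨u, hu⟩ : ∃ u, τ' 1 1 (shift g (hτ.lift 1 1 LinearMap.id)) u ≠ 0 := by
      by_contra! h
      exact hg (LinearMap.ext h)
    obtain ⟨T, hT⟩ := exists_linearMap_apply_eq (k := k) hw u
    obtain ⟨a, ha, rfl⟩ := hfull.surjective 1 χ T
    -- If f is killed by τ, then e * (a * f) = 0, since left multiplication by e only sees τ(a * f).
    -- The element a was chosen to carry a nonzero value of the translated τ'(f) to a vector u not
    -- killed by the image of e, which is a contradiction.
    have h1 : starMul (J.J ψ) (hτ.lift 1 1 LinearMap.id) (starMul (J.J ψ) a f) = 0 := by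
      rw [hτ.lift_starMul _ (starMul_mem J ψ ha hf), hτ.map_mul _ _ _ _ ha _ hf, h0,
        LinearMap.comp_zero, LinearMap.comp_zero, map_zero]
    have h2 := congrArg (τ' 1 ψ ∘ₗ shift g) h1
    rw [hfull.map_mul 1 1 ψ _ (hτ.lift_mem _ _ _) _ (starMul_mem J ψ ha hf),
      hfull.map_mul 1 χ ψ _ ha _ hf, map_zero] at h2
    have h3 := LinearMap.congr_fun h2 w
    refine hu (Eq.trans (congrArg _ ?_) h3)
    exact hT.symm
  obtain ⟨φ, hφ⟩ := hτ.isFullRep.exists_intertwiner hfull (χ₀ := 1) hker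
  have hzero : ∀ f ∈ weightFun ((1 : Dual k A) / 1), τ 1 1 f = 0 ↔ τ' 1 1 (shift g f) = 0 := by
    intro f hf
    refine ⟨hker 1 1 f hf, fun h => LinearMap.ext fun v => ?_⟩
    have := hφ 1 1 f hf v
    rw [LinearMap.comp_apply, h, LinearMap.zero_apply] at this
    exact (φ 1).map_eq_zero_iff.1 this.symm
  have hK : ∀ h : G, h ∈ K ↔ g * h * g⁻¹ ∈ K' := by
    intro h
    rw [hτ.mem_iff_stabilizes 1, hτ'.mem_iff_stabilizes 1]
    constructor
    · intro H f hf h0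
      have h1 := H (shift g⁻¹ f) (shift_mem_weightFun hf _) (by
        rwa [hzero _ (shift_mem_weightFun hf _), ← shift_mul, mul_inv_cancel, shift_one])
      rwa [hzero _ (shift_mem_weightFun (shift_mem_weightFun hf _) _), ← shift_mul,
        ← shift_mul] at h1
    · intro H f hf h0
      have h1 := H (shift g f) (shift_mem_weightFun hf _) ((hzero _ hf).1 h0)
      rwa [← shift_mul, inv_mul_cancel_right, shift_mul,
        ← hzero _ (shift_mem_weightFun hf _)] at h1
  -- Transported by φ, the operators π'_χ(g h g⁻¹) implement the same translation of functions as
  -- π_χ(h). They thus differ by a scalar common to all χ, as an isomorphism of data requires.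
  have hscal : ∀ h : K, ∃ a : kˣ, ∀ χ v,
      ((φ χ).trans (π' χ ⟨g * h * g⁻¹, (hK h).1 h.2⟩)).trans (φ χ).symm v =
        (a : k) • π χ h v := by
    intro h
    refine exists_scalar_of_equivariant hτ.isFullRep (h : G) (fun χ => π χ h) _ ?_ ?_
    · intro χ ψ f hf v
      rw [hτ.equivariant χ ψ h f hf]
      simp [LinearEquiv.arrowCongr_apply]
    · intro χ ψ f hf v
      simp only [LinearEquiv.trans_apply]
      rw [LinearEquiv.eq_symm_apply, ← hφ _ _ _ (shift_mem_weightFun hf _),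
        LinearEquiv.apply_symm_apply, LinearMap.comp_apply, ← hφ _ _ _ hf, LinearMap.comp_apply]
      have h1 := hτ'.equivariant χ ψ ⟨g * h * g⁻¹, (hK h).1 h.2⟩ (shift g f)
        (shift_mem_weightFun hf _)
      rw [← shift_mul, inv_mul_cancel_right, shift_mul] at h1
      rw [h1]
      simp [LinearEquiv.arrowCongr_apply]
  choose α hα using hscal
  refine ⟨g, hK, φ, α, fun χ h v => ?_⟩
  rw [← map_smul, ← hα, LinearEquiv.trans_apply, LinearEquiv.trans_apply,
    LinearEquiv.apply_symm_apply]

end FullRep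

/-- The datum `𝒟` carries a fibre representation of the twist `J`. -/
def HasFiberRep (J : DynamicalTwist k A) (𝒟 : DynamicalDatum k A) : Prop :=
  ∃ τ, IsFiberRep J.J 𝒟.K 𝒟.π τ

theorem HasFiberRep.datumIso [Finite G] [CharZero k] {J : DynamicalTwist k A}
    {𝒟 𝒟' : DynamicalDatum k A} (h : HasFiberRep J 𝒟) (h' : HasFiberRep J 𝒟') : DatumIso 𝒟 𝒟' := by
  obtain ⟨τ, hτ⟩ := h
  obtain ⟨τ', hτ'⟩ := h'
  exact hτ.exists_iso hτ'

/-- The multiplier α does not depend on χ, so it cancels in the conjugation action on Hom(V_ψ, V_χ),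
and the fibre representation can be transported along the isomorphism. -/
theorem HasFiberRep.of_datumIso [Finite G] [CharZero k] {J : DynamicalTwist k A}
    {𝒟 𝒟' : DynamicalDatum k A} (h : HasFiberRep J 𝒟) (h' : DatumIso 𝒟 𝒟') : HasFiberRep J 𝒟' := by
  obtain ⟨τ, hτ⟩ := h
  obtain ⟨g, hK, φ, α, hα⟩ := h'
  refine ⟨_, hτ.transport g hK φ fun χ ψ h T => LinearMap.ext fun v => ?_⟩
  obtain ⟨w, rfl⟩ := (φ ψ).surjective v
  obtain ⟨w, rfl⟩ := (𝒟.π ψ h).surjective w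
  have h1 := hα ψ h w
  have h2 : (𝒟'.π ψ ⟨g * h * g⁻¹, (hK h).1 h.2⟩).symm (φ ψ (𝒟.π ψ h w)) =
      (((α h)⁻¹ : kˣ) : k) • φ ψ w := by
    rw [LinearEquiv.symm_apply_eq, map_smul, h1, smul_smul]
    simp
  simp only [LinearEquiv.arrowCongr_apply, LinearEquiv.symm_apply_apply]
  rw [h2, map_smul, LinearEquiv.symm_apply_apply, map_smul, map_smul, map_smul, hα, smul_smul]
  simp

/-! ### Gauge transformations and fibre representations -/

/-- The right translation of functions on `G` by an element of `k[G]`. -/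
def rightMul (x : MonoidAlgebra k G) : (G → k) →ₗ[k] (G → k) :=
  LinearMap.pi fun g => (evalPairing k G).flip (MonoidAlgebra.of k G g * x)

theorem rightMul_apply (x : MonoidAlgebra k G) (f : G → k) (g : G) :
    rightMul x f g = evalFun f (MonoidAlgebra.of k G g * x) := rfl

theorem evalFun_rightMul (x : MonoidAlgebra k G) (f : G → k) (y : MonoidAlgebra k G) :
    evalFun (rightMul x f) y = evalFun f (y * x) := by
  induction y using monoidAlgebra_induction with
  | of g => rw [evalFun_of, rightMul_apply]
  | add y z hy hz => rw [add_mul, map_add, hy, hz, map_add]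
  | smul c y hy => rw [smul_mul_assoc, map_smul, hy, map_smul]

theorem rightMul_mul (x y : MonoidAlgebra k G) (f : G → k) :
    rightMul (x * y) f = rightMul x (rightMul y f) := by
  ext g
  rw [rightMul_apply, rightMul_apply, evalFun_rightMul, mul_assoc]

theorem rightMul_one (f : G → k) : rightMul 1 f = f := by
  ext g
  rw [rightMul_apply, mul_one, evalFun_of]

theorem shift_rightMul (x : MonoidAlgebra k G) (g : G) (f : G → k) :
    shift g (rightMul x f) = rightMul x (shift g f) := by
  ext h
  rw [shift_apply, rightMul_apply, rightMul_apply, evalFun_shift, map_mul (MonoidAlgebra.of k G),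
    mul_assoc]

theorem rightMul_of {χ : Dual k A} {f : G → k} (hf : f ∈ weightFun χ) (a : A) :
    rightMul (MonoidAlgebra.of k G a) f = ((χ a : kˣ) : k) • f := by
  ext g
  rw [rightMul_apply, evalFun_mul_of hf, evalFun_of]
  rfl

theorem rightMul_mem {x : MonoidAlgebra k G}
    (hx : ∀ a : A, MonoidAlgebra.of k G a * x = x * MonoidAlgebra.of k G a) {χ : Dual k A}
    {f : G → k} (hf : f ∈ weightFun χ) : rightMul x f ∈ weightFun χ := fun h a => by
  rw [rightMul_apply, rightMul_apply, map_mul (MonoidAlgebra.of k G), mul_assoc, hx, ← mul_assoc,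
    evalFun_mul_of hf, mul_comm]

theorem rightMul_const (x : MonoidAlgebra k G) :
    rightMul x (1 : G → k) = Bialgebra.counitAlgHom k (MonoidAlgebra k G) x • (1 : G → k) := by
  have key : ∀ y : MonoidAlgebra k G,
      evalFun 1 y = Bialgebra.counitAlgHom k (MonoidAlgebra k G) y := by
    intro y
    induction y using monoidAlgebra_induction with
    | of g => simp
    | add y z hy hz => rw [map_add, hy, hz, map_add]
    | smul c y hy => rw [map_smul, hy, map_smul]
  ext g
  rw [rightMul_apply, key, map_mul]
  simp

section Finite

variable [Finite G]

/-- Every functional on the space of functions on `G` is given by an element of `k[G]`. -/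
theorem exists_evalFun_eq (Λ : (G → k) →ₗ[k] k) :
    ∃ x : MonoidAlgebra k G, ∀ f, evalFun f x = Λ f := by
  classical
  have := Fintype.ofFinite G
  refine ⟨∑ g, Λ (Pi.single g 1) • MonoidAlgebra.of k G g, fun f => ?_⟩
  rw [map_sum]
  simp only [map_smul, evalFun_of]
  conv_rhs => rw [← Finset.univ_sum_single f, map_sum]
  refine Finset.sum_congr rfl fun g _ => ?_
  have : (Pi.single g (f g) : G → k) = f g • Pi.single g 1 := by
    rw [← Pi.single_smul, smul_eq_mul, mul_one]
  rw [this, map_smul, smul_eq_mul, smul_eq_mul, mul_comm]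

variable [CharZero k]

/-- The weight ω-ψ of f' selects the summand of t(ω - h^{(2)}) with t(ω-(ω-ψ)) = t(ψ). The two
factors are thus translated by t at their own right indices. -/
theorem evalFun₂_mul_gaugeTensor {t : Dual k A → (MonoidAlgebra k G)ˣ}
    (ht : ZeroWeight₁ fun χ => (t χ : MonoidAlgebra k G)) {ψ ω : Dual k A} (f : G → k)
    {f' : G → k} (hf' : f' ∈ weightFun (ω / ψ))
    (x : MonoidAlgebra k G ⊗[k] MonoidAlgebra k G) :
    evalFun₂ f f' (x * gaugeTensor t ω) =
      evalFun₂ (rightMul (t ψ : MonoidAlgebra k G) f) (rightMul (t ω : MonoidAlgebra k G) f') x := by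
  classical
  have := Fintype.ofFinite (Dual k A)
  induction x using TensorProduct.induction_on with
  | zero => simp
  | tmul a b =>
    rw [gaugeTensor, shiftByWeight, finsum_eq_sum_of_fintype, Finset.sum_mul, Finset.mul_sum,
      map_sum, evalFun₂_tmul, evalFun_rightMul, evalFun_rightMul, Finset.sum_eq_single (ω / ψ)]
    · rw [Algebra.TensorProduct.tmul_mul_tmul, Algebra.TensorProduct.tmul_mul_tmul, mul_one,
        evalFun₂_tmul, dual_div_div_cancel, ht.charIdem_comm ω, ← mul_assoc,
        evalFun_mul_charIdem hf']
    · intro θ _ hθ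
      rw [Algebra.TensorProduct.tmul_mul_tmul, Algebra.TensorProduct.tmul_mul_tmul, evalFun₂_tmul,
        ht.charIdem_comm ω, ← mul_assoc b, evalFun_mul_charIdem_of_ne hf' hθ.symm, mul_zero]
    · simp
  | add a b ha hb => rw [add_mul, map_add, ha, hb, map_add]

theorem starMul_mul_gaugeTensor {t : Dual k A → (MonoidAlgebra k G)ˣ}
    (ht : ZeroWeight₁ fun χ => (t χ : MonoidAlgebra k G)) {ψ ω : Dual k A} (f : G → k)
    {f' : G → k} (hf' : f' ∈ weightFun (ω / ψ))
    (x : MonoidAlgebra k G ⊗[k] MonoidAlgebra k G) :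
    starMul (x * gaugeTensor t ω) f f' =
      starMul x (rightMul (t ψ : MonoidAlgebra k G) f) (rightMul (t ω : MonoidAlgebra k G) f') := by
  ext g
  rw [starMul, starMul, ← mul_assoc, evalFun₂_mul_gaugeTensor ht f hf']

/-- The gauge equation, multiplied by Δ(t(ω)), says that right translation by t at the right index
of a morphism space is a functor from the category of J' to that of J. -/
theorem rightMul_starMul_gauge {J J' : Dual k A → MonoidAlgebra k G ⊗[k] MonoidAlgebra k G}
    {t : Dual k A → (MonoidAlgebra k G)ˣ} (ht : ZeroWeight₁ fun χ => (t χ : MonoidAlgebra k G))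
    (h : ∀ χ, J' χ = Bialgebra.comulAlgHom k (MonoidAlgebra k G)
      (((t χ)⁻¹ : (MonoidAlgebra k G)ˣ) : MonoidAlgebra k G) * J χ * gaugeTensor t χ)
    {ψ ω : Dual k A} (f : G → k) {f' : G → k} (hf' : f' ∈ weightFun (ω / ψ)) :
    rightMul (t ω : MonoidAlgebra k G) (starMul (J' ω) f f') =
      starMul (J ω) (rightMul (t ψ : MonoidAlgebra k G) f)
        (rightMul (t ω : MonoidAlgebra k G) f') := by
  have h1 : Bialgebra.comulAlgHom k (MonoidAlgebra k G) (t ω : MonoidAlgebra k G) * J' ω =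
      J ω * gaugeTensor t ω := by
    rw [h, ← mul_assoc, ← mul_assoc, ← map_mul, Units.mul_inv, map_one, one_mul]
  ext g
  rw [rightMul_apply, ← evalFun₂_comul,
    map_mul (Bialgebra.comulAlgHom k (MonoidAlgebra k G)), mul_assoc, h1, evalFun₂_comul, evalFun_of,
    starMul_mul_gaugeTensor ht f hf']

/-- Precompose τ_{χψ} with right translation by t(ψ). This commutes with left translations,
preserves weights because t commutes with A, fixes 1 because ε(t) = 1, and is multiplicative by
`rightMul_starMul_gauge`. -/
theorem HasFiberRep.of_gaugeEquivalent {J J' : DynamicalTwist k A} {𝒟 : DynamicalDatum k A}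
    (h : HasFiberRep J 𝒟) (hJ : GaugeEquivalent J J') : HasFiberRep J' 𝒟 := by
  obtain ⟨τ, hτ⟩ := h
  obtain ⟨t, ht, hJ⟩ := hJ
  have hcomm : ∀ χ (a : A), MonoidAlgebra.of k G a * ((t χ)⁻¹ : (MonoidAlgebra k G)ˣ) =
      ((t χ)⁻¹ : (MonoidAlgebra k G)ˣ) * MonoidAlgebra.of k G a := fun χ a =>
    ht.inv.1 χ a
  refine ⟨fun χ ψ => τ χ ψ ∘ₗ rightMul (t ψ : MonoidAlgebra k G), ?_⟩
  refine { equivariant := ?_, injective := ?_, surjective := ?_, map_one := ?_, map_mul := ?_ }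
  · intro χ ψ h f hf
    rw [LinearMap.comp_apply, ← shift_rightMul,
      hτ.equivariant χ ψ h _ (rightMul_mem (ht.1 ψ) hf), LinearMap.comp_apply]
  · intro χ ψ f hf h0
    have := hτ.injective χ ψ (rightMul (t ψ : MonoidAlgebra k G) f)
      (rightMul_mem (ht.1 ψ) hf) fun g => by rw [shift_rightMul]; exact h0 g
    rw [← rightMul_one f, ← Units.inv_mul (t ψ), rightMul_mul, this, map_zero]
  · intro χ ψ T
    refine ⟨rightMul (((t ψ)⁻¹ : (MonoidAlgebra k G)ˣ) : MonoidAlgebra k G) (hτ.lift χ ψ T),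
      ⟨rightMul_mem (hcomm ψ) (hτ.lift_mem _ _ _), fun g hg => ?_⟩, ?_⟩
    · rw [LinearMap.comp_apply, ← shift_rightMul, ← rightMul_mul, Units.mul_inv, rightMul_one,
        hτ.map_shift_lift_of_notMem _ _ _ hg]
    · rw [LinearMap.comp_apply, ← rightMul_mul, Units.mul_inv, rightMul_one, hτ.map_lift]
  · intro χ
    rw [LinearMap.comp_apply, rightMul_const, ht.2, one_smul, hτ.map_one]
  · intro χ ψ ω f hf f' hf'
    rw [LinearMap.comp_apply, rightMul_starMul_gauge ht.1 hJ f hf',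
      hτ.map_mul χ ψ ω _ (rightMul_mem (ht.1 ψ) hf) _ (rightMul_mem (ht.1 ω) hf')]
    rfl

variable [IsAlgClosed k] [IsMulCommutative A]

/-- For fixed ψ the weights ψ-χ exhaust A^*, so these spaces span all functions on G. -/
theorem eq_of_rightMul_eq (ψ : Dual k A) {x y : MonoidAlgebra k G}
    (h : ∀ χ : Dual k A, ∀ f ∈ weightFun (ψ / χ), rightMul x f = rightMul y f) : x = y := by
  have := Fintype.ofFinite (Dual k A)
  refine evalFun_ext fun f => ?_
  rw [← sum_weightProj (A := A) f, evalFun_sum, evalFun_sum]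
  refine Finset.sum_congr rfl fun χ _ => ?_
  have h1 := h (ψ / χ) (weightProj χ f) (by
    rw [dual_div_div_cancel]
    exact weightProj_mem _ _)
  have h2 := congrFun h1 1
  rwa [rightMul_apply, rightMul_apply, map_one, one_mul, one_mul] at h2

/-! ### Two fibre maps for the same representations differ by right multiplication. -/

section Comparison

variable {V : Dual k A → Type w} [∀ χ, AddCommGroup (V χ)] [∀ χ, Module k (V χ)]
  {K : Subgroup G} {π : ∀ χ, K → V χ ≃ₗ[k] V χ} {τ τ' : ∀ χ ψ, (G → k) →ₗ[k] (V ψ →ₗ[k] V χ)}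

/-- The automorphism of `F_{ψ-χ}[G]` relating two fibre maps. -/
def comparison (hτ : IsFiberMap K π τ) (τ' : ∀ χ ψ, (G → k) →ₗ[k] (V ψ →ₗ[k] V χ))
    (χ ψ : Dual k A) : (G → k) →ₗ[k] (G → k) :=
  hτ.coindLift χ ψ ∘ₗ LinearMap.pi fun g => τ' χ ψ ∘ₗ shift g

theorem comparison_mem (hτ : IsFiberMap K π τ) (τ' : ∀ χ ψ, (G → k) →ₗ[k] (V ψ →ₗ[k] V χ))
    (χ ψ : Dual k A) (f : G → k) : comparison hτ τ' χ ψ f ∈ weightFun (ψ / χ) :=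
  hτ.coindLift_mem _ _ _

theorem map_shift_comparison (hτ : IsFiberMap K π τ) (hτ' : IsFiberMap K π τ') {χ ψ : Dual k A}
    {f : G → k} (hf : f ∈ weightFun (ψ / χ)) (g : G) :
    τ χ ψ (shift g (comparison hτ τ' χ ψ f)) = τ' χ ψ (shift g f) := by
  refine hτ.map_shift_coindLift χ ψ _ (fun h g => ?_) g
  simp only [LinearMap.pi_apply, LinearMap.comp_apply]
  rw [shift_mul, hτ'.equivariant _ _ _ _ (shift_mem_weightFun hf _)]

theorem eq_comparison (hτ : IsFiberMap K π τ) (hτ' : IsFiberMap K π τ') {χ ψ : Dual k A}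
    {f f' : G → k} (hf : f ∈ weightFun (ψ / χ)) (hf' : f' ∈ weightFun (ψ / χ))
    (h : ∀ g, τ χ ψ (shift g f') = τ' χ ψ (shift g f)) : f' = comparison hτ τ' χ ψ f :=
  sub_eq_zero.1 (hτ.injective χ ψ _ (Submodule.sub_mem _ hf' (comparison_mem hτ τ' χ ψ f))
    fun g => by rw [map_sub, map_sub, map_shift_comparison hτ hτ' hf, h, sub_self])

/-- The comparison map commutes with left translations, hence is right multiplication by an element
of k[G]. For fixed ψ distinct χ occupy distinct weights, so a single element x serves all χ. -/
theorem exists_rightMul_eq_comparison (hτ : IsFiberMap K π τ) (hτ' : IsFiberMap K π τ')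
    (ψ : Dual k A) : ∃ x : MonoidAlgebra k G, ∀ χ : Dual k A, ∀ f ∈ weightFun (ψ / χ),
      rightMul x f = comparison hτ τ' χ ψ f := by
  classical
  have := Fintype.ofFinite (Dual k A)
  obtain ⟨x, hx⟩ := exists_evalFun_eq (∑ χ : Dual k A,
    LinearMap.proj (1 : G) ∘ₗ comparison hτ τ' χ ψ ∘ₗ weightProj (ψ / χ))
  refine ⟨x, fun χ f hf => ?_⟩
  have hcomm : ∀ g, comparison hτ τ' χ ψ (shift g f) = shift g (comparison hτ τ' χ ψ f) :=
    fun g => (eq_comparison hτ hτ' (shift_mem_weightFun hf g)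
      (shift_mem_weightFun (comparison_mem _ _ _ _ _) g) fun y => by
        rw [← shift_mul, map_shift_comparison hτ hτ' hf, shift_mul]).symm
  ext g
  have h1 := hx (shift g⁻¹ f)
  rw [evalFun_shift, inv_inv, LinearMap.sum_apply, Finset.sum_eq_single χ] at h1
  · simp only [LinearMap.comp_apply, LinearMap.proj_apply] at h1
    rw [weightProj_of_mem (shift_mem_weightFun hf _), hcomm, shift_apply, inv_inv, mul_one] at h1
    rw [rightMul_apply, h1]
  · intro θ _ hθ
    have h2 : weightProj (ψ / θ) (shift g⁻¹ f) = 0 := by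
      ext y
      rw [weightProj_apply, evalFun_mul_charIdem_of_ne (shift_mem_weightFun hf _)]
      · rfl
      · intro h
        apply hθ
        rw [← dual_div_div_cancel ψ θ, ← h, dual_div_div_cancel]
    simp [h2]
  · simp

end Comparison

/-- The comparison elements x(ψ) are the gauge transformation t. They are invertible by the opposite
comparison, commute with A because A acts by scalars on each weight, and have counit 1 because both
fibre maps send 1 to the identity. Multiplicativity of both fibre maps is the gauge equation. -/
theorem HasFiberRep.gaugeEquivalent {J J' : DynamicalTwist k A} {𝒟 : DynamicalDatum k A}
    (h : HasFiberRep J 𝒟) (h' : HasFiberRep J' 𝒟) : GaugeEquivalent J J' := by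
  obtain ⟨τ, hτ⟩ := h
  obtain ⟨τ', hτ'⟩ := h'
  choose x hx using exists_rightMul_eq_comparison hτ.toIsFiberMap hτ'.toIsFiberMap
  choose y hy using exists_rightMul_eq_comparison hτ'.toIsFiberMap hτ.toIsFiberMap
  have hxy : ∀ ψ, x ψ * y ψ = 1 := fun ψ => eq_of_rightMul_eq ψ fun χ f hf => by
    rw [rightMul_one, rightMul_mul, hy ψ χ f hf, hx ψ χ _ (comparison_mem _ _ _ _ _)]
    refine (eq_comparison hτ.toIsFiberMap hτ'.toIsFiberMap (comparison_mem _ _ _ _ _) hf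
      fun g => ?_).symm
    rw [map_shift_comparison hτ'.toIsFiberMap hτ.toIsFiberMap hf]
  have hyx : ∀ ψ, y ψ * x ψ = 1 := fun ψ => eq_of_rightMul_eq ψ fun χ f hf => by
    rw [rightMul_one, rightMul_mul, hx ψ χ f hf, hy ψ χ _ (comparison_mem _ _ _ _ _)]
    refine (eq_comparison hτ'.toIsFiberMap hτ.toIsFiberMap (comparison_mem _ _ _ _ _) hf
      fun g => ?_).symm
    rw [map_shift_comparison hτ.toIsFiberMap hτ'.toIsFiberMap hf]
  let t : Dual k A → (MonoidAlgebra k G)ˣ := fun ψ => ⟨x ψ, y ψ, hxy ψ, hyx ψ⟩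
  have hzero : ZeroWeight₁ fun χ => (t χ : MonoidAlgebra k G) := fun ψ a =>
    eq_of_rightMul_eq ψ fun χ f hf => by
      change rightMul (_ * x ψ) f = rightMul (x ψ * _) f
      rw [rightMul_mul, rightMul_mul, rightMul_of hf, map_smul, hx ψ χ f hf,
        rightMul_of (comparison_mem _ _ _ _ _)]
  refine ⟨t, ⟨hzero, fun ψ => ?_⟩, fun ω => ?_⟩
  · have h1 := hx ψ ψ 1 (one_mem_weightFun_div ψ)
    rw [← eq_comparison hτ.toIsFiberMap hτ'.toIsFiberMap (one_mem_weightFun_div ψ)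
      (one_mem_weightFun_div ψ) (fun g => by rw [shift_const, hτ.map_one, hτ'.map_one]),
      rightMul_const] at h1
    simpa using congrFun h1 1
  · refine evalFun₂_ext_weight (A := A) fun α β f hf f' hf' => ?_
    -- Any two weights are those of a composable pair of morphisms ending at ω, so the equation
    -- between tensors can be tested on products in the category.
    obtain ⟨ψ, rfl⟩ : ∃ ψ, β = ω / ψ := ⟨ω / β, (dual_div_div_cancel _ _).symm⟩
    obtain ⟨χ, rfl⟩ : ∃ χ, α = ψ / χ := ⟨ψ / α, (dual_div_div_cancel _ _).symm⟩
    have h1 : starMul (J.J ω * gaugeTensor t ω) f f' = rightMul (x ω) (starMul (J'.J ω) f f') := by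
      rw [starMul_mul_gaugeTensor hzero f hf', hx ω χ _ (starMul_mem J' ω hf hf')]
      change starMul (J.J ω) (rightMul (x ψ) f) (rightMul (x ω) f') = _
      rw [hx ψ χ f hf, hx ω ψ f' hf']
      refine eq_comparison hτ.toIsFiberMap hτ'.toIsFiberMap (starMul_mem J' ω hf hf')
        (starMul_mem J ω (comparison_mem _ _ _ _ _) (comparison_mem _ _ _ _ _)) fun g => ?_
      rw [shift_starMul, hτ.map_mul χ ψ ω _ (shift_mem_weightFun (comparison_mem _ _ _ _ _) g) _
        (shift_mem_weightFun (comparison_mem _ _ _ _ _) g),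
        map_shift_comparison hτ.toIsFiberMap hτ'.toIsFiberMap hf,
        map_shift_comparison hτ.toIsFiberMap hτ'.toIsFiberMap hf', shift_starMul,
        hτ'.map_mul χ ψ ω _ (shift_mem_weightFun hf _) _ (shift_mem_weightFun hf' _)]
    rw [mul_assoc, evalFun₂_comul, h1, evalFun_rightMul]
    change _ = evalFun _ (y ω * x ω)
    rw [hyx, ← map_one (MonoidAlgebra.of k G), evalFun_of, starMul, map_one,
      ← Algebra.TensorProduct.one_def, one_mul]

end Finite

/-! ### Existence of fibre representations of a twist -/

section Existence

variable [Finite G] [CharZero k] {J : DynamicalTwist k A}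

theorem starMul_shift_right_apply (x : MonoidAlgebra k G ⊗[k] MonoidAlgebra k G)
    (f f' : G → k) (h g : G) :
    starMul x f (shift h f') g =
      evalFun₂ f f' ((MonoidAlgebra.of k G g ⊗ₜ[k] MonoidAlgebra.of k G (h⁻¹ * g)) * x) := by
  induction x using tensor_induction with
  | of a b =>
    rw [starMul_of_tmul_of, Algebra.TensorProduct.tmul_mul_tmul, ← map_mul, ← map_mul,
      evalFun₂_tmul, evalFun_of, evalFun_of, shift_apply, mul_assoc]
  | add x y hx hy => rw [starMul_add, Pi.add_apply, hx, hy, mul_add, map_add]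
  | smul c x hx =>
    rw [starMul_smul, Pi.smul_apply, hx, mul_smul_comm, map_smul]

/-- Since `J(χ)` is invertible, the algebra of functions is a Galois extension: there are elements
`∑ u ⊗ v` with `∑ u * (x ∘ v) = δ_{x,1}`. -/
theorem exists_galois_elements [Fintype G] [DecidableEq G] (J : DynamicalTwist k A) (χ : Dual k A) :
    ∃ Φ : G → G → k, ∀ x : G,
      ∑ a, ∑ b, Φ a b • starMul (J.J χ) (Pi.single a 1) (shift x (Pi.single b 1)) =
        if x = 1 then 1 else 0 := by
  obtain ⟨u, hu⟩ := J.isUnit χ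
  -- L is the indicator of the diagonal, L(g ⊗ h) = δ_{g,h}.
  let L : MonoidAlgebra k G ⊗[k] MonoidAlgebra k G →ₗ[k] k :=
    ∑ c : G, evalFun₂ (Pi.single c 1) (Pi.single c 1)
  have hL : ∀ g h : G, L (MonoidAlgebra.of k G g ⊗ₜ[k] MonoidAlgebra.of k G h) =
      if g = h then 1 else 0 := by
    intro g h
    simp only [L, LinearMap.sum_apply, evalFun₂_tmul, evalFun_of, Pi.single_apply]
    simp
  have hexp : ∀ (Λ : MonoidAlgebra k G ⊗[k] MonoidAlgebra k G →ₗ[k] k) y,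
      ∑ a, ∑ b, Λ (MonoidAlgebra.of k G a ⊗ₜ[k] MonoidAlgebra.of k G b) *
        evalFun₂ (Pi.single a 1) (Pi.single b 1) y = Λ y := by
    intro Λ y
    induction y using tensor_induction with
    | of g h =>
      simp only [evalFun₂_tmul, evalFun_of, Pi.single_apply]
      simp
    | add y z hy hz => simp only [map_add, mul_add, Finset.sum_add_distrib, hy, hz]
    | smul c y hy =>
      simp only [map_smul, smul_eq_mul, mul_left_comm _ c, ← Finset.mul_sum, hy]
  -- These are the coefficients of L after right multiplication by J(χ)⁻¹. In the sum J(χ) cancels,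
  -- and L(g ⊗ x⁻¹ g) = δ_{x,1} remains.
  refine ⟨fun a b => L ((MonoidAlgebra.of k G a ⊗ₜ[k] MonoidAlgebra.of k G b) *
    ((u⁻¹ : (MonoidAlgebra k G ⊗[k] MonoidAlgebra k G)ˣ) :
      MonoidAlgebra k G ⊗[k] MonoidAlgebra k G)), fun x => ?_⟩
  ext g
  simp only [Finset.sum_apply, Pi.smul_apply, starMul_shift_right_apply, smul_eq_mul]
  have h1 := hexp (L ∘ₗ LinearMap.mulRight k
    ((u⁻¹ : (MonoidAlgebra k G ⊗[k] MonoidAlgebra k G)ˣ) :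
      MonoidAlgebra k G ⊗[k] MonoidAlgebra k G))
    ((MonoidAlgebra.of k G g ⊗ₜ[k] MonoidAlgebra.of k G (x⁻¹ * g)) * J.J χ)
  simp only [LinearMap.comp_apply, LinearMap.mulRight_apply] at h1
  rw [h1, mul_assoc, ← hu, Units.mul_inv, mul_one, hL]
  by_cases hx : x = 1
  · simp [hx]
  · simp [hx]

theorem exists_ne_zero_mem_weightFun (α : Dual k A) : ∃ f ∈ weightFun α, f ≠ (0 : G → k) := by
  classical
  refine ⟨fun g => if h : g ∈ A then ((α ⟨g, h⟩ : kˣ) : k) else 0, fun g a => ?_, fun h => ?_⟩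
  · by_cases hg : g ∈ A
    · have hga : g * a ∈ A := A.mul_mem hg a.2
      simp only [hg, hga, dif_pos]
      have : (⟨g * a, hga⟩ : A) = ⟨g, hg⟩ * a := rfl
      rw [this, map_mul, Units.val_mul]
    · have hga : g * a ∉ A := fun h => hg ((A.mul_mem_cancel_right a.2).1 h)
      simp [hg, hga]
  · have := congrFun h 1
    simp [A.one_mem] at this

section FullRep

variable {V : Dual k A → Type w} [∀ χ, AddCommGroup (V χ)] [∀ χ, Module k (V χ)]
  {τ : ∀ χ ψ, (G → k) →ₗ[k] (V ψ →ₗ[k] V χ)}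

section

variable [IsAlgClosed k] [IsMulCommutative A]

/-- A full representation and its translates have no common kernel. -/
theorem IsFullRep.eq_zero_of_map_shift (hτ : IsFullRep J τ) {χ ψ : Dual k A} [Nontrivial (V ψ)]
    {n : G → k} (hn : n ∈ weightFun (ψ / χ)) (h0 : ∀ g, τ χ ψ (shift g n) = 0) : n = 0 := by
  classical
  have := Fintype.ofFinite G
  have := Fintype.ofFinite (Dual k A)
  -- The sum F of all translates of v * n is G-invariant, hence constant, and τ kills it. The
  -- constant is zero: for ω = ψ because τ(1) is the identity on a nonzero space, otherwise because
  -- the weight of F is nontrivial.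
  have hw : ∀ (ω : Dual k A), ∀ v ∈ weightFun (χ / ω),
      ∑ x : G, shift x (starMul (J.J ψ) v n) = 0 := by
    intro ω v hv
    set F := ∑ x : G, shift x (starMul (J.J ψ) v n) with hF
    have hmem : F ∈ weightFun (ψ / ω) :=
      Submodule.sum_mem _ fun x _ => shift_mem_weightFun (starMul_mem J ψ hv hn) x
    have hinv : ∀ g, shift g F = F := fun g => by
      rw [hF, map_sum]
      refine Fintype.sum_equiv (Equiv.mulLeft g) _ _ fun x => ?_
      rw [Equiv.coe_mulLeft, shift_mul]
    have hτF : τ ω ψ F = 0 := by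
      rw [hF, map_sum]
      refine Finset.sum_eq_zero fun x _ => ?_
      rw [shift_starMul, hτ.map_mul ω χ ψ _ (shift_mem_weightFun hv x) _
        (shift_mem_weightFun hn x), h0, LinearMap.comp_zero]
    have hconst := smul_one_of_shift_eq hinv
    rw [hconst] at hmem hτF ⊢
    by_cases hω : ω = ψ
    · subst hω
      rw [map_smul, hτ.map_one] at hτF
      obtain ⟨v₀, hv₀⟩ := exists_ne (0 : V ω)
      have := LinearMap.congr_fun hτF v₀
      rw [LinearMap.smul_apply, LinearMap.id_apply, LinearMap.zero_apply] at this
      rw [(smul_eq_zero.1 this).resolve_right hv₀, zero_smul]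
    · rw [eq_zero_of_const_mem (fun h => hω (dual_div_eq_one.1 h).symm) hmem, zero_smul]
  have hv : ∀ v : G → k, ∑ x : G, shift x (starMul (J.J ψ) v n) = 0 := by
    intro v
    rw [← sum_weightProj (A := A) v]
    simp only [starMul_sum_left, map_sum]
    rw [Finset.sum_comm]
    refine Finset.sum_eq_zero fun α _ => hw (χ / α) _ ?_
    rw [dual_div_div_cancel]
    exact weightProj_mem _ _
  have huv : ∀ u v : G → k,
      ∑ x : G, starMul (J.J ψ) (starMul (J.J χ) u (shift x v)) (shift x n) = 0 := by
    intro u v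
    rw [← starMul_zero_right (J.J ψ) u, ← hv v, starMul_sum_right]
    refine Finset.sum_congr rfl fun x _ => ?_
    rw [starMul_assoc J _ _ (shift_mem_weightFun hn x), shift_starMul]
  -- So far ∑_x (u * (x ∘ v)) * (x ∘ n) = 0 for all u, v. The Galois elements, for which ∑ u * (x ∘
  -- v) = δ_{x,1}, single out the term x = 1, which is n itself.
  obtain ⟨Φ, hΦ⟩ := exists_galois_elements J χ
  have h1 : n = ∑ x : G, starMul (J.J ψ)
      (∑ a, ∑ b, Φ a b • starMul (J.J χ) (Pi.single a 1) (shift x (Pi.single b 1)))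
      (shift x n) := by
    simp only [hΦ]
    rw [Finset.sum_eq_single 1]
    · rw [if_pos rfl, shift_one, one_starMul]
    · intro x _ hx
      rw [if_neg hx, starMul_zero_left]
    · simp
  rw [h1]
  simp only [starMul_sum_left, starMul_smul_left]
  rw [Finset.sum_comm]
  refine Finset.sum_eq_zero fun a _ => ?_
  rw [Finset.sum_comm]
  refine Finset.sum_eq_zero fun b _ => ?_
  rw [← Finset.smul_sum, huv, smul_zero]

/-- If V_χ were zero, τ_{χψ} would kill all of F_{ψ-χ}[G] with its translates, forcing that space to
vanish. It contains the extension of a character by zero. -/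
theorem IsFullRep.nontrivial (hτ : IsFullRep J τ) (ψ : Dual k A) [Nontrivial (V ψ)]
    (χ : Dual k A) : Nontrivial (V χ) := by
  by_contra h
  rw [not_nontrivial_iff_subsingleton] at h
  obtain ⟨f, hf, hne⟩ := exists_ne_zero_mem_weightFun (ψ / χ)
  exact hne (hτ.eq_zero_of_map_shift hf fun g => LinearMap.ext fun v => Subsingleton.elim _ _)

end

/-- The stabilizer of the kernel of a full representation. -/
def kernelStabilizer (τ : ∀ χ ψ, (G → k) →ₗ[k] (V ψ →ₗ[k] V χ)) : Subgroup G where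
  carrier := {g | ∀ χ ψ : Dual k A, ∀ f ∈ weightFun (ψ / χ), τ χ ψ f = 0 → τ χ ψ (shift g f) = 0}
  one_mem' χ ψ f _ h := by rwa [shift_one]
  mul_mem' {g g'} hg hg' χ ψ f hf h := by
    rw [shift_mul]
    exact hg χ ψ _ (shift_mem_weightFun hf _) (hg' χ ψ f hf h)
  inv_mem' {g} hg χ ψ f hf h := by
    have hpow : ∀ n : ℕ, τ χ ψ (shift (g ^ n) f) = 0 := by
      intro n
      induction n with
      | zero => rwa [pow_zero, shift_one]
      | succ n ih =>
        rw [pow_succ', shift_mul]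
        exact hg χ ψ _ (shift_mem_weightFun hf _) ih
    obtain ⟨n, hn⟩ : ∃ n : ℕ, g⁻¹ = g ^ n :=
      ⟨orderOf g - 1, inv_eq_of_mul_eq_one_right (by
        rw [← pow_succ', Nat.sub_add_cancel (orderOf_pos g), pow_orderOf_eq_one])⟩
    rw [hn]
    exact hpow n

/-- Some f is killed by τ while its translate by g⁻¹ is not. Multiplying g⁻¹ ∘ f on both sides
reaches every T, because products a ∘ S ∘ b with S ≠ 0 span; the translate by g of each product
contains the factor τ(f) = 0. -/
theorem IsFullRep.exists_map_eq_of_notMem (hτ : IsFullRep J τ) [∀ χ, Module.Finite k (V χ)]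
    {g : G} (hg : g ∉ kernelStabilizer τ) (χ ψ : Dual k A) (T : V ψ →ₗ[k] V χ) :
    ∃ f ∈ weightFun (ψ / χ), τ χ ψ (shift g f) = 0 ∧ τ χ ψ f = T := by
  have hg' : g⁻¹ ∉ kernelStabilizer τ := fun h => hg ((Subgroup.inv_mem_iff _).1 h)
  obtain ⟨χ', ψ', f, hf, h0, hne⟩ : ∃ χ' ψ' : Dual k A, ∃ f ∈ weightFun (ψ' / χ'),
      τ χ' ψ' f = 0 ∧ τ χ' ψ' (shift g⁻¹ f) ≠ 0 := by
    by_contra! h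
    exact hg' h
  have key := mem_of_sandwich_mem hne
    ((weightFun (ψ / χ) ⊓ LinearMap.ker (τ χ ψ ∘ₗ shift g)).map (τ χ ψ)) (fun a b => ?_) T
  · obtain ⟨f', ⟨h1, h2⟩, h3⟩ := key
    exact ⟨f', h1, h2, h3⟩
  · obtain ⟨x, hx, rfl⟩ := hτ.surjective χ χ' a
    obtain ⟨y, hy, rfl⟩ := hτ.surjective ψ' ψ b
    have hf' := shift_mem_weightFun hf g⁻¹
    have hxy := starMul_mem J ψ hx (starMul_mem J ψ hf' hy)
    refine ⟨starMul (J.J ψ) x (starMul (J.J ψ) (shift g⁻¹ f) y), ⟨hxy, ?_⟩, ?_⟩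
    · change τ χ ψ (shift g (starMul (J.J ψ) x (starMul (J.J ψ) (shift g⁻¹ f) y))) = 0
      rw [shift_starMul, shift_starMul,
        hτ.map_mul χ χ' ψ _ (shift_mem_weightFun hx g) _
          (starMul_mem J ψ (shift_mem_weightFun hf' g) (shift_mem_weightFun hy g)),
        hτ.map_mul χ' ψ' ψ _ (shift_mem_weightFun hf' g) _ (shift_mem_weightFun hy g),
        ← shift_mul, mul_inv_cancel, shift_one, h0, LinearMap.zero_comp, LinearMap.comp_zero]
    · rw [hτ.map_mul χ χ' ψ _ hx _ (starMul_mem J ψ hf' hy), hτ.map_mul χ' ψ' ψ _ hf' _ hy]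

/-- As in the Chinese remainder theorem, multiply elements that are sent to the identity by τ and
killed after translation by one g each. -/
theorem IsFullRep.exists_separating (hτ : IsFullRep J τ) [∀ χ, Module.Finite k (V χ)]
    (χ : Dual k A) (S : Finset G) (hS : ∀ g ∈ S, g ∉ kernelStabilizer τ) :
    ∃ z ∈ weightFun (χ / χ), τ χ χ z = LinearMap.id ∧ ∀ g ∈ S, τ χ χ (shift g z) = 0 := by
  classical
  induction S using Finset.induction_on with
  | empty => exact ⟨1, one_mem_weightFun_div χ, hτ.map_one χ, by simp⟩
  | insert g S hgS ih =>
    obtain ⟨z, hz, hz1, hz0⟩ := ih fun x hx => hS x (Finset.mem_insert_of_mem hx)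
    obtain ⟨f, hf, hf0, hf1⟩ := hτ.exists_map_eq_of_notMem (hS g (Finset.mem_insert_self _ _)) χ χ
      LinearMap.id
    refine ⟨starMul (J.J χ) z f, starMul_mem J χ hz hf, ?_, fun x hx => ?_⟩
    · rw [hτ.map_mul χ χ χ _ hz _ hf, hz1, hf1, LinearMap.id_comp]
    · rw [shift_starMul, hτ.map_mul χ χ χ _ (shift_mem_weightFun hz _) _
        (shift_mem_weightFun hf _)]
      rcases Finset.mem_insert.1 hx with rfl | hx
      · rw [hf0, LinearMap.comp_zero]
      · rw [hz0 x hx, LinearMap.zero_comp]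

/-- A full representation is a fibre representation for the stabilizer of its kernel. -/
theorem IsFullRep.exists_isFiberRep [IsAlgClosed k] [IsMulCommutative A] (hτ : IsFullRep J τ)
    [∀ χ, Module.Finite k (V χ)] [∀ χ, Nontrivial (V χ)] :
    ∃ π : ∀ χ, kernelStabilizer τ → V χ ≃ₗ[k] V χ,
      IsFiberRep J.J (kernelStabilizer τ) π τ := by
  classical
  have := Fintype.ofFinite G
  -- For h in the stabilizer, τ and its translate by h are full representations with nested kernels.
  -- The intertwiner between them is the operator π(h).
  choose π hπ using fun h : kernelStabilizer τ =>
    hτ.exists_intertwiner (hτ.comp_shift (h : G)) (χ₀ := 1) h.2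
  refine ⟨fun χ h => π h χ,
    { equivariant := ?_
      injective := fun χ ψ f hf h => hτ.eq_zero_of_map_shift hf h
      surjective := ?_
      map_one := hτ.map_one
      map_mul := hτ.map_mul }⟩
  · intro χ ψ h f hf
    ext v
    obtain ⟨v, rfl⟩ := (π h ψ).surjective v
    rw [LinearEquiv.arrowCongr_apply, LinearEquiv.symm_apply_apply, ← hπ h χ ψ f hf]
    rfl
  · intro χ ψ T
    obtain ⟨f, hf, rfl⟩ := hτ.surjective χ ψ T
    obtain ⟨z, hz, hz1, hz0⟩ := hτ.exists_separating χ
      (Finset.univ.filter fun g => g ∉ kernelStabilizer τ) (by simp)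
    -- Multiplication by the separating element z cuts f down to K without changing its value under
    -- τ.
    refine ⟨starMul (J.J ψ) z f, ⟨starMul_mem J ψ hz hf, fun g hg => ?_⟩, ?_⟩
    · rw [shift_starMul, hτ.map_mul χ χ ψ _ (shift_mem_weightFun hz _) _
        (shift_mem_weightFun hf _), hz0 g (by simpa using hg), LinearMap.zero_comp]
    · rw [hτ.map_mul χ χ ψ _ hz _ hf, hz1, LinearMap.id_comp]

end FullRep

end Existence

/-! ### A simple module over the functions on `G` -/

section SimpleModule

variable [Finite G] [CharZero k] [IsAlgClosed k] [IsMulCommutative A]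

/-- Left submodules of `⨁_χ F_{-χ}[G]`. -/
def IsStableFamily [DecidableEq (Dual k A)] (J : DynamicalTwist k A)
    (U : Submodule k (Dual k A → G → k)) : Prop :=
  (∀ x ∈ U, ∀ χ, x χ ∈ weightFun (1 / χ)) ∧ ∀ χ ψ : Dual k A, ∀ f ∈ weightFun (ψ / χ), ∀ x ∈ U,
    Pi.single χ (starMul (J.J 1) f (x ψ)) ∈ U

/-- A minimal stable family is a simple module over the category, inside the morphisms into the
trivial character; this is why all actions are by J(1). It exists since the whole space is stable,
nonzero and finite-dimensional. -/
theorem exists_minimal_stableFamily [DecidableEq (Dual k A)] (J : DynamicalTwist k A) :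
    ∃ U, Minimal (fun U => IsStableFamily J U ∧ U ≠ ⊥) U := by
  have := Fintype.ofFinite (Dual k A)
  refine exists_minimal_of_wellFoundedLT _ ⟨Submodule.pi Set.univ fun χ => weightFun (1 / χ),
    ⟨fun x hx χ => hx χ (Set.mem_univ _), fun χ ψ f hf x hx χ' _ => ?_⟩, fun h => ?_⟩
  · by_cases hχ : χ' = χ
    · subst hχ
      rw [Pi.single_eq_same]
      exact starMul_mem J 1 hf (hx ψ (Set.mem_univ _))
    · rw [Pi.single_eq_of_ne hχ]
      exact Submodule.zero_mem (weightFun (1 / χ'))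
  · have h1 : (Pi.single 1 1 : Dual k A → G → k) ∈
        Submodule.pi Set.univ fun χ : Dual k A => weightFun (1 / χ) := by
      intro χ' _
      by_cases hχ : χ' = 1
      · subst hχ
        rw [Pi.single_eq_same]
        exact one_mem_weightFun_div 1
      · rw [Pi.single_eq_of_ne hχ]
        exact Submodule.zero_mem (weightFun (1 / χ'))
    rw [h, Submodule.mem_bot] at h1
    have h2 := congrFun (congrFun h1 1) 1
    simp at h2

/-- The action of `f ∈ F_{ψ-χ}[G]` on `⨁_χ F_{-χ}[G]`. -/
def blockOperator [DecidableEq (Dual k A)] (J : DynamicalTwist k A) (χ ψ : Dual k A) (f : G → k) :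
    Module.End k (Dual k A → G → k) :=
  LinearMap.single k (fun _ => G → k) χ ∘ₗ starMulₗ (J.J 1) f ∘ₗ LinearMap.proj ψ

section Stable

variable [DecidableEq (Dual k A)] {J : DynamicalTwist k A} {U : Submodule k (Dual k A → G → k)}

/-- The units of the category act as the projections to the components, so U is the direct sum of
its intersections with them. -/
theorem IsStableFamily.sum_single_mem (hU : IsStableFamily J U) {x : Dual k A → G → k}
    (hx : x ∈ U) (χ : Dual k A) : Pi.single χ (x χ) ∈ U := by
  have := hU.2 χ χ 1 (one_mem_weightFun_div χ) x hx
  rwa [one_starMul] at this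

/-- The operators on a stable family that are sums of block operators. -/
def IsStableFamily.operators (hU : IsStableFamily J U) : Subalgebra k (Module.End k U) where
  carrier := {s | ∃ F : Dual k A → Dual k A → G → k, (∀ χ ψ, F χ ψ ∈ weightFun (ψ / χ)) ∧
    ∀ x : U, ∀ χ, (s x : Dual k A → G → k) χ =
      ∑ᶠ ψ, starMul (J.J 1) (F χ ψ) ((x : Dual k A → G → k) ψ)}
  mul_mem' := by
    have := Fintype.ofFinite (Dual k A)
    rintro s s' ⟨F, hF, h⟩ ⟨F', hF', h'⟩
    refine ⟨fun χ ω => ∑ ψ, starMul (J.J ω) (F χ ψ) (F' ψ ω), fun χ ω =>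
      Submodule.sum_mem _ fun ψ _ => starMul_mem J ω (hF χ ψ) (hF' ψ ω), fun x χ => ?_⟩
    rw [Module.End.mul_apply, h]
    simp only [h', finsum_eq_sum_of_fintype, starMul_sum_left, starMul_sum_right]
    rw [Finset.sum_comm]
    refine Finset.sum_congr rfl fun ω _ => Finset.sum_congr rfl fun ψ _ => ?_
    rw [starMul_assoc J _ _ (hU.1 x x.2 ω)]
  add_mem' := by
    have := Fintype.ofFinite (Dual k A)
    rintro s s' ⟨F, hF, h⟩ ⟨F', hF', h'⟩
    refine ⟨F + F', fun χ ψ => Submodule.add_mem _ (hF χ ψ) (hF' χ ψ), fun x χ => ?_⟩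
    rw [LinearMap.add_apply, Submodule.coe_add, Pi.add_apply, h, h']
    simp only [finsum_eq_sum_of_fintype, ← Finset.sum_add_distrib]
    refine Finset.sum_congr rfl fun ψ _ => ?_
    rw [← starMulₗ_apply, ← starMulₗ_apply, ← starMulₗ_apply, Pi.add_apply, Pi.add_apply, map_add,
      LinearMap.add_apply]
  algebraMap_mem' c := by
    have := Fintype.ofFinite (Dual k A)
    refine ⟨fun χ ψ => if χ = ψ then c • 1 else 0, fun χ ψ => ?_, fun x χ => ?_⟩
    · beta_reduce
      split_ifs with h
      · subst h
        exact Submodule.smul_mem _ _ (one_mem_weightFun_div _)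
      · exact Submodule.zero_mem (weightFun (ψ / χ))
    · rw [finsum_eq_sum_of_fintype, Finset.sum_eq_single χ]
      · beta_reduce
        rw [if_pos rfl, starMul_smul_left, one_starMul]
        rfl
      · intro ψ _ hψ
        beta_reduce
        rw [if_neg hψ.symm, starMul_zero_left]
      · simp

/-- Block operators preserve U and belong to this algebra, so an invariant subspace of U is again a
stable family and minimality makes it trivial. Burnside's theorem applies. -/
theorem IsStableFamily.operators_eq_top (hU : Minimal (fun U => IsStableFamily J U ∧ U ≠ ⊥) U) :
    hU.prop.1.operators = ⊤ := by
  have := Fintype.ofFinite (Dual k A)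
  have hne : Nontrivial U := Submodule.nontrivial_iff_ne_bot.2 hU.prop.2
  refine subalgebra_eq_top_of_irreducible _ fun W hW => ?_
  have hstable : IsStableFamily J (W.map U.subtype) := by
    constructor
    · rintro _ ⟨x, hx, rfl⟩ χ
      exact hU.prop.1.1 _ x.2 χ
    · rintro χ ψ f hf _ ⟨x, hx, rfl⟩
      have hres : ∀ y ∈ U, blockOperator J χ ψ f y ∈ U := fun y hy => hU.prop.1.2 χ ψ f hf y hy
      refine ⟨(blockOperator J χ ψ f).restrict hres x, hW _ ?_ x hx, rfl⟩
      refine ⟨fun χ' ψ' => if χ' = χ ∧ ψ' = ψ then f else 0, fun χ' ψ' => ?_, fun y χ' => ?_⟩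
      · beta_reduce
        split_ifs with h
        · rw [h.1, h.2]
          exact hf
        · exact Submodule.zero_mem (weightFun (ψ' / χ'))
      · rw [finsum_eq_sum_of_fintype, Finset.sum_eq_single ψ]
        · rw [LinearMap.restrict_apply]
          change (Pi.single χ (starMul (J.J 1) f ((y : Dual k A → G → k) ψ)) :
            Dual k A → G → k) χ' = _
          beta_reduce
          by_cases hχ : χ' = χ
          · subst hχ
            rw [Pi.single_eq_same, if_pos ⟨rfl, rfl⟩]
          · rw [Pi.single_eq_of_ne hχ, if_neg (fun h => hχ h.1), starMul_zero_left]
        · intro ψ' _ hψ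
          beta_reduce
          rw [if_neg (fun h => hψ h.2), starMul_zero_left]
        · simp
  by_cases hbot : W = ⊥
  · exact Or.inl hbot
  · right
    have hle := hU.le_of_le ⟨hstable, fun h => hbot (Submodule.map_injective_of_injective
      U.injective_subtype (h.trans (Submodule.map_bot _).symm))⟩ (Submodule.map_subtype_le U W)
    rw [eq_top_iff]
    intro x _
    obtain ⟨y, hy, hyx⟩ := hle x.2
    rwa [← Subtype.ext hyx]

end Stable

/-- Every dynamical twist has a full representation. -/
theorem exists_isFullRep (J : DynamicalTwist k A) :
    ∃ (d : Dual k A → ℕ) (τ : ∀ χ ψ, (G → k) →ₗ[k] ((Fin (d ψ) → k) →ₗ[k] (Fin (d χ) → k))),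
      IsFullRep J τ ∧ ∃ χ, d χ ≠ 0 := by
  classical
  have := Fintype.ofFinite (Dual k A)
  obtain ⟨U, hU⟩ := exists_minimal_stableFamily J
  have htop := IsStableFamily.operators_eq_top hU
  -- V_χ is the component of the simple module U at the object χ.
  let V : Dual k A → Submodule k (G → k) := fun χ =>
    U.comap (LinearMap.single k (fun _ => G → k) χ)
  have hV : ∀ {χ y}, y ∈ V χ ↔ (Pi.single χ y : Dual k A → G → k) ∈ U := Iff.rfl
  have hVw : ∀ {χ y}, y ∈ V χ → y ∈ weightFun (1 / χ) := fun {χ y} hy => by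
    have := hU.prop.1.1 _ (hV.1 hy) χ
    rwa [Pi.single_eq_same] at this
  have hact : ∀ (χ ψ : Dual k A) (f : G → k), ∀ y ∈ V ψ,
      starMul (J.J 1) (weightProj (ψ / χ) f) y ∈ V χ := by
    intro χ ψ f y hy
    have := hU.prop.1.2 χ ψ _ (weightProj_mem (ψ / χ) f) _ (hV.1 hy)
    rwa [Pi.single_eq_same] at this
  let τ₀ : ∀ χ ψ, (G → k) →ₗ[k] (V ψ →ₗ[k] V χ) := fun χ ψ =>
    { toFun := fun f => (starMulₗ (J.J 1) (weightProj (ψ / χ) f)).restrict (hact χ ψ f)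
      map_add' := fun f f' => by
        ext1 y
        apply Subtype.ext
        change starMulₗ (J.J 1) _ _ = _
        rw [map_add, map_add]
        rfl
      map_smul' := fun c f => by
        ext1 y
        apply Subtype.ext
        change starMulₗ (J.J 1) _ _ = _
        rw [map_smul, map_smul]
        rfl }
  have hτ₀ : ∀ χ ψ : Dual k A, ∀ f ∈ weightFun (ψ / χ), ∀ y : V ψ,
      (τ₀ χ ψ f y : G → k) = starMul (J.J 1) f y := fun χ ψ f hf y => by
    change starMul (J.J 1) (weightProj (ψ / χ) f) y = _
    rw [weightProj_of_mem hf]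
  have hfull : IsFullRep J τ₀ := by
    constructor
    · intro χ
      ext1 y
      apply Subtype.ext
      rw [hτ₀ _ _ _ (one_mem_weightFun_div χ), one_starMul]
      rfl
    · intro χ ψ ω f hf f' hf'
      ext1 y
      apply Subtype.ext
      rw [hτ₀ _ _ _ (starMul_mem J ω hf hf'), LinearMap.comp_apply, hτ₀ _ _ _ hf,
        hτ₀ _ _ _ hf', starMul_assoc J _ _ (hVw y.2)]
    · intro χ ψ T
      -- T is extended to an endomorphism of U, zero on the other components. As an operator it is a
      -- matrix of functions, whose entry at (χ, ψ) is a preimage of T.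
      let s : Module.End k U :=
        (LinearMap.single k (fun _ => G → k) χ ∘ₗ (V χ).subtype ∘ₗ T ∘ₗ
          (LinearMap.proj ψ ∘ₗ U.subtype).codRestrict (V ψ) fun x =>
            hV.2 (hU.prop.1.sum_single_mem x.2 ψ)).codRestrict U fun x => hV.1 (T _).2
      have hs : s ∈ hU.prop.1.operators := by rw [htop]; trivial
      obtain ⟨F, hF, h⟩ := hs
      refine ⟨F χ ψ, hF χ ψ, ?_⟩
      ext1 y
      apply Subtype.ext
      rw [hτ₀ _ _ _ (hF χ ψ)]
      have h1 := h ⟨Pi.single ψ (y : G → k), hV.1 y.2⟩ χ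
      rw [finsum_eq_sum_of_fintype, Finset.sum_eq_single ψ] at h1
      · change _ = starMul (J.J 1) (F χ ψ) ((Pi.single ψ (y : G → k) : Dual k A → G → k) ψ) at h1
        rw [Pi.single_eq_same] at h1
        rw [← h1]
        change (Pi.single χ _ : Dual k A → G → k) χ = _
        rw [Pi.single_eq_same]
        exact congrArg (fun z => (T z : G → k)) (Subtype.ext (by
          change (Pi.single ψ (y : G → k) : Dual k A → G → k) ψ = y
          exact Pi.single_eq_same _ _))
      · intro ψ' _ hψ'
        change starMul (J.J 1) (F χ ψ') ((Pi.single ψ (y : G → k) : Dual k A → G → k) ψ') = 0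
        rw [Pi.single_eq_of_ne hψ', starMul_zero_right]
      · simp
  -- The V_χ consist of functions on G and live in the wrong universe for a projective family;
  -- coordinate spaces over k replace them.
  let e : ∀ χ, V χ ≃ₗ[k] (Fin (Module.finrank k (V χ)) → k) := fun χ =>
    (Module.finBasis k (V χ)).equivFun
  refine ⟨fun χ => Module.finrank k (V χ), fun χ ψ =>
    ((e ψ).arrowCongr (e χ)).toLinearMap ∘ₗ τ₀ χ ψ, ⟨?_, ?_, ?_⟩, ?_⟩
  · intro χ
    rw [LinearMap.comp_apply, hfull.map_one]
    refine LinearMap.ext fun v => ?_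
    simp [LinearEquiv.arrowCongr_apply]
  · intro χ ψ ω f hf f' hf'
    simp only [LinearMap.comp_apply]
    rw [hfull.map_mul _ _ _ _ hf _ hf']
    exact LinearEquiv.arrowCongr_comp _ _ _ _ _
  · intro χ ψ T
    obtain ⟨f, hf, h⟩ := hfull.surjective χ ψ (((e ψ).arrowCongr (e χ)).symm T)
    refine ⟨f, hf, ?_⟩
    rw [LinearMap.comp_apply, h]
    exact LinearEquiv.apply_symm_apply _ _
  · by_contra! h
    refine hU.prop.2 (Submodule.eq_bot_iff _ |>.2 fun x hx => ?_)
    ext1 χ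
    have := Module.finrank_zero_iff.1 (h χ)
    exact congrArg Subtype.val (Subsingleton.elim
      (⟨x χ, hV.2 (hU.prop.1.sum_single_mem hx χ)⟩ : V χ) 0)

/-- Every dynamical twist has a fibre representation in a projective family. -/
theorem exists_projectiveFamily (J : DynamicalTwist k A) :
    ∃ (𝒱 : ProjectiveFamily k A) (τ : ∀ χ ψ, (G → k) →ₗ[k] (𝒱.V ψ →ₗ[k] 𝒱.V χ)),
      IsFiberRep J.J 𝒱.K 𝒱.π τ := by
  obtain ⟨d, τ, hfull, χ₀, hχ₀⟩ := exists_isFullRep J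
  have : Nontrivial (Fin (d χ₀) → k) := by
    have : NeZero (d χ₀) := ⟨hχ₀⟩
    infer_instance
  have hnt : ∀ χ, Nontrivial (Fin (d χ) → k) := hfull.nontrivial χ₀
  obtain ⟨π, hπ⟩ := hfull.exists_isFiberRep
  -- The operators π(g) π(h) and π(gh) implement the same translation of functions, so they differ
  -- by a scalar.
  have hproj : ∀ g h : kernelStabilizer τ, ∃ a : kˣ, ∀ χ v,
      ((π χ h).trans (π χ g)) v = (a : k) • π χ (g * h) v := by
    intro g h
    have heq : ∀ (x : kernelStabilizer τ) (χ ψ : Dual k A), ∀ f ∈ weightFun (ψ / χ), ∀ v,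
        τ χ ψ (shift (x : G) f) (π ψ x v) = π χ x (τ χ ψ f v) := by
      intro x χ ψ f hf v
      rw [hπ.equivariant χ ψ x f hf]
      simp [LinearEquiv.arrowCongr_apply]
    refine exists_scalar_of_equivariant hfull ((g * h : kernelStabilizer τ) : G) _ _
      (heq (g * h)) fun χ ψ f hf v => ?_
    rw [LinearEquiv.trans_apply, LinearEquiv.trans_apply, Subgroup.coe_mul, shift_mul,
      heq g _ _ _ (shift_mem_weightFun hf _), heq h _ _ _ hf]
  choose c hc using hproj
  refine ⟨{ K := kernelStabilizer τ
            V := fun χ => Fin (d χ) → k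
            π := π
            projective := fun χ => ⟨c, fun g h v => hc g h χ v⟩
            irreducible := fun χ => hπ.irreducible hπ.map_one χ
            linear := hπ.linear }, τ, hπ⟩

end SimpleModule

/-! ### Isomorphisms between induced representations -/

section Induced

variable {K : Subgroup G} {W : Type*} [AddCommGroup W] [Module k W]

/-- The linear map on an induced representation that is given by a compatible family of maps. -/
def indLift {X : Type*} [AddCommGroup X] [Module k X] (σ : Representation k K W)
    (φ : G → W →ₗ[k] X) (hφ : ∀ (h : K) (g : G) (w : W), φ (h * g) (σ h w) = φ g w) :
    Representation.IndV K.subtype σ →ₗ[k] X :=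
  Representation.Coinvariants.lift _
    (TensorProduct.lift <| (Finsupp.lift (W →ₗ[k] X) k G φ) ∘ₗ
        (MonoidAlgebra.coeffLinearEquiv k).toLinearMap)
    (fun h => by
      ext g w
      simp [hφ, Representation.ofMulAction_single])

theorem indLift_mk {X : Type*} [AddCommGroup X] [Module k X] (σ : Representation k K W)
    (φ : G → W →ₗ[k] X) (hφ : ∀ (h : K) (g : G) (w : W), φ (h * g) (σ h w) = φ g w) (g : G)
    (w : W) : indLift σ φ hφ (Representation.IndV.mk K.subtype σ g w) = φ g w := by
  simp [indLift]

theorem indV_mk_mul (σ : Representation k K W) (h : K) (g : G) (w : W) :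
    Representation.IndV.mk K.subtype σ (h * g) (σ h w) =
      Representation.IndV.mk K.subtype σ g w := by
  have := Representation.Coinvariants.mk_self_apply
    (Representation.tprod ((Representation.leftRegular k G).comp K.subtype) σ) h
    (MonoidAlgebra.single g 1 ⊗ₜ[k] w)
  simpa [Representation.ofMulAction_single] using this

/-- The projection `k[G] → Ind_A^G α`. -/
def charIndProj (α : Dual k A) :
    MonoidAlgebra k G →ₗ[k] Representation.IndV A.subtype (charRep α) :=
  Finsupp.linearCombination k
      (fun g : G => Representation.IndV.mk A.subtype (charRep α) g⁻¹ (1 : k)) ∘ₗ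
    (MonoidAlgebra.coeffLinearEquiv k).toLinearMap

theorem charIndProj_of (α : Dual k A) (g : G) :
    charIndProj α (MonoidAlgebra.of k G g) =
      Representation.IndV.mk A.subtype (charRep α) g⁻¹ (1 : k) := by
  simp [charIndProj]

theorem charIndProj_of_mul (α : Dual k A) (g : G) (x : MonoidAlgebra k G) :
    charIndProj α (MonoidAlgebra.of k G g * x) =
      Representation.ind A.subtype (charRep α) g (charIndProj α x) := by
  induction x using monoidAlgebra_induction with
  | of h =>
    rw [← map_mul, charIndProj_of, charIndProj_of, Representation.ind_mk, mul_inv_rev]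
  | add x y hx hy => rw [mul_add, map_add, map_add, map_add, hx, hy]
  | smul c x hx => rw [mul_smul_comm, map_smul, map_smul, map_smul, hx]

theorem frobeniusHom_mk {X : Type*} [AddCommGroup X] [Module k X] (ρ : Representation k G X)
    (α : Dual k A) (x : weightSpace ρ α) (g : G) (c : k) :
    frobeniusHom ρ α x (Representation.IndV.mk A.subtype (charRep α) g c) =
      c • ρ g⁻¹ (x : X) := by
  simp [frobeniusHom]

variable [Finite G]

/-- The embedding `Ind_A^G α → k[G]` with image `k[G] P_α`. -/
def charIndEmb (α : Dual k A) :
    Representation.IndV A.subtype (charRep α) →ₗ[k] MonoidAlgebra k G :=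
  indLift _ (fun g => LinearMap.toSpanSingleton k _ (MonoidAlgebra.of k G g⁻¹ * charIdem α))
    fun a g c => by
      have : MonoidAlgebra.of k G (g⁻¹ * (a : G)⁻¹) * charIdem α =
          (((α a)⁻¹ : kˣ) : k) • (MonoidAlgebra.of k G g⁻¹ * charIdem α) := by
        rw [map_mul, mul_assoc]
        have := of_mul_charIdem α a⁻¹
        rw [Subgroup.coe_inv] at this
        rw [this, mul_smul_comm, map_inv]
      rw [LinearMap.toSpanSingleton_apply, LinearMap.toSpanSingleton_apply, mul_inv_rev, this,
        smul_smul]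
      congr 1
      simp [charRep, mul_comm]

theorem charIndEmb_mk (α : Dual k A) (g : G) (c : k) :
    charIndEmb α (Representation.IndV.mk A.subtype (charRep α) g c) =
      c • (MonoidAlgebra.of k G g⁻¹ * charIdem α) := by
  rw [charIndEmb, indLift_mk, LinearMap.toSpanSingleton_apply]

theorem charIndEmb_ind (α : Dual k A) (g : G)
    (r : Representation.IndV A.subtype (charRep α)) :
    charIndEmb α (Representation.ind A.subtype (charRep α) g r) =
      MonoidAlgebra.of k G g * charIndEmb α r := by
  have : charIndEmb α ∘ₗ Representation.ind A.subtype (charRep α) g =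
      LinearMap.mulLeft k (MonoidAlgebra.of k G g) ∘ₗ charIndEmb α := by
    refine Representation.IndV.hom_ext _ _ fun h => LinearMap.ext fun c => ?_
    simp only [LinearMap.comp_apply]
    have h1 := Representation.ind_mk A.subtype (charRep α) g h c
    have h2 := charIndEmb_mk α (h * g⁻¹) c
    have h3 := charIndEmb_mk α h c
    simp only [LinearMap.comp_apply] at h1 h2 h3
    rw [h1, h2, h3, LinearMap.mulLeft_apply, mul_smul_comm, ← mul_assoc, ← map_mul]
    simp
  exact LinearMap.congr_fun this r

variable [CharZero k]

theorem charIndEmb_charIndProj (α : Dual k A) (x : MonoidAlgebra k G) :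
    charIndEmb α (charIndProj α x) = x * charIdem α := by
  induction x using monoidAlgebra_induction with
  | of g => rw [charIndProj_of, charIndEmb_mk, one_smul, inv_inv]
  | add x y hx hy => rw [map_add, map_add, hx, hy, add_mul]
  | smul c x hx => rw [map_smul, map_smul, hx, smul_mul_assoc]

theorem charIndProj_charIdem (α : Dual k A) :
    charIndProj α (charIdem α) = Representation.IndV.mk A.subtype (charRep α) 1 (1 : k) := by
  have := Fintype.ofFinite A
  have hA : (Nat.card A : k) ≠ 0 := by exact_mod_cast Nat.card_pos.ne'
  rw [charIdem, finsum_eq_sum_of_fintype, map_smul, map_sum]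
  have : ∀ a : A, charIndProj α (MonoidAlgebra.single (a : G) (((α a)⁻¹ : kˣ) : k)) =
      Representation.IndV.mk A.subtype (charRep α) 1 (1 : k) := by
    intro a
    have h1 : MonoidAlgebra.single (a : G) (((α a)⁻¹ : kˣ) : k) =
        (((α a)⁻¹ : kˣ) : k) • MonoidAlgebra.of k G (a : G) := by simp
    have h2 := indV_mk_mul (charRep α) a⁻¹ 1 (1 : k)
    rw [h1, map_smul, charIndProj_of, ← h2, ← map_smul]
    simp [charRep]
  rw [Finset.sum_congr rfl fun a _ => this a, Finset.sum_const, Finset.card_univ,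
    ← Nat.card_eq_fintype_card, ← Nat.cast_smul_eq_nsmul k, smul_smul, inv_mul_cancel₀ hA,
    one_smul]

theorem charIndProj_charIndEmb (α : Dual k A) (r : Representation.IndV A.subtype (charRep α)) :
    charIndProj α (charIndEmb α r) = r := by
  have : charIndProj α ∘ₗ charIndEmb α = LinearMap.id := by
    refine Representation.IndV.hom_ext _ _ fun h => LinearMap.ext_ring ?_
    simp only [LinearMap.comp_apply]
    have h2 := charIndEmb_mk α h 1
    have h3 := Representation.ind_mk A.subtype (charRep α) h⁻¹ 1 (1 : k)
    simp only [LinearMap.comp_apply] at h2 h3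
    rw [h2, map_smul, charIndProj_of_mul, charIndProj_charIdem]
    simp only [LinearMap.comp_apply]
    rw [h3, ← map_smul]
    simp
  exact LinearMap.congr_fun this r

theorem charIndEmb_mul_charIdem (α : Dual k A) (r : Representation.IndV A.subtype (charRep α)) :
    charIndEmb α r * charIdem α = charIndEmb α r := by
  rw [← charIndEmb_charIndProj, charIndProj_charIndEmb]

theorem asAlgebraHom_charIdem_apply {X : Type*} [AddCommGroup X] [Module k X]
    (ρ : Representation k G X) (α : Dual k A) (x : weightSpace ρ α) :
    ρ.asAlgebraHom (charIdem α) (x : X) = x := by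
  have := Fintype.ofFinite A
  have hA : (Nat.card A : k) ≠ 0 := by exact_mod_cast Nat.card_pos.ne'
  rw [charIdem, finsum_eq_sum_of_fintype, map_smul, map_sum, LinearMap.smul_apply,
    LinearMap.sum_apply]
  have : ∀ a : A, ρ.asAlgebraHom (MonoidAlgebra.single (a : G) (((α a)⁻¹ : kˣ) : k)) (x : X) =
      x := by
    intro a
    rw [Representation.asAlgebraHom_single, LinearMap.smul_apply, x.2 a, smul_smul]
    simp
  rw [Finset.sum_congr rfl fun a _ => this a, Finset.sum_const, Finset.card_univ,
    ← Nat.card_eq_fintype_card, ← Nat.cast_smul_eq_nsmul k, smul_smul, inv_mul_cancel₀ hA,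
    one_smul]

/-- Both sides are compatible with G, and the generator embeds as P_α, which fixes x because x has
weight α. -/
theorem frobeniusHom_apply {X : Type*} [AddCommGroup X] [Module k X] (ρ : Representation k G X)
    (α : Dual k A) (x : weightSpace ρ α) (r : Representation.IndV A.subtype (charRep α)) :
    frobeniusHom ρ α x r = ρ.asAlgebraHom (charIndEmb α r) (x : X) := by
  have : frobeniusHom ρ α x =
      LinearMap.applyₗ (x : X) ∘ₗ ρ.asAlgebraHom.toLinearMap ∘ₗ charIndEmb α := by
    refine Representation.IndV.hom_ext _ _ fun h => LinearMap.ext fun c => ?_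
    have h1 := frobeniusHom_mk ρ α x h c
    have h2 := charIndEmb_mk α h c
    simp only [LinearMap.comp_apply] at h1 h2 ⊢
    rw [h1, h2, AlgHom.toLinearMap_apply, map_smul, map_mul, LinearMap.applyₗ_apply_apply,
      LinearMap.smul_apply, Module.End.mul_apply, asAlgebraHom_charIdem_apply,
      Representation.asAlgebraHom_of]
  exact LinearMap.congr_fun this r

/-- A linear map `u : W → k[G]` that corresponds to an isomorphism `Ind_K^G W ≅ Ind_A^G α`. -/
structure IsIndCore (σ : Representation k K W) (α : Dual k A)
    (u : W →ₗ[k] MonoidAlgebra k G) : Prop where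
  equivariant : ∀ (h : K) w, u (σ h w) = MonoidAlgebra.of k G (h : G) * u w
  mul_charIdem : ∀ w, u w * charIdem α = u w
  injective : ∀ f ∈ weightFun α, (∀ g w, evalFun f (MonoidAlgebra.of k G g * u w) = 0) → f = 0
  surjective : ∀ ℓ : W →ₗ[k] k, ∃ f ∈ weightFun α, (∀ w, evalFun f (u w) = ℓ w) ∧
    ∀ g, g ∉ K → ∀ w, evalFun f (MonoidAlgebra.of k G g * u w) = 0

theorem mem_weightFun_of_functional (α : Dual k A)
    (φ : Representation.IndV A.subtype (charRep α) →ₗ[k] k) :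
    (fun g : G => φ (charIndProj α (MonoidAlgebra.of k G g))) ∈ weightFun α := by
  intro g a
  beta_reduce
  have h2 := indV_mk_mul (charRep α) a⁻¹ g⁻¹ ((α a : kˣ) : k)
  have h3 : Representation.IndV.mk A.subtype (charRep α) ((a : G)⁻¹ * g⁻¹) (1 : k) =
      ((α a : kˣ) : k) • Representation.IndV.mk A.subtype (charRep α) g⁻¹ (1 : k) := by
    rw [← map_smul, smul_eq_mul, mul_one, ← h2]
    simp [charRep]
  rw [charIndProj_of, charIndProj_of, mul_inv_rev, h3, map_smul, smul_eq_mul, mul_comm]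

/-- The map `W → k[G]` that corresponds to an isomorphism `Ind_K^G W ≅ Ind_A^G α`. -/
def indCore {σ : Representation k K W} {α : Dual k A}
    (ε : (Representation.ind K.subtype σ).Equiv (Representation.ind A.subtype (charRep α))) :
    W →ₗ[k] MonoidAlgebra k G :=
  charIndEmb α ∘ₗ ε.toLinearMap ∘ₗ Representation.IndV.mk K.subtype σ 1

theorem of_mul_indCore {σ : Representation k K W} {α : Dual k A}
    (ε : (Representation.ind K.subtype σ).Equiv (Representation.ind A.subtype (charRep α)))
    (g : G) (w : W) : MonoidAlgebra.of k G g * indCore ε w =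
      charIndEmb α (ε (Representation.IndV.mk K.subtype σ g⁻¹ w)) := by
  have h1 : ε (Representation.ind K.subtype σ g (Representation.IndV.mk K.subtype σ 1 w)) =
      Representation.ind A.subtype (charRep α) g (ε (Representation.IndV.mk K.subtype σ 1 w)) :=
    LinearMap.congr_fun (ε.isIntertwining' g) _
  rw [Representation.ind_mk, one_mul] at h1
  rw [h1, charIndEmb_ind]
  rfl

/-- Each condition is a property of ε read on functionals: `injective` expresses surjectivity of ε,
and `surjective` extends a functional on W by zero from the summand of Ind_K^G W over the trivial
coset. -/
theorem isIndCore_indCore {σ : Representation k K W} {α : Dual k A}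
    (ε : (Representation.ind K.subtype σ).Equiv (Representation.ind A.subtype (charRep α))) :
    IsIndCore σ α (indCore ε) where
  equivariant h w := by
    rw [of_mul_indCore]
    have h2 := indV_mk_mul σ h (h : G)⁻¹ w
    rw [mul_inv_cancel] at h2
    rw [← h2]
    rfl
  mul_charIdem w := charIndEmb_mul_charIdem _ _
  injective f hf h := by
    have h1 : evalFun f ∘ₗ charIndEmb α ∘ₗ ε.toLinearMap = 0 := by
      refine Representation.IndV.hom_ext _ _ fun g => LinearMap.ext fun w => ?_
      have := h g⁻¹ w
      rw [of_mul_indCore, inv_inv] at this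
      exact this
    ext g
    have h2 := LinearMap.congr_fun h1 (ε.toLinearEquiv.symm (charIndProj α (MonoidAlgebra.of k G g)))
    have h3 : ε.toLinearMap (ε.toLinearEquiv.symm (charIndProj α (MonoidAlgebra.of k G g))) =
      charIndProj α (MonoidAlgebra.of k G g) := ε.toLinearEquiv.apply_symm_apply _
    simp only [LinearMap.comp_apply] at h2
    rw [h3, charIndEmb_charIndProj, evalFun_mul_charIdem hf, evalFun_of] at h2
    exact h2
  surjective ℓ := by
    classical
    -- Since `IndV.mk g w` stands for g⁻¹ ⊗ w, the extension of ℓ is w ↦ ℓ(g⁻¹ w) for g ∈ K and zero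
    -- on the other cosets.
    let φ : Representation.IndV K.subtype σ →ₗ[k] k :=
      indLift σ (fun g => if hg : g ∈ K then ℓ ∘ₗ σ ⟨g, hg⟩⁻¹ else 0) fun h g w => by
        by_cases hg : g ∈ K
        · rw [dif_pos hg, dif_pos (K.mul_mem h.2 hg), LinearMap.comp_apply, LinearMap.comp_apply,
            ← Module.End.mul_apply, ← map_mul]
          congr 3
          ext
          simp
        · rw [dif_neg hg, dif_neg fun h' => hg ((K.mul_mem_cancel_left h.2).1 h')]
          rfl
    let Φ : Representation.IndV A.subtype (charRep α) →ₗ[k] k :=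
      φ ∘ₗ ε.toLinearEquiv.symm.toLinearMap
    have key : ∀ g w, evalFun (fun g => Φ (charIndProj α (MonoidAlgebra.of k G g)))
        (MonoidAlgebra.of k G g * indCore ε w) =
          φ (Representation.IndV.mk K.subtype σ g⁻¹ w) := by
      intro g w
      have h1 : evalFun (fun g => Φ (charIndProj α (MonoidAlgebra.of k G g))) =
          Φ ∘ₗ charIndProj α := LinearMap.ext (evalFun_of_functional (Φ ∘ₗ charIndProj α))
      rw [h1, LinearMap.comp_apply, of_mul_indCore, charIndProj_charIndEmb]
      exact congrArg φ (ε.toLinearEquiv.symm_apply_apply _)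
    refine ⟨_, mem_weightFun_of_functional α Φ, fun w => ?_, fun g hg w => ?_⟩
    · have := key 1 w
      rw [map_one, one_mul, indLift_mk, dif_pos (by simp)] at this
      rw [this]
      have h1 : (⟨(1 : G)⁻¹, by simp⟩ : K)⁻¹ = 1 := by ext; simp
      rw [LinearMap.comp_apply, h1, map_one]
      rfl
    · rw [key, indLift_mk, dif_neg (by simpa using hg)]
      rfl

/-- Conversely, `u : W → k[G]` as in `IsIndCore` gives an isomorphism of induced
representations. -/
theorem IsIndCore.exists_equiv {σ : Representation k K W} {α : Dual k A}
    {u : W →ₗ[k] MonoidAlgebra k G} (hu : IsIndCore σ α u) :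
    ∃ ε : (Representation.ind K.subtype σ).Equiv (Representation.ind A.subtype (charRep α)),
      indCore ε = u := by
  classical
  have := Fintype.ofFinite G
  have hK : (Nat.card K : k) ≠ 0 := by exact_mod_cast Nat.card_pos.ne'
  let U : Representation.IndV K.subtype σ →ₗ[k] MonoidAlgebra k G :=
    indLift σ (fun g => LinearMap.mulLeft k (MonoidAlgebra.of k G g⁻¹) ∘ₗ u) fun h g w => by
      simp only [LinearMap.comp_apply, LinearMap.mulLeft_apply]
      rw [hu.equivariant, ← mul_assoc, ← map_mul]
      simp
  have hU : ∀ g w, U (Representation.IndV.mk K.subtype σ g w) = MonoidAlgebra.of k G g⁻¹ * u w :=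
    fun g w => indLift_mk _ _ _ _ _
  have hUP : ∀ x, charIndEmb α (charIndProj α (U x)) = U x := by
    intro x
    have : charIndEmb α ∘ₗ charIndProj α ∘ₗ U = U := by
      refine Representation.IndV.hom_ext _ _ fun g => LinearMap.ext fun w => ?_
      have h1 := hU g w
      simp only [LinearMap.comp_apply] at h1 ⊢
      rw [h1, charIndEmb_charIndProj, mul_assoc, hu.mul_charIdem]
    exact LinearMap.congr_fun this x
  let E : (Representation.ind K.subtype σ).IntertwiningMap
      (Representation.ind A.subtype (charRep α)) :=
    { toLinearMap := charIndProj α ∘ₗ U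
      isIntertwining' := fun g => by
        refine Representation.IndV.hom_ext _ _ fun h => LinearMap.ext fun w => ?_
        have h1 := hU h w
        have h2 := hU (h * g⁻¹) w
        have h3 := Representation.ind_mk K.subtype σ g h w
        simp only [LinearMap.comp_apply] at h1 h2 h3 ⊢
        rw [h3, h1, h2, ← charIndProj_of_mul, ← mul_assoc, ← map_mul, mul_inv_rev, inv_inv] }
  -- A functional on the induced representation is assembled from translates of functions supported
  -- near K, one for each g. Every coset is counted |K| times, hence the factor.
  have hdual : ∀ φ : Representation.IndV K.subtype σ →ₗ[k] k, ∃ f : G → k, evalFun f ∘ₗ U = φ := by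
    intro φ
    choose f _ hf1 hf2 using fun g => hu.surjective (φ ∘ₗ Representation.IndV.mk K.subtype σ g)
    refine ⟨(Nat.card K : k)⁻¹ • ∑ g : G, shift g⁻¹ (f g), ?_⟩
    refine Representation.IndV.hom_ext _ _ fun y => LinearMap.ext fun w => ?_
    have h1 := hU y w
    have h2 : ∀ g, evalFun (shift g⁻¹ (f g)) (MonoidAlgebra.of k G y⁻¹ * u w) =
        if g * y⁻¹ ∈ K then φ (Representation.IndV.mk K.subtype σ y w) else 0 := by
      intro g
      rw [evalFun_shift, ← mul_assoc, ← map_mul, inv_inv]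
      split_ifs with hg
      · have h3 := hu.equivariant ⟨_, hg⟩ w
        rw [← h3, hf1, LinearMap.comp_apply]
        have h4 := indV_mk_mul σ ⟨_, hg⟩ y w
        simp only [inv_mul_cancel_right] at h4
        rw [h4]
      · exact hf2 g _ hg w
    simp only [LinearMap.comp_apply] at h1 h2 ⊢
    rw [h1, evalFun_smul, evalFun_sum,
      Finset.sum_congr rfl fun g _ => h2 g]
    rw [← Equiv.sum_comp (Equiv.mulRight y)]
    simp only [Equiv.coe_mulRight, mul_inv_cancel_right]
    rw [← Finset.sum_filter, Finset.sum_const, ← Fintype.card_subtype, ← Nat.card_eq_fintype_card,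
      ← Nat.cast_smul_eq_nsmul k, smul_eq_mul]
    exact inv_mul_cancel_left₀ hK _
  -- Injectivity of U is surjectivity of its transpose, which is `hdual`.
  have hinj : Function.Injective E := by
    have h1 : Function.Injective U := by
      rw [← LinearMap.dualMap_surjective_iff]
      intro φ
      obtain ⟨f, hf⟩ := hdual φ
      exact ⟨evalFun f, hf⟩
    intro x y hxy
    apply h1
    rw [← hUP x, ← hUP y]
    exact congrArg _ hxy
  have hsurj : Function.Surjective E := by
    change Function.Surjective (charIndProj α ∘ₗ U)
    rw [← LinearMap.dualMap_injective_iff, injective_iff_map_eq_zero]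
    intro φ hφ
    have h1 := hu.injective _ (mem_weightFun_of_functional α φ) fun g w => by
      have h2 : evalFun (fun g => φ (charIndProj α (MonoidAlgebra.of k G g))) =
          φ ∘ₗ charIndProj α := LinearMap.ext (evalFun_of_functional (φ ∘ₗ charIndProj α))
      rw [h2]
      have h3 := LinearMap.congr_fun hφ (Representation.IndV.mk K.subtype σ g⁻¹ w)
      have h4 := hU g⁻¹ w
      rw [inv_inv] at h4
      rw [LinearMap.dualMap_apply, LinearMap.comp_apply, h4] at h3
      exact h3
    refine Representation.IndV.hom_ext _ _ fun g => LinearMap.ext_ring ?_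
    have h2 := congrFun h1 g⁻¹
    beta_reduce at h2
    rw [charIndProj_of, inv_inv] at h2
    exact h2
  refine ⟨E.ofBijective ⟨hinj, hsurj⟩, LinearMap.ext fun w => ?_⟩
  change charIndEmb α (charIndProj α (U (Representation.IndV.mk K.subtype σ 1 w))) = _
  rw [hUP, hU, inv_one, map_one, one_mul]

end Induced

/-- The exchange map in terms of the core of the isomorphism of induced representations. -/
theorem exchangeHom_apply [Finite G] [CharZero k] {𝒟 : DynamicalDatum k A} (ε : IndIsos 𝒟)
    (χ ψ : Dual k A) {X : Type*} [AddCommGroup X] [Module k X] (ρ : Representation k G X)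
    (x : weightSpace ρ (χ / ψ)) (T : 𝒟.V ψ →ₗ[k] 𝒟.V χ) :
    exchangeHom ε χ ψ ρ x T = ρ.asAlgebraHom (indCore (ε χ ψ) T) (x : X) :=
  frobeniusHom_apply _ _ _ _

/-! ### Duality between fibre maps and maps to the group algebra -/

section Dual

/-- This and the next lemma give the two directions of the trace duality between Hom(V, W) and
Hom(W, V), on rank one maps ξ(T w) = tr(T ∘ (w ⊗ ξ)). -/
theorem exists_linearMap_of_functional {V W : Type*} [AddCommGroup V] [Module k V]
    [Module.Finite k V] [AddCommGroup W] [Module k W] :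
    ∃ Φ : ((V →ₗ[k] W) →ₗ[k] k) →ₗ[k] (W →ₗ[k] V), ∀ ℓ (ξ : V →ₗ[k] k) (w : W),
      ξ (Φ ℓ w) = ℓ (ξ.smulRight w) := by
  refine ⟨∑ i, (LinearMap.smulRightₗ.flip (Module.finBasis k V i)) ∘ₗ
    (LinearMap.smulRightₗ ((Module.finBasis k V).coord i)).lcomp k k, fun ℓ ξ w => ?_⟩
  have h1 : ξ.smulRight w = ∑ i, ξ (Module.finBasis k V i) •
      ((Module.finBasis k V).coord i).smulRight w := by
    conv_lhs => rw [linearMap_eq_sum_smulRight (ξ.smulRight w)]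
    refine Finset.sum_congr rfl fun i _ => ?_
    ext v
    simp [smul_smul, mul_comm]
  rw [h1, map_sum, LinearMap.sum_apply, LinearMap.sum_apply, map_sum]
  refine Finset.sum_congr rfl fun i _ => ?_
  simp [mul_comm]

theorem exists_functional_of_linearMap {V W : Type*} [AddCommGroup V] [Module k V]
    [Module.Finite k V] [AddCommGroup W] [Module k W] :
    ∃ Ψ : (W →ₗ[k] V) →ₗ[k] (V →ₗ[k] W) →ₗ[k] k, ∀ T (ξ : V →ₗ[k] k) (w : W),
      Ψ T (ξ.smulRight w) = ξ (T w) := by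
  refine ⟨((LinearMap.trace k V).compRight k) ∘ₗ LinearMap.llcomp k V W V, fun T ξ w => ?_⟩
  have : (LinearMap.llcomp k V W V T) (ξ.smulRight w) = ξ.smulRight (T w) := by
    ext v
    simp
  simp only [LinearMap.comp_apply, LinearMap.compRight_apply]
  rw [this]
  simp

theorem apply_eq_sum_coord {V : Type*} [AddCommGroup V] [Module k V] [Module.Finite k V]
    (ξ : V →ₗ[k] k) (v : V) : ξ v = ∑ i, ξ (Module.finBasis k V i) *
      (Module.finBasis k V).coord i v := by
  conv_lhs => rw [← (Module.finBasis k V).sum_repr v]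
  rw [map_sum]
  refine Finset.sum_congr rfl fun i _ => ?_
  rw [map_smul, smul_eq_mul, mul_comm, Module.Basis.coord_apply]

theorem eq_of_forall_functional {V : Type*} [AddCommGroup V] [Module k V] {v w : V}
    (h : ∀ ξ : V →ₗ[k] k, ξ v = ξ w) : v = w := by
  rw [← sub_eq_zero]
  exact (Module.forall_dual_apply_eq_zero_iff k _).1 fun ξ => by rw [map_sub, h, sub_self]

section Family

variable {V : Dual k A → Type w} [∀ χ, AddCommGroup (V χ)] [∀ χ, Module k (V χ)]

/-- Maps `u_{χψ} : Hom(V_χ, V_ψ) → k[G] P_{ψ-χ}` that are dual to maps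
`τ_{χψ} : F_{ψ-χ}[G] → Hom(V_ψ, V_χ)` with respect to the trace pairing. -/
structure IsDualFamily (τ : ∀ χ ψ, (G → k) →ₗ[k] (V ψ →ₗ[k] V χ))
    (u : ∀ χ ψ, (V χ →ₗ[k] V ψ) →ₗ[k] MonoidAlgebra k G) : Prop where
  pairing : ∀ χ ψ : Dual k A, ∀ f ∈ weightFun (ψ / χ), ∀ (ξ : V χ →ₗ[k] k) (v : V ψ),
    ξ (τ χ ψ f v) = evalFun f (u χ ψ (ξ.smulRight v))
  mul_charIdem : ∀ (χ ψ : Dual k A) T, u χ ψ T * charIdem (ψ / χ) = u χ ψ T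

theorem exists_isDualFamily_of_core [∀ χ, Module.Finite k (V χ)]
    (u : ∀ χ ψ, (V χ →ₗ[k] V ψ) →ₗ[k] MonoidAlgebra k G)
    (hu : ∀ (χ ψ : Dual k A) T, u χ ψ T * charIdem (ψ / χ) = u χ ψ T) :
    ∃ τ : ∀ χ ψ, (G → k) →ₗ[k] (V ψ →ₗ[k] V χ), IsDualFamily τ u := by
  choose Φ hΦ using fun χ ψ : Dual k A =>
    exists_linearMap_of_functional (k := k) (V := V χ) (W := V ψ)
  refine ⟨fun χ ψ => Φ χ ψ ∘ₗ (u χ ψ).lcomp k k ∘ₗ evalPairing k G, fun χ ψ f _ ξ v => ?_, hu⟩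
  simp only [LinearMap.comp_apply]
  rw [hΦ]
  rfl

variable [Finite G] [CharZero k]

theorem exists_isDualFamily_of_map [IsMulCommutative A] [∀ χ, Module.Finite k (V χ)]
    (τ : ∀ χ ψ, (G → k) →ₗ[k] (V ψ →ₗ[k] V χ)) :
    ∃ u : ∀ χ ψ, (V χ →ₗ[k] V ψ) →ₗ[k] MonoidAlgebra k G, IsDualFamily τ u := by
  classical
  have := Fintype.ofFinite G
  choose Ψ hΨ using fun χ ψ : Dual k A =>
    exists_functional_of_linearMap (k := k) (V := V χ) (W := V ψ)
  -- The coefficient at g is the trace pairing with τ of the weight component of δ_g. This makes u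
  -- the transpose of τ preceded by the weight projection, so its values lie in k[G] P_{ψ-χ}.
  let u : ∀ χ ψ : Dual k A, (V χ →ₗ[k] V ψ) →ₗ[k] MonoidAlgebra k G := fun χ ψ =>
    ∑ g : G, (Ψ χ ψ (τ χ ψ (weightProj (ψ / χ) (Pi.single g 1)))).smulRight
      (MonoidAlgebra.of k G g)
  have hu : ∀ (χ ψ : Dual k A) (f : G → k) T,
      evalFun f (u χ ψ T) = Ψ χ ψ (τ χ ψ (weightProj (ψ / χ) f)) T := by
    intro χ ψ f T
    conv_rhs => rw [← Finset.univ_sum_single f]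
    rw [LinearMap.sum_apply, map_sum, map_sum, map_sum, map_sum, LinearMap.sum_apply]
    refine Finset.sum_congr rfl fun g _ => ?_
    have : (Pi.single g (f g) : G → k) = f g • Pi.single g 1 := by
      rw [← Pi.single_smul, smul_eq_mul, mul_one]
    rw [this, LinearMap.smulRight_apply, map_smul, evalFun_of, map_smul, map_smul, map_smul,
      LinearMap.smul_apply, smul_eq_mul, smul_eq_mul, mul_comm]
  refine ⟨u, fun χ ψ f hf ξ v => ?_, fun χ ψ T => evalFun_ext fun f => ?_⟩
  · rw [hu, weightProj_of_mem hf, hΨ]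
  · rw [← evalFun_weightProj, hu, hu, weightProj_of_mem (weightProj_mem _ _)]

namespace IsDualFamily

variable {τ : ∀ χ ψ, (G → k) →ₗ[k] (V ψ →ₗ[k] V χ)}
  {u : ∀ χ ψ, (V χ →ₗ[k] V ψ) →ₗ[k] MonoidAlgebra k G} (h : IsDualFamily τ u)

include h

theorem pairing_of_mul {χ ψ : Dual k A} {f : G → k} (hf : f ∈ weightFun (ψ / χ)) (g : G)
    (ξ : V χ →ₗ[k] k) (v : V ψ) : evalFun f (MonoidAlgebra.of k G g * u χ ψ (ξ.smulRight v)) =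
      ξ (τ χ ψ (shift g⁻¹ f) v) := by
  rw [h.pairing _ _ _ (shift_mem_weightFun hf _), evalFun_shift, inv_inv]

theorem forall_evalFun_eq_zero [∀ χ, Module.Finite k (V χ)] {χ ψ : Dual k A} {f : G → k}
    (hf : f ∈ weightFun (ψ / χ)) (g : G) :
    (∀ T, evalFun f (MonoidAlgebra.of k G g * u χ ψ T) = 0) ↔ τ χ ψ (shift g⁻¹ f) = 0 := by
  constructor
  · intro h0
    refine LinearMap.ext fun v => eq_of_forall_functional (k := k) fun ξ => ?_
    rw [← h.pairing_of_mul hf, h0, LinearMap.zero_apply, map_zero]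
  · intro h0
    have : evalFun f ∘ₗ LinearMap.mulLeft k (MonoidAlgebra.of k G g) ∘ₗ u χ ψ = 0 :=
      linearMap_ext_smulRight fun ξ v => by
        have h1 := h.pairing_of_mul hf g ξ v
        rw [h0, LinearMap.zero_apply, map_zero] at h1
        exact h1
    exact fun T => LinearMap.congr_fun this T

theorem forall_evalFun_eq_iff [∀ χ, Module.Finite k (V χ)] {χ ψ : Dual k A} {f : G → k}
    (hf : f ∈ weightFun (ψ / χ)) (ℓ : (V χ →ₗ[k] V ψ) →ₗ[k] k) (T : V ψ →ₗ[k] V χ)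
    (hT : ∀ (ξ : V χ →ₗ[k] k) (v : V ψ), ξ (T v) = ℓ (ξ.smulRight v)) :
    (∀ S, evalFun f (u χ ψ S) = ℓ S) ↔ τ χ ψ f = T := by
  constructor
  · intro h0
    refine LinearMap.ext fun v => eq_of_forall_functional (k := k) fun ξ => ?_
    rw [h.pairing _ _ _ hf, h0, hT]
  · rintro rfl
    have : evalFun f ∘ₗ u χ ψ = ℓ := linearMap_ext_smulRight fun ξ v => by
      rw [← hT, h.pairing _ _ _ hf, LinearMap.comp_apply]
    exact fun S => LinearMap.congr_fun this S

theorem map_one_iff [∀ χ, Module.Finite k (V χ)] (χ : Dual k A) :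
    τ χ χ 1 = LinearMap.id ↔ ∀ (ξ : V χ →ₗ[k] k) (v : V χ),
      evalFun 1 (u χ χ (ξ.smulRight v)) = ξ v := by
  constructor
  · intro h1 ξ v
    rw [← h.pairing χ χ 1 (one_mem_weightFun_div χ), h1, LinearMap.id_apply]
  · intro h1
    refine LinearMap.ext fun v => eq_of_forall_functional (k := k) fun ξ => ?_
    rw [h.pairing χ χ 1 (one_mem_weightFun_div χ), h1, LinearMap.id_apply]

theorem comp_eq [∀ χ, Module.Finite k (V χ)] {χ ψ ω : Dual k A} {f f' : G → k}
    (hf : f ∈ weightFun (ψ / χ)) (hf' : f' ∈ weightFun (ω / ψ)) (ξ : V χ →ₗ[k] k) (v : V ω) :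
    ξ (τ χ ψ f (τ ψ ω f' v)) = evalFun₂ f f' (∑ i,
      u χ ψ (ξ.smulRight (Module.finBasis k (V ψ) i)) ⊗ₜ[k]
        u ψ ω (((Module.finBasis k (V ψ)).coord i).smulRight v)) := by
  change (ξ ∘ₗ τ χ ψ f) _ = _
  rw [apply_eq_sum_coord (ξ ∘ₗ τ χ ψ f), map_sum]
  refine Finset.sum_congr rfl fun i _ => ?_
  rw [evalFun₂_tmul, ← h.pairing _ _ _ hf, ← h.pairing _ _ _ hf', LinearMap.comp_apply]

theorem map_mul_iff [IsAlgClosed k] [IsMulCommutative A] [∀ χ, Module.Finite k (V χ)]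
    {x : MonoidAlgebra k G ⊗[k] MonoidAlgebra k G} {χ ψ ω : Dual k A}
    (hx : ∀ f ∈ weightFun (ψ / χ), ∀ f' ∈ weightFun (ω / ψ), starMul x f f' ∈ weightFun (ω / χ)) :
    (∀ f ∈ weightFun (ψ / χ), ∀ f' ∈ weightFun (ω / ψ),
      τ χ ω (starMul x f f') = τ χ ψ f ∘ₗ τ ψ ω f') ↔
    ∀ (ξ : V χ →ₗ[k] k) (v : V ω),
      Bialgebra.comulAlgHom k (MonoidAlgebra k G) (u χ ω (ξ.smulRight v)) *
        (x * (charIdem (ψ / χ) ⊗ₜ[k] charIdem (ω / ψ))) =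
      ∑ i, u χ ψ (ξ.smulRight (Module.finBasis k (V ψ) i)) ⊗ₜ[k]
        u ψ ω (((Module.finBasis k (V ψ)).coord i).smulRight v) := by
  classical
  have key : ∀ f ∈ weightFun (ψ / χ), ∀ f' ∈ weightFun (ω / ψ), ∀ y,
      evalFun₂ f f' (y * (charIdem (ψ / χ) ⊗ₜ[k] charIdem (ω / ψ))) = evalFun₂ f f' y := by
    intro f hf f' hf' y
    induction y using tensor_induction with
    | of g h =>
      rw [Algebra.TensorProduct.tmul_mul_tmul, evalFun₂_tmul, evalFun₂_tmul,
        evalFun_mul_charIdem hf, evalFun_mul_charIdem hf']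
    | add y z hy hz => rw [add_mul, map_add, hy, hz, map_add]
    | smul c y hy => rw [smul_mul_assoc, map_smul, hy, map_smul]
  have key' : ∀ (α β : Dual k A), ∀ f ∈ weightFun α, ∀ f' ∈ weightFun β,
      (α ≠ ψ / χ ∨ β ≠ ω / ψ) → ∀ y : MonoidAlgebra k G ⊗[k] MonoidAlgebra k G,
      evalFun₂ f f' (y * (charIdem (ψ / χ) ⊗ₜ[k] charIdem (ω / ψ))) = 0 := by
    intro α β f hf f' hf' hne y
    induction y using tensor_induction with
    | of g h =>
      rw [Algebra.TensorProduct.tmul_mul_tmul, evalFun₂_tmul]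
      rcases hne with hne | hne
      · rw [evalFun_mul_charIdem_of_ne hf hne, zero_mul]
      · rw [evalFun_mul_charIdem_of_ne hf' hne, mul_zero]
    | add y z hy hz => rw [add_mul, map_add, hy, hz, add_zero]
    | smul c y hy => rw [smul_mul_assoc, map_smul, hy, smul_zero]
  constructor
  · intro hmul ξ v
    have hP : (∑ i, u χ ψ (ξ.smulRight (Module.finBasis k (V ψ) i)) ⊗ₜ[k]
        u ψ ω (((Module.finBasis k (V ψ)).coord i).smulRight v)) *
          (charIdem (ψ / χ) ⊗ₜ[k] charIdem (ω / ψ)) =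
        ∑ i, u χ ψ (ξ.smulRight (Module.finBasis k (V ψ) i)) ⊗ₜ[k]
        u ψ ω (((Module.finBasis k (V ψ)).coord i).smulRight v) := by
      rw [Finset.sum_mul]
      refine Finset.sum_congr rfl fun i _ => ?_
      rw [Algebra.TensorProduct.tmul_mul_tmul, h.mul_charIdem, h.mul_charIdem]
    refine evalFun₂_ext_weight (A := A) fun α β f hf f' hf' => ?_
    rw [← hP, ← mul_assoc]
    by_cases hne : α ≠ ψ / χ ∨ β ≠ ω / ψ
    · rw [key' α β f hf f' hf' hne, key' α β f hf f' hf' hne]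
    · push Not at hne
      obtain ⟨rfl, rfl⟩ := hne
      rw [key f hf f' hf', key f hf f' hf', evalFun₂_comul, ← h.comp_eq hf hf',
        ← h.pairing _ _ _ (hx f hf f' hf'), hmul f hf f' hf', LinearMap.comp_apply]
  · intro heq f hf f' hf'
    refine LinearMap.ext fun v => eq_of_forall_functional (k := k) fun ξ => ?_
    rw [LinearMap.comp_apply, h.comp_eq hf hf', ← heq, ← mul_assoc, key f hf f' hf',
      evalFun₂_comul, h.pairing _ _ _ (hx f hf f' hf')]

end IsDualFamily

end Family

variable [Finite G] [CharZero k] {𝒱 : ProjectiveFamily k A}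
  {τ : ∀ χ ψ, (G → k) →ₗ[k] (𝒱.V ψ →ₗ[k] 𝒱.V χ)}
  {u : ∀ χ ψ, (𝒱.V χ →ₗ[k] 𝒱.V ψ) →ₗ[k] MonoidAlgebra k G}

theorem homRep_smulRight {χ ψ : Dual k A} (h : 𝒱.K) (ξ : 𝒱.V ψ →ₗ[k] k) (v : 𝒱.V χ) :
    𝒱.homRep χ ψ h (ξ.smulRight v) =
      (ξ ∘ₗ (𝒱.π ψ h).symm.toLinearMap).smulRight (𝒱.π χ h v) := by
  ext w
  change (𝒱.π ψ h).arrowCongr (𝒱.π χ h) (ξ.smulRight v) w = _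
  simp [LinearEquiv.arrowCongr_apply]

/-- With `IsDualFamily.isFiberMap` this shows that fibre maps and isomorphisms Ind_K^G(V_ψ ⊗ V_χ^*)
≅ Ind_A^G(ψ-χ) are transposes of each other. Vanishing on g u_{χψ}(T) for all T means that τ kills
the translate by g⁻¹. -/
theorem IsDualFamily.isIndCore [IsMulCommutative A] (h : IsDualFamily τ u) (hτ : IsFiberMap 𝒱.K 𝒱.π τ)
    (χ ψ : Dual k A) : IsIndCore (𝒱.homRep ψ χ) (ψ / χ) (u χ ψ) where
  equivariant x T := by
    have : u χ ψ ∘ₗ 𝒱.homRep ψ χ x = LinearMap.mulLeft k (MonoidAlgebra.of k G (x : G)) ∘ₗ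
        u χ ψ := by
      refine linearMap_ext_smulRight fun ξ v => ?_
      rw [LinearMap.comp_apply, LinearMap.comp_apply, LinearMap.mulLeft_apply, homRep_smulRight]
      refine evalFun_ext fun f => ?_
      rw [← h.mul_charIdem, ← h.mul_charIdem χ ψ (ξ.smulRight v), ← mul_assoc,
        ← evalFun_weightProj, ← evalFun_weightProj]
      have hf := weightProj_mem (ψ / χ) f
      have h1 := hτ.equivariant χ ψ x _ (shift_mem_weightFun hf (x : G)⁻¹)
      rw [← shift_mul, mul_inv_cancel, shift_one] at h1
      rw [h.pairing_of_mul hf, ← h.pairing _ _ _ hf, h1]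
      simp [LinearEquiv.arrowCongr_apply]
    exact LinearMap.congr_fun this T
  mul_charIdem := h.mul_charIdem χ ψ
  injective f hf h0 := hτ.injective χ ψ f hf fun g => by
    have := (h.forall_evalFun_eq_zero hf g⁻¹).1 (h0 g⁻¹)
    rwa [inv_inv] at this
  surjective ℓ := by
    obtain ⟨Φ, hΦ⟩ := exists_linearMap_of_functional (k := k) (V := 𝒱.V χ) (W := 𝒱.V ψ)
    refine ⟨hτ.lift χ ψ (Φ ℓ), hτ.lift_mem _ _ _, ?_, fun g hg => ?_⟩
    · exact (h.forall_evalFun_eq_iff (hτ.lift_mem _ _ _) ℓ (Φ ℓ) (hΦ ℓ)).2 (hτ.map_lift _ _ _)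
    · rw [h.forall_evalFun_eq_zero (hτ.lift_mem _ _ _)]
      exact hτ.map_shift_lift_of_notMem _ _ _ (by simpa using hg)

theorem IsDualFamily.isFiberMap (h : IsDualFamily τ u)
    (hu : ∀ χ ψ : Dual k A, IsIndCore (𝒱.homRep ψ χ) (ψ / χ) (u χ ψ)) :
    IsFiberMap 𝒱.K 𝒱.π τ where
  equivariant χ ψ x f hf := by
    refine LinearMap.ext fun v => eq_of_forall_functional (k := k) fun ξ => ?_
    have h1 := homRep_smulRight x (ξ ∘ₗ (𝒱.π χ x).toLinearMap) ((𝒱.π ψ x).symm v)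
    have h2 : (ξ ∘ₗ (𝒱.π χ x).toLinearMap) ∘ₗ (𝒱.π χ x).symm.toLinearMap = ξ := by
      ext w
      simp
    rw [h2, LinearEquiv.apply_symm_apply] at h1
    rw [h.pairing _ _ _ (shift_mem_weightFun hf _), ← h1, (hu χ ψ).equivariant, evalFun_shift,
      ← mul_assoc, ← map_mul, inv_mul_cancel, map_one, one_mul, ← h.pairing _ _ _ hf]
    simp [LinearEquiv.arrowCongr_apply]
  injective χ ψ f hf h0 := (hu χ ψ).injective f hf fun g =>
    (h.forall_evalFun_eq_zero hf g).2 (h0 g⁻¹)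
  surjective χ ψ T := by
    obtain ⟨Ψ, hΨ⟩ := exists_functional_of_linearMap (k := k) (V := 𝒱.V χ) (W := 𝒱.V ψ)
    obtain ⟨f, hf, h1, h2⟩ := (hu χ ψ).surjective (Ψ T)
    refine ⟨f, ⟨hf, fun g hg => ?_⟩, ?_⟩
    · have := (h.forall_evalFun_eq_zero hf g⁻¹).1 (h2 g⁻¹ (by simpa using hg))
      rwa [inv_inv] at this
    · exact (h.forall_evalFun_eq_iff hf (Ψ T) T fun ξ v => (hΨ T ξ v).symm).1 h1

end Dual

/-- Every dynamical twist has a fibre representation in a dynamical datum. -/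
theorem exists_hasFiberRep [Finite G] [CharZero k] [IsAlgClosed k] [IsMulCommutative A]
    (J : DynamicalTwist k A) : ∃ 𝒟 : DynamicalDatum k A, HasFiberRep J 𝒟 := by
  obtain ⟨𝒱, τ, hτ⟩ := exists_projectiveFamily J
  obtain ⟨u, hu⟩ := exists_isDualFamily_of_map τ
  refine ⟨{ toProjectiveFamily := 𝒱
            ind_iso := fun χ ψ => ?_ }, τ, hτ⟩
  obtain ⟨ε, -⟩ := (hu.isIndCore hτ.toIsFiberMap ψ χ).exists_equiv
  exact ⟨ε⟩

/-! ### The exchange construction -/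

section Contraction

variable {V X Y : Type*} [AddCommGroup V] [Module k V] [AddCommGroup X] [Module k X]
  [AddCommGroup Y] [Module k Y]

/-- Contraction of the first tensor factor with a functional. -/
def contract (ξ : V →ₗ[k] k) : V ⊗[k] X →ₗ[k] X :=
  (TensorProduct.lid k X).toLinearMap ∘ₗ ξ.rTensor X

@[simp]
theorem contract_tmul (ξ : V →ₗ[k] k) (v : V) (x : X) : contract ξ (v ⊗ₜ[k] x) = ξ v • x := by
  simp [contract]

theorem contract_assoc (ξ : V →ₗ[k] k) (z : V ⊗[k] Y) (x : X) :
    contract ξ (TensorProduct.assoc k V Y X (z ⊗ₜ[k] x)) = contract ξ z ⊗ₜ[k] x := by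
  induction z using TensorProduct.induction_on with
  | zero => simp
  | tmul v y => simp [TensorProduct.smul_tmul']
  | add z w hz hw => rw [TensorProduct.add_tmul, map_add, map_add, hz, hw, map_add,
      TensorProduct.add_tmul]

theorem eq_of_contract_eq [Module.Finite k V] {z w : V ⊗[k] X}
    (h : ∀ ξ : V →ₗ[k] k, contract ξ z = contract ξ w) : z = w := by
  have key : ∀ z : V ⊗[k] X, z = ∑ i, Module.finBasis k V i ⊗ₜ[k]
      contract ((Module.finBasis k V).coord i) z := by
    intro z
    induction z using TensorProduct.induction_on with
    | zero => simp
    | tmul v x =>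
      simp only [contract_tmul, ← TensorProduct.smul_tmul, ← TensorProduct.sum_tmul]
      congr 1
      exact ((Module.finBasis k V).sum_repr v).symm
    | add z w hz hw =>
      conv_lhs => rw [hz, hw]
      simp only [map_add, TensorProduct.tmul_add, Finset.sum_add_distrib]
  rw [key z, key w]
  simp only [h]

theorem smulRight_eq_sum_coord [Module.Finite k V] (ξ : V →ₗ[k] k) (x : X) :
    ξ.smulRight x = ∑ i, ξ (Module.finBasis k V i) •
      ((Module.finBasis k V).coord i).smulRight x := by
  ext v
  rw [LinearMap.smulRight_apply, apply_eq_sum_coord, Finset.sum_smul, LinearMap.sum_apply]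
  simp [smul_smul]

end Contraction

section Modules

variable {X Y : Type*} [AddCommGroup X] [Module k X] [AddCommGroup Y] [Module k Y]

theorem asAlgebraHom_tprod (ρY : Representation k G Y) (ρX : Representation k G X)
    (z : MonoidAlgebra k G) : (ρY.tprod ρX).asAlgebraHom z =
      tensorAct ρY ρX (Bialgebra.comulAlgHom k (MonoidAlgebra k G) z) := by
  induction z using monoidAlgebra_induction with
  | of g =>
    rw [Representation.asAlgebraHom_of]
    ext y x
    simp [tensorAct, Module.endTensorEndAlgHom]
  | add x y hx hy => rw [map_add, map_add, map_add, hx, hy]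
  | smul c x hx => rw [map_smul, map_smul, map_smul, hx]

theorem tensorAct_tmul (ρY : Representation k G Y) (ρX : Representation k G X)
    (a b : MonoidAlgebra k G) (y : Y) (x : X) :
    tensorAct ρY ρX (a ⊗ₜ[k] b) (y ⊗ₜ[k] x) =
      ρY.asAlgebraHom a y ⊗ₜ[k] ρX.asAlgebraHom b x := by
  simp [tensorAct, Module.endTensorEndAlgHom]

theorem asAlgebraHom_leftRegular (z x : MonoidAlgebra k G) :
    (Representation.leftRegular k G).asAlgebraHom z x = z * x := by
  induction z using monoidAlgebra_induction with
  | of g =>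
    rw [Representation.asAlgebraHom_of]
    induction x using monoidAlgebra_induction with
    | of h => simp [Representation.ofMulAction_single]
    | add x y hx hy => rw [map_add, hx, hy, mul_add]
    | smul c x hx => rw [map_smul, hx, mul_smul_comm]
  | add x y hx hy => rw [map_add, LinearMap.add_apply, hx, hy, add_mul]
  | smul c x hx => rw [map_smul, LinearMap.smul_apply, hx, smul_mul_assoc]

theorem tensorAct_leftRegular (z : MonoidAlgebra k G ⊗[k] MonoidAlgebra k G)
    (x y : MonoidAlgebra k G) :
    tensorAct (Representation.leftRegular k G) (Representation.leftRegular k G) z (x ⊗ₜ[k] y) =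
      z * (x ⊗ₜ[k] y) := by
  induction z using tensor_induction with
  | of g h =>
    rw [tensorAct_tmul, asAlgebraHom_leftRegular, asAlgebraHom_leftRegular,
      Algebra.TensorProduct.tmul_mul_tmul]
  | add x y hx hy => rw [map_add, LinearMap.add_apply, hx, hy, add_mul]
  | smul c x hx => rw [map_smul, LinearMap.smul_apply, hx, smul_mul_assoc]

theorem asAlgebraHom_trivial (z : MonoidAlgebra k G) (c : k) :
    (Representation.trivial k G k).asAlgebraHom z c = evalFun 1 z * c := by
  induction z using monoidAlgebra_induction with
  | of g => simp
  | add x y hx hy => rw [map_add, LinearMap.add_apply, hx, hy, map_add, add_mul]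
  | smul d x hx => rw [map_smul, LinearMap.smul_apply, hx, map_smul, smul_mul_assoc]

theorem charIdem_mem_weightSpace [Finite G] (χ : Dual k A) :
    charIdem χ ∈ weightSpace (Representation.leftRegular k G) χ := by
  intro a
  rw [← Representation.asAlgebraHom_of, asAlgebraHom_leftRegular, of_mul_charIdem]

theorem tensorAct_mem_weightSpace {J : Dual k A → MonoidAlgebra k G ⊗[k] MonoidAlgebra k G}
    (hJ : ZeroWeight₂ J) (ρY : Representation k G Y) (ρX : Representation k G X)
    {α β : Dual k A} (θ : Dual k A) (y : weightSpace ρY α) (x : weightSpace ρX β) :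
    tensorAct ρY ρX (J θ) ((y : Y) ⊗ₜ[k] (x : X)) ∈ weightSpace (ρY.tprod ρX) (α * β) := by
  intro a
  have h1 : Bialgebra.comulAlgHom k (MonoidAlgebra k G) (MonoidAlgebra.of k G (a : G)) =
      MonoidAlgebra.of k G (a : G) ⊗ₜ[k] MonoidAlgebra.of k G (a : G) := by simp
  rw [← Representation.asAlgebraHom_of, asAlgebraHom_tprod, h1, ← Module.End.mul_apply, ← map_mul,
    hJ, map_mul, Module.End.mul_apply, tensorAct_tmul, Representation.asAlgebraHom_of,
    Representation.asAlgebraHom_of, x.2 a, y.2 a, TensorProduct.smul_tmul_smul, map_smul]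
  rfl

end Modules

section Exchange

variable [Finite G] [CharZero k] {𝒟 : DynamicalDatum k A}

/-- Contraction with ξ removes the dual bases from the definition of Ψ and leaves the action of one
element of k[G] on x. -/
theorem contract_Psi (ε : IndIsos 𝒟) (χ ψ : Dual k A) {X : Type*} [AddCommGroup X] [Module k X]
    (ρ : Representation k G X) (x : weightSpace ρ (χ / ψ)) (ξ : 𝒟.V ψ →ₗ[k] k) (v : 𝒟.V χ) :
    contract ξ (Psi ε χ ψ ρ x v) = ρ.asAlgebraHom (indCore (ε χ ψ) (ξ.smulRight v)) (x : X) := by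
  rw [smulRight_eq_sum_coord ξ v, map_sum, map_sum, LinearMap.sum_apply, Psi,
    LinearMap.sum_apply, map_sum]
  refine Finset.sum_congr rfl fun i _ => ?_
  simp only [LinearMap.comp_apply, TensorProduct.mk_apply]
  rw [contract_tmul, exchangeHom_apply, map_smul, map_smul, LinearMap.smul_apply]
  rfl

theorem contract_Psi_Psi (ε : IndIsos 𝒟) (χ ψ ω : Dual k A) {X Y : Type*} [AddCommGroup X]
    [Module k X] [AddCommGroup Y] [Module k Y] (ρX : Representation k G X)
    (ρY : Representation k G Y) (x : weightSpace ρX (χ / ψ)) (y : weightSpace ρY (ψ / ω))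
    (ξ : 𝒟.V ω →ₗ[k] k) (v : 𝒟.V χ) :
    contract ξ (TensorProduct.assoc k (𝒟.V ω) Y X
      ((Psi ε ψ ω ρY y).rTensor X (Psi ε χ ψ ρX x v))) =
    tensorAct ρY ρX (∑ i, indCore (ε ψ ω) (ξ.smulRight (Module.finBasis k (𝒟.V ψ) i)) ⊗ₜ[k]
      indCore (ε χ ψ) (((Module.finBasis k (𝒟.V ψ)).coord i).smulRight v))
      ((y : Y) ⊗ₜ[k] (x : X)) := by
  have hsum : Psi ε χ ψ ρX x v = ∑ i, Module.finBasis k (𝒟.V ψ) i ⊗ₜ[k]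
      exchangeHom ε χ ψ ρX x (((Module.finBasis k (𝒟.V ψ)).coord i).smulRight v) := by
    rw [Psi, LinearMap.sum_apply]
    rfl
  rw [map_sum, LinearMap.sum_apply, hsum, map_sum, map_sum, map_sum]
  refine Finset.sum_congr rfl fun i _ => ?_
  rw [LinearMap.rTensor_tmul, contract_assoc, contract_Psi, exchangeHom_apply, tensorAct_tmul]

theorem Psi_trivial_iff (ε : IndIsos 𝒟) (χ : Dual k A) :
    (∀ v, Psi ε χ χ (Representation.trivial k G k) ⟨1, one_mem_weightSpace χ⟩ v =
      v ⊗ₜ[k] (1 : k)) ↔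
    ∀ (ξ : 𝒟.V χ →ₗ[k] k) (v : 𝒟.V χ), evalFun 1 (indCore (ε χ χ) (ξ.smulRight v)) = ξ v := by
  constructor
  · intro h ξ v
    have h1 := contract_Psi ε χ χ (Representation.trivial k G k) ⟨1, one_mem_weightSpace χ⟩ ξ v
    rw [h, contract_tmul, asAlgebraHom_trivial, mul_one, smul_eq_mul, mul_one] at h1
    exact h1.symm
  · intro h v
    refine eq_of_contract_eq fun ξ => ?_
    rw [contract_Psi, contract_tmul, asAlgebraHom_trivial, mul_one, h, smul_eq_mul, mul_one]

variable [IsAlgClosed k] [IsMulCommutative A]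

/-- A dynamical twist is obtained from a datum by the exchange construction if and only if the
datum carries a fibre representation of the twist. -/
theorem isExchangeTwist_iff {J : DynamicalTwist k A} {𝒟 : DynamicalDatum k A} :
    IsExchangeTwist 𝒟 J ↔ HasFiberRep J 𝒟 := by
  constructor
  · rintro ⟨ε, hone, hmul⟩
    have hcore : ∀ χ ψ : Dual k A, IsIndCore (𝒟.homRep ψ χ) (ψ / χ) (indCore (ε ψ χ)) :=
      fun χ ψ => isIndCore_indCore (ε ψ χ)
    obtain ⟨τ, hτ⟩ := exists_isDualFamily_of_core (fun χ ψ : Dual k A => indCore (ε ψ χ))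
      fun χ ψ => (hcore χ ψ).mul_charIdem
    refine ⟨τ, { hτ.isFiberMap hcore with
      map_one := fun χ => (hτ.map_one_iff χ).2 ((Psi_trivial_iff ε χ).1 (hone χ))
      map_mul := fun ω ψ χ => ?_ }⟩
    refine (hτ.map_mul_iff fun f hf f' hf' => starMul_mem J χ hf hf').2 fun ξ v => ?_
    -- The universal test case: X and Y regular, with x and y the idempotents P of the required
    -- weights. The exchange identity becomes an equation in k[G] ⊗ k[G].
    obtain ⟨hz, h⟩ := hmul _ _ (Representation.leftRegular k G) (Representation.leftRegular k G)
      χ ψ ω ⟨_, charIdem_mem_weightSpace (χ / ψ)⟩ ⟨_, charIdem_mem_weightSpace (ψ / ω)⟩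
    have h1 := congrArg (contract ξ) (LinearMap.congr_fun h v)
    rw [contract_Psi, asAlgebraHom_tprod] at h1
    have h2 := (contract_Psi_Psi ε χ ψ ω (Representation.leftRegular k G)
      (Representation.leftRegular k G) ⟨_, charIdem_mem_weightSpace (χ / ψ)⟩
      ⟨_, charIdem_mem_weightSpace (ψ / ω)⟩ ξ v).symm.trans h1
    rw [← Module.End.mul_apply, ← map_mul, tensorAct_leftRegular, tensorAct_leftRegular,
      mul_assoc] at h2
    rw [← h2, Finset.sum_mul]
    refine Finset.sum_congr rfl fun i _ => ?_
    rw [Algebra.TensorProduct.tmul_mul_tmul, (hcore ω ψ).mul_charIdem, (hcore ψ χ).mul_charIdem]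
  · rintro ⟨τ, hτ⟩
    obtain ⟨u, hu⟩ := exists_isDualFamily_of_map τ
    choose ε hε using fun χ ψ : Dual k A => (hu.isIndCore hτ.toIsFiberMap ψ χ).exists_equiv
    refine ⟨ε, fun χ => (Psi_trivial_iff ε χ).2 ?_, ?_⟩
    · rw [hε]
      exact (hu.map_one_iff χ).1 (hτ.map_one χ)
    · intro X Y _ _ _ _ ρX ρY χ ψ ω x y
      have hz := tensorAct_mem_weightSpace J.zeroWeight ρY ρX χ y x
      rw [dual_div_mul_div] at hz
      refine ⟨hz, LinearMap.ext fun v => eq_of_contract_eq fun ξ => ?_⟩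
      have h1 := (hu.map_mul_iff fun f hf f' hf' => starMul_mem J χ hf hf').1
        (hτ.map_mul ω ψ χ) ξ v
      have h2 : tensorAct ρY ρX (charIdem (ψ / ω) ⊗ₜ[k] charIdem (χ / ψ))
          ((y : Y) ⊗ₜ[k] (x : X)) = (y : Y) ⊗ₜ[k] (x : X) := by
        rw [tensorAct_tmul, asAlgebraHom_charIdem_apply, asAlgebraHom_charIdem_apply]
      rw [contract_Psi, asAlgebraHom_tprod, ← Module.End.mul_apply, ← map_mul]
      refine (contract_Psi_Psi ε χ ψ ω ρX ρY x y ξ v).trans ?_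
      rw [hε, hε, hε, ← h1, ← mul_assoc, map_mul, Module.End.mul_apply, h2]

end Exchange

/-! ### The twist of a dynamical datum -/

section TwistOfDatum

theorem weightProj_of_ne [Finite G] [CharZero k] {α β : Dual k A} {f : G → k}
    (hf : f ∈ weightFun α) (h : α ≠ β) : weightProj β f = 0 := by
  ext g
  rw [weightProj_apply, evalFun_mul_charIdem_of_ne hf h]
  rfl

theorem exists_evalFun₂_eq [Finite G] (B : (G → k) →ₗ[k] (G → k) →ₗ[k] k) :
    ∃ x : MonoidAlgebra k G ⊗[k] MonoidAlgebra k G, ∀ f f', evalFun₂ f f' x = B f f' := by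
  classical
  have := Fintype.ofFinite G
  refine ⟨∑ g, ∑ h, B (Pi.single g 1) (Pi.single h 1) •
    (MonoidAlgebra.of k G g ⊗ₜ[k] MonoidAlgebra.of k G h), fun f f' => ?_⟩
  have hs : ∀ f : G → k, f = ∑ g, f g • Pi.single g 1 := fun f => by
    conv_lhs => rw [← Finset.univ_sum_single f]
    refine Finset.sum_congr rfl fun g _ => ?_
    rw [← Pi.single_smul, smul_eq_mul, mul_one]
  conv_rhs => rw [hs f, hs f', map_sum B, LinearMap.sum_apply]
  rw [map_sum]
  refine Finset.sum_congr rfl fun g _ => ?_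
  rw [map_sum, map_sum]
  refine Finset.sum_congr rfl fun h _ => ?_
  rw [map_smul, evalFun₂_tmul, evalFun_of, evalFun_of, map_smul, map_smul, LinearMap.smul_apply]
  simp only [smul_eq_mul]
  ring

variable [Finite G] [CharZero k] {V : Dual k A → Type w} [∀ χ, AddCommGroup (V χ)]
  [∀ χ, Module k (V χ)] {K : Subgroup G} {π : ∀ χ, K → V χ ≃ₗ[k] V χ}
  {τ : ∀ χ ψ, (G → k) →ₗ[k] (V ψ →ₗ[k] V χ)}

/-- A fibre map can be rescaled. -/
theorem IsFiberMap.smul (hτ : IsFiberMap K π τ) {c : Dual k A → k} (hc : ∀ χ, c χ ≠ 0) :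
    IsFiberMap K π fun χ ψ => c χ • τ χ ψ where
  equivariant χ ψ h f hf := by
    rw [LinearMap.smul_apply, LinearMap.smul_apply, hτ.equivariant χ ψ h f hf, map_smul]
  injective χ ψ f hf h0 := hτ.injective χ ψ f hf fun g =>
    (smul_eq_zero.1 (h0 g)).resolve_left (hc χ)
  surjective χ ψ T := by
    obtain ⟨f, hf, h⟩ := hτ.surjective χ ψ ((c χ)⁻¹ • T)
    refine ⟨f, ⟨hf.1, fun g hg => ?_⟩, ?_⟩
    · rw [LinearMap.smul_apply, hf.2 g hg, smul_zero]
    · rw [LinearMap.smul_apply, h, smul_smul, mul_inv_cancel₀ (hc χ), one_smul]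

/-- A fibre map can be normalized. -/
theorem IsFiberMap.exists_normalized [∀ χ, Nontrivial (V χ)] (hτ : IsFiberMap K π τ) :
    ∃ τ' : ∀ χ ψ, (G → k) →ₗ[k] (V ψ →ₗ[k] V χ), IsFiberMap K π τ' ∧
      ∀ χ, τ' χ χ 1 = LinearMap.id := by
  -- The identity of V_χ is K-invariant, hence a multiple of τ(1), and the multiplier is nonzero
  -- since V_χ ≠ 0. Rescaling by it keeps a fibre map.
  have key : ∀ χ, ∃ c : k, LinearMap.id = c • τ χ χ 1 := fun χ => by
    obtain ⟨c, -, hc⟩ := hτ.exists_const_of_invariant χ χ LinearMap.id fun h => by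
      ext v
      simp [LinearEquiv.arrowCongr_apply]
    exact ⟨c, hc⟩
  choose c hc using key
  refine ⟨fun χ ψ => c χ • τ χ ψ, hτ.smul fun χ h0 => ?_, fun χ => (hc χ).symm⟩
  have := hc χ
  rw [h0, zero_smul] at this
  exact one_ne_zero (α := Module.End k (V χ)) this

variable [IsAlgClosed k] [IsMulCommutative A]

/-- The values of `J` define products that correspond to the composition of maps. -/
def IsProduct (τ : ∀ χ ψ, (G → k) →ₗ[k] (V ψ →ₗ[k] V χ))
    (J : Dual k A → MonoidAlgebra k G ⊗[k] MonoidAlgebra k G) : Prop :=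
  ∀ χ ψ ω : Dual k A, ∀ f ∈ weightFun (ψ / χ), ∀ f' ∈ weightFun (ω / ψ),
    starMul (J ω) f f' ∈ weightFun (ω / χ) ∧ ∀ g,
      τ χ ω (shift g (starMul (J ω) f f')) = τ χ ψ (shift g f) ∘ₗ τ ψ ω (shift g f')

/-- Pointwise composition of equivariant functions is transported to the spaces F_{ψ-χ}[G]. The
resulting products commute with G, so they are determined by their values at 1, which are bilinear
functionals and hence tensors. -/
theorem IsFiberMap.exists_isProduct (hτ : IsFiberMap K π τ) : ∃ J, IsProduct τ J := by
  classical
  have := Fintype.ofFinite (Dual k A)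
  let m : ∀ χ ψ ω : Dual k A, (G → k) →ₗ[k] (G → k) →ₗ[k] (G → k) := fun χ ψ ω =>
    LinearMap.mk₂ k
      (fun f f' => hτ.coindLift χ ω fun g => τ χ ψ (shift g f) ∘ₗ τ ψ ω (shift g f'))
      (fun f₁ f₂ f' => by
        rw [← map_add]; congr 1; ext1 g
        rw [map_add, map_add, LinearMap.add_comp]; rfl)
      (fun c f f' => by
        rw [← map_smul]; congr 1; ext1 g
        rw [map_smul, map_smul, LinearMap.smul_comp]; rfl)
      (fun f f₁ f₂ => by
        rw [← map_add]; congr 1; ext1 g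
        rw [map_add, map_add, LinearMap.comp_add]; rfl)
      (fun c f f' => by
        rw [← map_smul]; congr 1; ext1 g
        rw [map_smul, map_smul, LinearMap.comp_smul]; rfl)
  have hm_mem : ∀ χ ψ ω f f', m χ ψ ω f f' ∈ weightFun (ω / χ) := fun χ ψ ω f f' =>
    hτ.coindLift_mem _ _ _
  have hm : ∀ χ ψ ω, ∀ f ∈ weightFun (ψ / χ), ∀ f' ∈ weightFun (ω / ψ), ∀ g,
      τ χ ω (shift g (m χ ψ ω f f')) = τ χ ψ (shift g f) ∘ₗ τ ψ ω (shift g f') := by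
    intro χ ψ ω f hf f' hf' g
    refine hτ.map_shift_coindLift χ ω _ (fun h x => ?_) g
    rw [shift_mul, shift_mul, hτ.equivariant _ _ _ _ (shift_mem_weightFun hf _),
      hτ.equivariant _ _ _ _ (shift_mem_weightFun hf' _)]
    exact (LinearEquiv.arrowCongr_comp _ _ _ _ _).symm
  have hshift : ∀ χ ψ ω, ∀ f ∈ weightFun (ψ / χ), ∀ f' ∈ weightFun (ω / ψ), ∀ g,
      m χ ψ ω (shift g f) (shift g f') = shift g (m χ ψ ω f f') := by
    intro χ ψ ω f hf f' hf' g
    refine sub_eq_zero.1 (hτ.injective χ ω _ (Submodule.sub_mem _ (hm_mem _ _ _ _ _)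
      (shift_mem_weightFun (hm_mem _ _ _ _ _) g)) fun x => ?_)
    rw [map_sub, map_sub, hm _ _ _ _ (shift_mem_weightFun hf _) _ (shift_mem_weightFun hf' _),
      ← shift_mul, ← shift_mul, ← shift_mul, hm _ _ _ _ hf _ hf', sub_self]
  -- For fixed ω the pair (χ, ψ) can be read off from the weights ψ-χ and ω-ψ, so all bilinear forms
  -- fit into one tensor J(ω).
  choose J hJ using fun ω : Dual k A => exists_evalFun₂_eq
    (∑ χ : Dual k A, ∑ ψ : Dual k A, ((m χ ψ ω).compl₁₂ (weightProj (ψ / χ))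
      (weightProj (ω / ψ))).compr₂ (LinearMap.proj (1 : G)))
  have key : ∀ χ ψ ω, ∀ f ∈ weightFun (ψ / χ), ∀ f' ∈ weightFun (ω / ψ),
      evalFun₂ f f' (J ω) = m χ ψ ω f f' 1 := by
    intro χ ψ ω f hf f' hf'
    have hzero : ∀ χ' ψ' : Dual k A, ψ' ≠ ψ ∨ χ' ≠ χ →
        m χ' ψ' ω (weightProj (ψ' / χ') f) (weightProj (ω / ψ') f') 1 = 0 := by
      intro χ' ψ' hne
      by_cases hψ : ψ' = ψ
      · have hχ := hne.resolve_left (not_not.2 hψ)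
        rw [weightProj_of_ne hf (β := ψ' / χ'), map_zero, LinearMap.zero_apply, Pi.zero_apply]
        intro h
        rw [hψ] at h
        exact hχ (div_right_injective (b := ψ) h).symm
      · rw [weightProj_of_ne hf' (β := ω / ψ'), map_zero, Pi.zero_apply]
        exact fun h => hψ (div_right_injective (b := ω) h).symm
    rw [hJ]
    simp only [LinearMap.sum_apply, LinearMap.compr₂_apply, LinearMap.compl₁₂_apply,
      LinearMap.proj_apply]
    rw [Finset.sum_eq_single χ, Finset.sum_eq_single ψ, weightProj_of_mem hf,
      weightProj_of_mem hf']
    · exact fun ψ' _ h => hzero χ ψ' (Or.inl h)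
    · simp
    · exact fun χ' _ h => Finset.sum_eq_zero fun ψ' _ => hzero χ' ψ' (Or.inr h)
    · simp
  refine ⟨J, fun χ ψ ω f hf f' hf' => ?_⟩
  have h1 : starMul (J ω) f f' = m χ ψ ω f f' := by
    ext g
    rw [starMul_eq_evalFun₂_shift, key χ ψ ω _ (shift_mem_weightFun hf _) _
      (shift_mem_weightFun hf' _), hshift _ _ _ _ hf _ hf', shift_apply, inv_inv, mul_one]
  rw [h1]
  exact ⟨hm_mem _ _ _ _ _, hm _ _ _ _ hf _ hf'⟩

namespace IsProduct

variable {J : Dual k A → MonoidAlgebra k G ⊗[k] MonoidAlgebra k G} (hJ : IsProduct τ J)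
  (hτ : IsFiberMap K π τ) (hone : ∀ χ, τ χ χ 1 = LinearMap.id)

include hJ

theorem zeroWeight : ZeroWeight₂ J := by
  intro ω a
  refine evalFun₂_ext_weight (A := A) fun α β f hf f' hf' => ?_
  rw [evalFun₂_mul_of hf hf']
  obtain ⟨ψ, rfl⟩ : ∃ ψ, β = ω / ψ := ⟨ω / β, (dual_div_div_cancel ω β).symm⟩
  obtain ⟨χ, rfl⟩ : ∃ χ, α = ψ / χ := ⟨ψ / α, (dual_div_div_cancel ψ α).symm⟩
  have h1 := (hJ _ _ _ f hf f' hf').1 1 a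
  rw [one_mul, starMul_eq_evalFun₂_shift _ _ _ 1, inv_one, shift_one, shift_one] at h1
  rw [dual_div_mul_div, mul_comm (((ω / χ) a : kˣ) : k)]
  exact h1

include hτ

/-- Composition of linear maps is associative, and τ together with its translates is injective. The
dynamical equation and the counit conditions follow in this way. -/
theorem assoc {ω ψ : Dual k A} (f₁ f₂ : G → k) {f₃ : G → k} {α β : Dual k A}
    (h₁ : f₁ ∈ weightFun α) (h₂ : f₂ ∈ weightFun β) (h₃ : f₃ ∈ weightFun (ω / ψ)) :
    starMul (J ω) (starMul (J ψ) f₁ f₂) f₃ = starMul (J ω) f₁ (starMul (J ω) f₂ f₃) := by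
  obtain ⟨χ, rfl⟩ : ∃ χ, β = ψ / χ := ⟨ψ / β, (dual_div_div_cancel ψ β).symm⟩
  obtain ⟨θ, rfl⟩ : ∃ θ, α = χ / θ := ⟨χ / α, (dual_div_div_cancel χ α).symm⟩
  obtain ⟨m12, e12⟩ := hJ _ _ _ _ h₁ _ h₂
  obtain ⟨m23, e23⟩ := hJ _ _ _ _ h₂ _ h₃
  obtain ⟨ml, el⟩ := hJ _ _ _ _ m12 _ h₃
  obtain ⟨mr, er⟩ := hJ _ _ _ _ h₁ _ m23
  refine sub_eq_zero.1 (hτ.injective θ ω _ (Submodule.sub_mem _ ml mr) fun x => ?_)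
  rw [map_sub, map_sub, el, er, e12, e23, LinearMap.comp_assoc, sub_self]

theorem dynamical (χ : Dual k A) :
    Algebra.TensorProduct.assoc k k k
        (MonoidAlgebra k G) (MonoidAlgebra k G) (MonoidAlgebra k G)
        (Algebra.TensorProduct.map (Bialgebra.comulAlgHom k (MonoidAlgebra k G))
            (AlgHom.id k (MonoidAlgebra k G)) (J χ) * shiftByWeight J χ) =
      Algebra.TensorProduct.map (AlgHom.id k (MonoidAlgebra k G))
          (Bialgebra.comulAlgHom k (MonoidAlgebra k G)) (J χ) *
        ((1 : MonoidAlgebra k G) ⊗ₜ[k] J χ) := by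
  refine evalFun₃_ext_weight (A := A) fun α β γ f₁ h₁ f₂ h₂ f₃ h₃ => ?_
  obtain ⟨ψ, rfl⟩ : ∃ ψ, γ = χ / ψ := ⟨χ / γ, (dual_div_div_cancel χ γ).symm⟩
  rw [evalFun₃_mul_shiftByWeight _ _ _ _ _ h₃, dual_div_div_cancel, evalFun₃_leftTriple]
  refine Eq.trans ?_ (evalFun₃_rightTriple (J χ) (J χ) f₁ f₂ f₃).symm
  have h := congrFun (hJ.assoc hτ f₁ f₂ h₁ h₂ h₃) 1
  rwa [starMul_eq_evalFun₂_shift, starMul_eq_evalFun₂_shift, inv_one, shift_one, shift_one,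
    shift_one, shift_one] at h

include hone

theorem one_starMul (ω : Dual k A) (f : G → k) : starMul (J ω) 1 f = f := by
  have := Fintype.ofFinite (Dual k A)
  conv_lhs => rw [← sum_weightProj (A := A) f]
  conv_rhs => rw [← sum_weightProj (A := A) f]
  rw [starMul_sum_right]
  refine Finset.sum_congr rfl fun β _ => ?_
  have hf := weightProj_mem β f
  obtain ⟨ψ, rfl⟩ : ∃ ψ, β = ω / ψ := ⟨ω / β, (dual_div_div_cancel ω β).symm⟩
  obtain ⟨h1, h2⟩ := hJ ψ ψ ω 1 (one_mem_weightFun_div ψ) _ hf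
  refine sub_eq_zero.1 (hτ.injective ψ ω _ (Submodule.sub_mem _ h1 hf) fun x => ?_)
  rw [map_sub, map_sub, h2, shift_const, hone, LinearMap.id_comp, sub_self]

theorem starMul_one (ω : Dual k A) (f : G → k) : starMul (J ω) f 1 = f := by
  have := Fintype.ofFinite (Dual k A)
  conv_lhs => rw [← sum_weightProj (A := A) f]
  conv_rhs => rw [← sum_weightProj (A := A) f]
  rw [starMul_sum_left]
  refine Finset.sum_congr rfl fun β _ => ?_
  have hf := weightProj_mem β f
  obtain ⟨ψ, rfl⟩ : ∃ ψ, β = ω / ψ := ⟨ω / β, (dual_div_div_cancel ω β).symm⟩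
  obtain ⟨h1, h2⟩ := hJ ψ ω ω _ hf 1 (one_mem_weightFun_div ω)
  refine sub_eq_zero.1 (hτ.injective ψ ω _ (Submodule.sub_mem _ h1 hf) fun x => ?_)
  rw [map_sub, map_sub, h2, shift_const, hone, LinearMap.comp_id, sub_self]

theorem counit_left (χ : Dual k A) :
    Algebra.TensorProduct.lid k (MonoidAlgebra k G)
      (Algebra.TensorProduct.map (Bialgebra.counitAlgHom k (MonoidAlgebra k G))
        (AlgHom.id k (MonoidAlgebra k G)) (J χ)) = 1 := by
  refine evalFun_ext fun f => ?_
  have h := congrFun (hJ.one_starMul hτ hone χ f) 1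
  rw [starMul_eq_evalFun₂_shift, inv_one, shift_one, shift_one, evalFun₂_one_left] at h
  rw [h, ← map_one (MonoidAlgebra.of k G), evalFun_of]

theorem counit_right (χ : Dual k A) :
    Algebra.TensorProduct.rid k k (MonoidAlgebra k G)
      (Algebra.TensorProduct.map (AlgHom.id k (MonoidAlgebra k G))
        (Bialgebra.counitAlgHom k (MonoidAlgebra k G)) (J χ)) = 1 := by
  refine evalFun_ext fun f => ?_
  have h := congrFun (hJ.starMul_one hτ hone χ f) 1
  rw [starMul_eq_evalFun₂_shift, inv_one, shift_one, shift_one, evalFun₂_one_right] at h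
  rw [h, ← map_one (MonoidAlgebra.of k G), evalFun_of]

end IsProduct

end TwistOfDatum

/-! ### Invertibility of the twist built from a datum. -/

section TwistUnit

variable [Finite G] [CharZero k] [IsAlgClosed k] [IsMulCommutative A]

theorem IsProduct.map_mul {V : Dual k A → Type w} [∀ χ, AddCommGroup (V χ)]
    [∀ χ, Module k (V χ)] {τ : ∀ χ ψ, (G → k) →ₗ[k] (V ψ →ₗ[k] V χ)}
    {J : Dual k A → MonoidAlgebra k G ⊗[k] MonoidAlgebra k G} (hJ : IsProduct τ J)
    {χ ψ ω : Dual k A} {f f' : G → k} (hf : f ∈ weightFun (ψ / χ)) (hf' : f' ∈ weightFun (ω / ψ)) :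
    τ χ ω (starMul (J ω) f f') = τ χ ψ f ∘ₗ τ ψ ω f' := by
  have := (hJ χ ψ ω f hf f' hf').2 1
  rwa [shift_one, shift_one, shift_one] at this

/-- The exchange relations for all intermediate ψ are summed. The summands have different weights in
the last factor, so no idempotents are needed. -/
theorem IsProduct.comul_mul {V : Dual k A → Type w} [∀ χ, AddCommGroup (V χ)]
    [∀ χ, Module k (V χ)] [∀ χ, Module.Finite k (V χ)]
    {τ : ∀ χ ψ, (G → k) →ₗ[k] (V ψ →ₗ[k] V χ)}
    {J : Dual k A → MonoidAlgebra k G ⊗[k] MonoidAlgebra k G} (hJ : IsProduct τ J)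
    {u : ∀ χ ψ, (V χ →ₗ[k] V ψ) →ₗ[k] MonoidAlgebra k G} (hu : IsDualFamily τ u)
    [Fintype (Dual k A)] (χ ω : Dual k A) (ξ : V χ →ₗ[k] k) (v : V ω) :
    Bialgebra.comulAlgHom k (MonoidAlgebra k G) (u χ ω (ξ.smulRight v)) * J ω =
      ∑ ψ, ∑ i, u χ ψ (ξ.smulRight (Module.finBasis k (V ψ) i)) ⊗ₜ[k]
        u ψ ω (((Module.finBasis k (V ψ)).coord i).smulRight v) := by
  refine evalFun₂_ext_weight (A := A) fun α β f hf f' hf' => ?_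
  obtain ⟨ψ₀, rfl⟩ : ∃ ψ, β = ω / ψ := ⟨ω / β, (dual_div_div_cancel ω β).symm⟩
  obtain ⟨χ₀, rfl⟩ : ∃ χ, α = ψ₀ / χ := ⟨ψ₀ / α, (dual_div_div_cancel ψ₀ α).symm⟩
  have hne : ∀ ψ, ψ ≠ ψ₀ → evalFun₂ f f' (∑ i,
      u χ ψ (ξ.smulRight (Module.finBasis k (V ψ) i)) ⊗ₜ[k]
        u ψ ω (((Module.finBasis k (V ψ)).coord i).smulRight v)) = 0 := by
    intro ψ hψ
    rw [map_sum]
    refine Finset.sum_eq_zero fun i _ => ?_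
    rw [evalFun₂_tmul, ← hu.mul_charIdem ψ ω, evalFun_mul_charIdem_of_ne hf', mul_zero]
    exact fun h => hψ (div_right_injective (b := ω) h).symm
  rw [evalFun₂_comul, map_sum, Finset.sum_eq_single ψ₀ (fun ψ _ h => hne ψ h) (by simp)]
  by_cases hχ : χ₀ = χ
  · subst hχ
    rw [← hu.pairing _ _ _ (hJ _ _ _ f hf f' hf').1, hJ.map_mul hf hf', LinearMap.comp_apply,
      hu.comp_eq hf hf']
  · rw [← hu.mul_charIdem χ ω, evalFun_mul_charIdem_of_ne (hJ _ _ _ f hf f' hf').1, map_sum,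
      Finset.sum_eq_zero]
    · intro i _
      rw [evalFun₂_tmul, ← hu.mul_charIdem χ ψ₀, evalFun_mul_charIdem_of_ne hf, zero_mul]
      exact fun h => hχ (div_right_injective (b := ψ₀) h)
    · exact fun h => hχ (div_right_injective (b := ω) h)

variable {𝒱 : ProjectiveFamily k A}
  {τ : ∀ χ ψ, (G → k) →ₗ[k] (𝒱.V ψ →ₗ[k] 𝒱.V χ)}
  {u : ∀ χ ψ, (𝒱.V χ →ₗ[k] 𝒱.V ψ) →ₗ[k] MonoidAlgebra k G}

/-- Dual form of a spanning statement: for fixed ψ the elements g u_{χψ}(T) span k[G], as they span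
each summand k[G] P_{ψ-χ}. -/
theorem functional_eq_zero
    (hu : ∀ χ ψ : Dual k A, IsIndCore (𝒱.homRep ψ χ) (ψ / χ) (u χ ψ)) (ψ : Dual k A)
    (φ : MonoidAlgebra k G →ₗ[k] k)
    (h : ∀ χ g T, φ (MonoidAlgebra.of k G g * u χ ψ T) = 0) : φ = 0 := by
  have := Fintype.ofFinite (Dual k A)
  have hφ : ∀ x, evalFun (fun g => φ (MonoidAlgebra.of k G g)) x = φ x := evalFun_of_functional φ
  have h0 : (fun g => φ (MonoidAlgebra.of k G g)) = 0 := by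
    rw [← sum_weightProj (A := A) fun g => φ (MonoidAlgebra.of k G g)]
    refine Finset.sum_eq_zero fun α _ => ?_
    obtain ⟨χ, rfl⟩ : ∃ χ, α = ψ / χ := ⟨ψ / α, (dual_div_div_cancel ψ α).symm⟩
    refine (hu χ ψ).injective _ (weightProj_mem _ _) fun g T => ?_
    rw [evalFun_weightProj, mul_assoc, (hu χ ψ).mul_charIdem, hφ, h]
  ext g
  exact congrFun h0 g

/-- In Δ(u_{χω}(v ⊗ ξ)) J(ω) all intermediate ψ and all basis vectors occur together. Left
multiplication by x ⊗ 1 with x ∈ K, and a suitable change of ξ, applies π_ψ(x) to the basis vectors;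
Schur orthogonality combines these into a single pure tensor. -/
theorem IsProduct.mul_tmul_mem {J : Dual k A → MonoidAlgebra k G ⊗[k] MonoidAlgebra k G}
    (hJ : IsProduct τ J) (hτ : IsFiberMap 𝒱.K 𝒱.π τ) (hone : ∀ χ, τ χ χ 1 = LinearMap.id)
    (hu : IsDualFamily τ u) (χ ψ ω : Dual k A) (ξ : 𝒱.V χ →ₗ[k] k) (w : 𝒱.V ψ)
    (η : 𝒱.V ψ →ₗ[k] k) (v : 𝒱.V ω) :
    u χ ψ (ξ.smulRight w) ⊗ₜ[k] u ψ ω (η.smulRight v) ∈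
      LinearMap.range (LinearMap.mulRight k (J ω)) := by
  have := Fintype.ofFinite (Dual k A)
  have := Fintype.ofFinite 𝒱.K
  obtain ⟨a, ha, ha'⟩ := hτ.exists_orthogonality hone ψ η w
  simp only [finsum_eq_sum_of_fintype] at ha ha'
  have hlin : ∀ (ψ' : Dual k A) (b : 𝒱.V ψ') (c : MonoidAlgebra k G),
      ∑ x, a x • (u χ ψ' (ξ.smulRight (𝒱.π ψ' x b)) ⊗ₜ[k] c) =
        u χ ψ' (ξ.smulRight (∑ x, a x • 𝒱.π ψ' x b)) ⊗ₜ[k] c := by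
    intro ψ' b c
    change _ = (u χ ψ' ∘ₗ LinearMap.smulRightₗ ξ) _ ⊗ₜ[k] c
    rw [map_sum, TensorProduct.sum_tmul]
    refine Finset.sum_congr rfl fun x _ => ?_
    rw [map_smul, TensorProduct.smul_tmul']
    rfl
  have hx : ∀ x : 𝒱.K, (MonoidAlgebra.of k G (x : G) ⊗ₜ[k] (1 : MonoidAlgebra k G)) *
      (Bialgebra.comulAlgHom k (MonoidAlgebra k G)
        (u χ ω ((ξ ∘ₗ (𝒱.π χ x).toLinearMap).smulRight v)) * J ω) =
      ∑ ψ', ∑ i, u χ ψ' (ξ.smulRight (𝒱.π ψ' x (Module.finBasis k (𝒱.V ψ') i))) ⊗ₜ[k]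
        u ψ' ω (((Module.finBasis k (𝒱.V ψ')).coord i).smulRight v) := by
    intro x
    rw [hJ.comul_mul hu, Finset.mul_sum]
    refine Finset.sum_congr rfl fun ψ' _ => ?_
    rw [Finset.mul_sum]
    refine Finset.sum_congr rfl fun i _ => ?_
    rw [Algebra.TensorProduct.tmul_mul_tmul, one_mul, ← (hu.isIndCore hτ χ ψ').equivariant,
      homRep_smulRight]
    congr 3
    ext w
    simp
  -- The coefficients a make ∑ a(x) π(x) the rank one operator w ⊗ η on V_ψ and zero on the other
  -- V_{ψ'}.
  have hmem : ∑ x, a x • ((MonoidAlgebra.of k G (x : G) ⊗ₜ[k] (1 : MonoidAlgebra k G)) *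
      (Bialgebra.comulAlgHom k (MonoidAlgebra k G)
        (u χ ω ((ξ ∘ₗ (𝒱.π χ x).toLinearMap).smulRight v)) * J ω)) ∈
      LinearMap.range (LinearMap.mulRight k (J ω)) := by
    refine Submodule.sum_mem _ fun x _ => Submodule.smul_mem _ _ ?_
    rw [← mul_assoc]
    exact ⟨_, rfl⟩
  convert hmem using 1
  simp only [hx, Finset.smul_sum]
  rw [Finset.sum_comm, Finset.sum_eq_single ψ, Finset.sum_comm]
  · simp only [hlin, ha]
    rw [smulRight_eq_sum_coord η v, map_sum, TensorProduct.tmul_sum]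
    refine Finset.sum_congr rfl fun i _ => ?_
    have : ξ.smulRight (η (Module.finBasis k (𝒱.V ψ) i) • w) =
        η (Module.finBasis k (𝒱.V ψ) i) • ξ.smulRight w := by
      ext z
      exact smul_comm _ _ _
    rw [this, map_smul, map_smul, TensorProduct.smul_tmul]
  · intro ψ' _ hψ'
    rw [Finset.sum_comm]
    refine Finset.sum_eq_zero fun i _ => ?_
    rw [hlin, ha' ψ' hψ']
    simp
  · simp

/-- The left ideal generated by J(ω) contains the tensors of `mul_tmul_mem` and their translates,
which span. Finite dimension makes the resulting left inverse two-sided. -/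
theorem IsProduct.isUnit {J : Dual k A → MonoidAlgebra k G ⊗[k] MonoidAlgebra k G}
    (hJ : IsProduct τ J) (hτ : IsFiberMap 𝒱.K 𝒱.π τ) (hone : ∀ χ, τ χ χ 1 = LinearMap.id)
    (ω : Dual k A) : IsUnit (J ω) := by
  obtain ⟨u, hu⟩ := exists_isDualFamily_of_map τ
  have hcore := hu.isIndCore hτ
  have hmem : ∀ (χ ψ : Dual k A) g h T S, (MonoidAlgebra.of k G g * u χ ψ T) ⊗ₜ[k]
      (MonoidAlgebra.of k G h * u ψ ω S) ∈ LinearMap.range (LinearMap.mulRight k (J ω)) := by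
    intro χ ψ g h T S
    have h1 : u χ ψ T ⊗ₜ[k] u ψ ω S ∈ LinearMap.range (LinearMap.mulRight k (J ω)) := by
      refine mem_of_smulRight_mem ((LinearMap.range (LinearMap.mulRight k (J ω))).comap
        ((TensorProduct.mk k (MonoidAlgebra k G) (MonoidAlgebra k G)).flip (u ψ ω S) ∘ₗ u χ ψ))
        (fun ξ w => ?_) T
      refine mem_of_smulRight_mem ((LinearMap.range (LinearMap.mulRight k (J ω))).comap
        (TensorProduct.mk k (MonoidAlgebra k G) (MonoidAlgebra k G) (u χ ψ (ξ.smulRight w)) ∘ₗ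
          u ψ ω)) (fun η v => ?_) S
      exact hJ.mul_tmul_mem hτ hone hu χ ψ ω ξ w η v
    obtain ⟨y, hy⟩ := h1
    refine ⟨(MonoidAlgebra.of k G g ⊗ₜ[k] MonoidAlgebra.of k G h) * y, ?_⟩
    rw [← Algebra.TensorProduct.tmul_mul_tmul, ← hy]
    exact mul_assoc _ _ _
  have htop : LinearMap.range (LinearMap.mulRight k (J ω)) = ⊤ := by
    by_contra hne
    obtain ⟨Λ, hΛ, hle⟩ := Submodule.exists_le_ker_of_lt_top _ (lt_top_iff_ne_top.2 hne)
    refine hΛ (TensorProduct.ext' fun a b => ?_)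
    have h1 : ∀ (ψ : Dual k A) h S a, Λ (a ⊗ₜ[k] (MonoidAlgebra.of k G h * u ψ ω S)) = 0 :=
      fun ψ h S a => LinearMap.congr_fun (functional_eq_zero hcore ψ
        (Λ ∘ₗ (TensorProduct.mk k (MonoidAlgebra k G) (MonoidAlgebra k G)).flip
          (MonoidAlgebra.of k G h * u ψ ω S)) fun χ g T => hle (hmem χ ψ g h T S)) a
    exact LinearMap.congr_fun (functional_eq_zero hcore ω
      (Λ ∘ₗ TensorProduct.mk k (MonoidAlgebra k G) (MonoidAlgebra k G) a)
      fun ψ h S => h1 ψ h S a) b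
  have hfin : Module.Finite k (MonoidAlgebra k G) :=
    Module.Finite.equiv (MonoidAlgebra.coeffLinearEquiv k).symm
  have hsurj := LinearMap.range_eq_top.1 htop
  have hinj := LinearMap.injective_iff_surjective.2 hsurj
  obtain ⟨y, hy⟩ := hsurj 1
  rw [LinearMap.mulRight_apply] at hy
  refine ⟨⟨J ω, y, hinj ?_, hy⟩, rfl⟩
  rw [LinearMap.mulRight_apply, LinearMap.mulRight_apply, mul_assoc, hy, mul_one, one_mul]

/-- Every dynamical datum carries a fibre representation of some dynamical twist. -/
theorem exists_twist_hasFiberRep (𝒟 : DynamicalDatum k A) :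
    ∃ J : DynamicalTwist k A, HasFiberRep J 𝒟 := by
  let ε : IndIsos 𝒟 := fun χ ψ => (𝒟.ind_iso χ ψ).some
  have hcore : ∀ χ ψ : Dual k A, IsIndCore (𝒟.homRep ψ χ) (ψ / χ) (indCore (ε ψ χ)) :=
    fun χ ψ => isIndCore_indCore (ε ψ χ)
  obtain ⟨τ₀, hτ₀⟩ := exists_isDualFamily_of_core (fun χ ψ : Dual k A => indCore (ε ψ χ))
    fun χ ψ => (hcore χ ψ).mul_charIdem
  obtain ⟨τ, hτ, hone⟩ := (hτ₀.isFiberMap hcore).exists_normalized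
  obtain ⟨J, hJ⟩ := hτ.exists_isProduct
  exact ⟨{ J := J
           zeroWeight := hJ.zeroWeight
           isUnit := hJ.isUnit hτ hone
           dynamical := hJ.dynamical hτ
           counit_left := hJ.counit_left hτ hone
           counit_right := hJ.counit_right hτ hone }, τ,
    { hτ with
      map_one := hone
      map_mul := fun χ ψ ω f hf f' hf' => hJ.map_mul hf hf' }⟩

end TwistUnit

/-! ### The datum of a dynamical twist -/

section DatumOfTwist

theorem weightFun_div_self (χ : Dual k A) : weightFun (χ / χ) = weightFun (1 : Dual k A) := by
  rw [dual_div_self]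

/-! ### The minimal ideals cut out by a fibre representation. -/

section Ideals

variable [Finite G] [CharZero k] {V : Dual k A → Type w} [∀ χ, AddCommGroup (V χ)]
  [∀ χ, Module k (V χ)] [∀ χ, Nontrivial (V χ)] {J : DynamicalTwist k A} {K : Subgroup G}
  {π : ∀ χ, K → V χ ≃ₗ[k] V χ}
  {τ : ∀ χ ψ, (G → k) →ₗ[k] (V ψ →ₗ[k] V χ)} (hτ : IsFiberRep J.J K π τ)

include hτ

namespace IsFiberRep

theorem isTwoSidedIdeal_fiberSupport (χ : Dual k A) :
    IsTwoSidedIdeal J χ (fiberSupport K τ χ χ) := by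
  refine ⟨fun f hf => ?_, fun f hf x hx => ?_⟩
  · rw [← weightFun_div_self χ]
    exact hf.1
  · rw [← weightFun_div_self χ] at hf
    exact ⟨hτ.starMul_mem_support_right hf hx, hτ.starMul_mem_support_left hx hf⟩

theorem lift_id_ne_zero (χ : Dual k A) : hτ.lift χ χ LinearMap.id ≠ 0 := by
  intro h
  have := hτ.map_lift χ χ LinearMap.id
  rw [h, map_zero] at this
  exact zero_ne_one (α := Module.End k (V χ)) this

/-- The lift is an isomorphism of End V_χ onto the support ideal, compatible with multiplication by
B_χ, and a matrix algebra is simple. -/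
theorem isMinimalIdeal_fiberSupport [∀ χ, Module.Finite k (V χ)] (χ : Dual k A) :
    IsMinimalIdeal J χ (fiberSupport K τ χ χ) := by
  refine ⟨⟨hτ.isTwoSidedIdeal_fiberSupport χ, fun h => hτ.lift_id_ne_zero χ ?_⟩, ?_⟩
  · have := hτ.lift_mem_support χ χ LinearMap.id
    rwa [h, Submodule.mem_bot] at this
  · rintro I ⟨hI, hne⟩ hle f hf
    obtain ⟨x, hx, hx0⟩ := Submodule.exists_mem_ne_zero_of_ne_bot hne
    have hT : τ χ χ x ≠ 0 := fun h => hx0 (hτ.eq_zero_of_mem_support (hle hx) h)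
    have key := mem_of_sandwich_mem hT (I.comap (hτ.lift χ χ)) (fun a b => ?_) (τ χ χ f)
    · rwa [Submodule.mem_comap, hτ.lift_map hf] at key
    · have ha := hτ.lift_mem χ χ a
      have hb := hτ.lift_mem χ χ b
      rw [weightFun_div_self] at ha hb
      have h1 := (hI.2 _ ha _ (hI.2 _ hb x hx).2).1
      rw [← hτ.lift_map (hle hx), hτ.lift_starMul_lift, hτ.lift_starMul_lift] at h1
      exact h1

/-- If τ(f) ≠ 0, then f * e with e the unit of the support ideal is a nonzero element of both
minimal ideals, so they coincide. -/
theorem eq_fiberSupport_of_ne_zero [∀ χ, Module.Finite k (V χ)] {χ : Dual k A}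
    {I : Submodule k (G → k)} (hI : IsMinimalIdeal J χ I) {f : G → k} (hf : f ∈ I)
    (h0 : τ χ χ f ≠ 0) : I = fiberSupport K τ χ χ := by
  have hmin := hτ.isMinimalIdeal_fiberSupport χ
  have hinf : IsTwoSidedIdeal J χ (I ⊓ fiberSupport K τ χ χ) ∧ I ⊓ fiberSupport K τ χ χ ≠ ⊥ := by
    refine ⟨⟨inf_le_left.trans hI.prop.1.1, fun f hf x hx => ⟨⟨?_, ?_⟩, ?_, ?_⟩⟩, fun hbot => h0 ?_⟩
    · exact (hI.prop.1.2 f hf x hx.1).1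
    · exact (hmin.prop.1.2 f hf x hx.2).1
    · exact (hI.prop.1.2 f hf x hx.1).2
    · exact (hmin.prop.1.2 f hf x hx.2).2
    · have hid := hτ.lift_mem χ χ LinearMap.id
      have hf' := hI.prop.1.1 hf
      rw [← weightFun_div_self χ] at hf'
      have hm := hτ.starMul_mem_support_right hf' (hτ.lift_mem_support χ χ LinearMap.id)
      rw [weightFun_div_self] at hid
      have h1 : starMul (J.J χ) f (hτ.lift χ χ LinearMap.id) ∈ I ⊓ fiberSupport K τ χ χ :=
        ⟨(hI.prop.1.2 _ hid f hf).2, hm⟩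
      rw [hbot, Submodule.mem_bot, hτ.starMul_lift hf'] at h1
      have h2 := congrArg (τ χ χ) h1
      rwa [hτ.map_lift, map_zero, LinearMap.comp_id] at h2
  exact le_antisymm ((hI.le_of_le hinf inf_le_left).trans inf_le_right)
    ((hmin.le_of_le hinf inf_le_right).trans inf_le_left)

theorem blockBimodule_le (χ ψ : Dual k A) :
    blockBimodule J (fun χ => fiberSupport K τ χ χ) χ ψ ≤ fiberSupport K τ χ ψ := by
  refine Submodule.span_le.2 ?_
  rintro _ ⟨f, hf, x, hx, f', hf', rfl⟩
  exact hτ.starMul_mem_support_right (starMul_mem J ψ hf.1 hx) hf'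

/-- Multiplication by the units of the two support ideals does not change a lift, and every product
in the block is supported on K. -/
theorem range_lift (χ ψ : Dual k A) : LinearMap.range (hτ.lift χ ψ) =
    blockBimodule J (fun χ => fiberSupport K τ χ χ) χ ψ := by
  apply le_antisymm
  · rintro _ ⟨T, rfl⟩
    refine Submodule.subset_span ⟨_, hτ.lift_mem_support χ χ LinearMap.id, _, hτ.lift_mem χ ψ T, _,
      hτ.lift_mem_support ψ ψ LinearMap.id, ?_⟩
    rw [hτ.lift_starMul_lift, hτ.lift_starMul_lift, LinearMap.id_comp, LinearMap.comp_id]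
  · intro f hf
    exact ⟨τ χ ψ f, hτ.lift_map (hτ.blockBimodule_le χ ψ hf)⟩

theorem lift_injective (χ ψ : Dual k A) : Function.Injective (hτ.lift χ ψ) :=
  Function.LeftInverse.injective (g := τ χ ψ) (hτ.map_lift χ ψ)

/-- For g outside K the translate of the unit of the ideal is killed by τ. If it lay in the ideal,
it would vanish. -/
theorem mem_iff_map_fiberSupport (χ : Dual k A) (g : G) :
    g ∈ K ↔ (fiberSupport K τ χ χ).map (shift g) = fiberSupport K τ χ χ := by
  constructor
  · intro hg
    apply le_antisymm
    · rintro _ ⟨f, hf, rfl⟩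
      exact hτ.shift_mem_support hf ⟨g, hg⟩
    · intro f hf
      refine ⟨shift g⁻¹ f, hτ.shift_mem_support hf ⟨g, hg⟩⁻¹, ?_⟩
      rw [← shift_mul, mul_inv_cancel, shift_one]
  · intro h
    by_contra hg
    have h1 : shift g (hτ.lift χ χ LinearMap.id) ∈ fiberSupport K τ χ χ := by
      rw [← h]
      exact ⟨_, hτ.lift_mem_support χ χ LinearMap.id, rfl⟩
    have h2 := hτ.eq_zero_of_mem_support h1 (hτ.map_shift_lift_of_notMem χ χ _ hg)
    refine hτ.lift_id_ne_zero χ ?_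
    rw [← shift_one (hτ.lift χ χ LinearMap.id), ← inv_mul_cancel g, shift_mul, h2, map_zero]

theorem eq_bot_or_eq_top_of_stable (χ : Dual k A) (W : Submodule k (V χ))
    (hW : ∀ f ∈ weightFun (χ / χ), ∀ x ∈ W, τ χ χ f x ∈ W) : W = ⊥ ∨ W = ⊤ := by
  by_cases hbot : W = ⊥
  · exact Or.inl hbot
  · right
    obtain ⟨x, hx, hx0⟩ := Submodule.exists_mem_ne_zero_of_ne_bot hbot
    refine eq_top_iff.2 fun y _ => ?_
    obtain ⟨T, hT⟩ := exists_linearMap_apply_eq (k := k) hx0 y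
    have := hW _ (hτ.lift_mem χ χ T) x hx
    rwa [hτ.map_lift, hT] at this

/-- The translates of a fibre representation. -/
theorem exists_shift (g : G) : ∃ (K' : Subgroup G) (π' : ∀ χ, K' → V χ ≃ₗ[k] V χ),
    IsFiberRep J.J K' π' fun χ ψ => τ χ ψ ∘ₗ shift g := by
  refine ⟨K.comap (MulAut.conj g).toMonoidHom, fun χ h => π χ ⟨g * h * g⁻¹, h.2⟩, ?_⟩
  have hK : ∀ h : G, h ∈ K ↔ g⁻¹ * h * g⁻¹⁻¹ ∈ K.comap (MulAut.conj g).toMonoidHom := fun h => by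
    simp [mul_assoc]
  have := hτ.transport (π' := fun χ (h : K.comap (MulAut.conj g).toMonoidHom) =>
    π χ ⟨g * h * g⁻¹, h.2⟩) g⁻¹ hK (fun χ => LinearEquiv.refl k (V χ)) fun χ ψ h T => by
      have hh : (⟨g * (g⁻¹ * (h : G) * g⁻¹⁻¹) * g⁻¹, (hK h).1 h.2⟩ : K) = h :=
        Subtype.ext (by simp [mul_assoc])
      rw [hh]
      rfl
  rw [inv_inv] at this
  exact this

end IsFiberRep

end Ideals

/-- The minimal ideals are the support ideals, the module structures are the maps τ_{χχ}, and the
bimodule isomorphisms are the lifts. -/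
theorem HasFiberRep.isDatumOf [Finite G] [CharZero k] {J : DynamicalTwist k A}
    {𝒟 : DynamicalDatum k A} (h : HasFiberRep J 𝒟) : IsDatumOf J 𝒟 := by
  obtain ⟨τ, hτ⟩ := h
  have hw : ∀ (χ : Dual k A) (f : weightFun (1 : Dual k A)), (f : G → k) ∈ weightFun (χ / χ) :=
    fun χ f => by
      rw [weightFun_div_self]
      exact f.2
  refine ⟨fun χ => fiberSupport 𝒟.K τ χ χ, fun χ => τ χ χ ∘ₗ (weightFun 1).subtype,
    fun χ ψ => hτ.lift χ ψ, hτ.isMinimalIdeal_fiberSupport, fun χ ψ => ?_,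
    hτ.mem_iff_map_fiberSupport, fun χ => ⟨⟨?_, ?_⟩, inferInstance, ?_, ?_⟩, ?_, fun χ ψ =>
      ⟨hτ.lift_injective χ ψ, hτ.range_lift χ ψ⟩, ?_, ?_, ?_⟩
  · rw [← hτ.range_lift, Ne, LinearMap.range_eq_bot]
    intro h
    obtain ⟨v, hv⟩ := exists_ne (0 : 𝒟.V ψ)
    obtain ⟨w, hw⟩ := exists_ne (0 : 𝒟.V χ)
    obtain ⟨T, hT⟩ := exists_linearMap_apply_eq (k := k) hv w
    have h1 := hτ.map_lift χ ψ T
    rw [h, LinearMap.zero_apply, map_zero] at h1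
    rw [← hT, ← h1] at hw
    exact hw rfl
  · intro e he
    have : (e : G → k) = 1 := funext he
    rw [LinearMap.comp_apply, Submodule.subtype_apply, this, hτ.map_one]
    rfl
  · intro f₁ f₂ f₃ h
    simp only [LinearMap.comp_apply, Submodule.subtype_apply]
    rw [h, hτ.map_mul χ χ χ _ (hw χ f₁) _ (hw χ f₂)]
    rfl
  · intro W hW
    refine hτ.eq_bot_or_eq_top_of_stable χ W fun f hf x hx => ?_
    rw [weightFun_div_self] at hf
    exact hW ⟨f, hf⟩ x hx
  · have hid := hτ.lift_mem χ χ LinearMap.id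
    rw [weightFun_div_self] at hid
    refine ⟨⟨_, hid⟩, hτ.lift_mem_support χ χ LinearMap.id, ?_⟩
    rw [LinearMap.comp_apply, Submodule.subtype_apply, hτ.map_lift]
    exact one_ne_zero (α := Module.End k (𝒟.V χ))
  · intro χ g f f' hf hf'
    simp only [LinearMap.comp_apply, Submodule.subtype_apply]
    rw [hf', hτ.equivariant χ χ g _ (hw χ f)]
  · intro χ ψ f T
    exact (hτ.starMul_lift (hw χ f) T).symm
  · intro χ ψ f T
    exact (hτ.lift_starMul T (hw ψ f)).symm
  · intro χ ψ g T
    refine hτ.eq_of_mem_support (hτ.lift_mem_support _ _ _)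
      (hτ.shift_mem_support (hτ.lift_mem_support _ _ _) g) ?_
    rw [hτ.map_lift, hτ.equivariant _ _ _ _ (hτ.lift_mem _ _ _), hτ.map_lift]
    rfl

end DatumOfTwist

/-! ### From ideals and bimodules back to a fibre representation. -/

section DatumUnique

variable [Finite G] [CharZero k]

/-- A simple module over the ideal of functions supported on `K` is the one given by the fibre
representation. -/
theorem IsFiberRep.exists_equiv_of_isSimpleOver {V : Dual k A → Type w}
    [∀ χ, AddCommGroup (V χ)] [∀ χ, Module k (V χ)] [∀ χ, Module.Finite k (V χ)]
    {J : DynamicalTwist k A} {K : Subgroup G} {π : ∀ χ, K → V χ ≃ₗ[k] V χ}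
    {τ : ∀ χ ψ, (G → k) →ₗ[k] (V ψ →ₗ[k] V χ)} (hτ : IsFiberRep J.J K π τ) {χ : Dual k A}
    {W : Type*} [AddCommGroup W] [Module k W]
    {a : weightFun (1 : Dual k A) →ₗ[k] Module.End k W}
    (ha : IsSimpleOver J χ (fiberSupport K τ χ χ) a) :
    ∃ φ : V χ ≃ₗ[k] W, ∀ (f : weightFun (1 : Dual k A)) (v : V χ),
      a f (φ v) = φ (τ χ χ f v) := by
  obtain ⟨⟨hone, hmul⟩, hnt, hsimple, f₀, hf₀, hne⟩ := ha
  have hw : ∀ f : weightFun (1 : Dual k A), (f : G → k) ∈ weightFun (χ / χ) := fun f => by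
    rw [weightFun_div_self]
    exact f.2
  have hmem : ∀ T, hτ.lift χ χ T ∈ weightFun (1 : Dual k A) := fun T => by
    rw [← weightFun_div_self χ]
    exact hτ.lift_mem χ χ T
  let e : weightFun (1 : Dual k A) := ⟨_, hmem LinearMap.id⟩
  have hcomm : ∀ f, a e * a f = a ⟨_, hmem (τ χ χ f)⟩ ∧ a f * a e = a ⟨_, hmem (τ χ χ f)⟩ := by
    intro f
    rw [← hmul e f ⟨_, hmem (τ χ χ f)⟩, ← hmul f e ⟨_, hmem (τ χ χ f)⟩]
    · exact ⟨rfl, rfl⟩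
    · change _ = starMul (J.J χ) f (hτ.lift χ χ LinearMap.id)
      rw [hτ.starMul_lift (hw f), LinearMap.comp_id]
    · change _ = starMul (J.J χ) (hτ.lift χ χ LinearMap.id) f
      rw [hτ.lift_starMul _ (hw f), LinearMap.id_comp]
  -- The vectors fixed by the central idempotent e form a submodule. It contains the image of f₀ ≠
  -- 0, so simplicity makes it everything.
  have he : a e = 1 := by
    have hstable : ∀ f, ∀ x ∈ LinearMap.eqLocus (a e) LinearMap.id,
        a f x ∈ LinearMap.eqLocus (a e) LinearMap.id := by
      intro f x hx
      change a e x = x at hx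
      change (a e * a f) x = a f x
      rw [(hcomm f).1, ← (hcomm f).2, Module.End.mul_apply, hx]
    rcases hsimple _ hstable with h | h
    · exfalso
      refine hne (LinearMap.ext fun w => ?_)
      have h1 : a f₀ w ∈ LinearMap.eqLocus (a e) LinearMap.id := by
        change (a e * a f₀) w = a f₀ w
        rw [(hcomm f₀).1]
        congr 2
        exact Subtype.ext (hτ.lift_map hf₀)
      rwa [h, Submodule.mem_bot] at h1
    · refine LinearMap.ext fun w => ?_
      exact h.ge (Submodule.mem_top (x := w))
  -- As e acts as 1, f acts as f * e, which depends only on τ(f). The action thus factors through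
  -- the full matrix algebra End V_χ.
  obtain ⟨q, hq⟩ := exists_linear_factor ⊤ (τ χ χ ∘ₗ (weightFun 1).subtype) a
    (fun T => ⟨⟨_, hmem T⟩, trivial, hτ.map_lift χ χ T⟩) fun f _ hf => by
      rw [LinearMap.comp_apply, Submodule.subtype_apply] at hf
      rw [← mul_one (a f), ← he, (hcomm f).2]
      have : (⟨_, hmem (τ χ χ f)⟩ : weightFun (1 : Dual k A)) = 0 :=
        Subtype.ext (by rw [hf]; exact map_zero _)
      rw [this, map_zero]
  have hq' : ∀ f : weightFun (1 : Dual k A), a f = q (τ χ χ f) := fun f => hq f trivial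
  have hqT : ∀ T, q T = a ⟨_, hmem T⟩ := fun T => by rw [hq', hτ.map_lift]
  have hqmul : ∀ S T, q (S ∘ₗ T) = q S ∘ₗ q T := by
    intro S T
    rw [hqT, hqT, hqT]
    exact hmul _ _ _ (hτ.lift_starMul_lift χ χ χ S T).symm
  obtain ⟨φ, hφ⟩ := exists_intertwiner (ι := Unit) (V := fun _ => V χ) (V' := fun _ => W)
    (fun _ _ => q) (fun _ _ _ S T => hqmul S T)
    ⟨(), (), LinearMap.id, by rw [hqT]; exact he.trans_ne one_ne_zero⟩ fun _ _ x y hx => by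
      have hstable : ∀ f, ∀ z ∈ LinearMap.range (q.flip x), a f z ∈ LinearMap.range (q.flip x) := by
        rintro f _ ⟨T, rfl⟩
        refine ⟨τ χ χ f ∘ₗ T, ?_⟩
        rw [LinearMap.flip_apply, LinearMap.flip_apply, hqmul, hq']
        rfl
      rcases hsimple _ hstable with h | h
      · exfalso
        have h1 : x ∈ LinearMap.range (q.flip x) := by
          refine ⟨LinearMap.id, ?_⟩
          rw [LinearMap.flip_apply, hqT]
          exact LinearMap.congr_fun he x
        rw [h, Submodule.mem_bot] at h1
        exact hx h1
      · exact h.ge (Submodule.mem_top (x := y))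
  refine ⟨φ (), fun f v => ?_⟩
  rw [hq']
  exact hφ () () (τ χ χ f) v

/-- Some fibre representation of J exists. It is adapted to the given datum: translated to fit the
ideal at one character, which the nonzero blocks propagate to all others, then moved to the spaces
V_χ. The bimodule isomorphisms finally identify the actions of K. -/
theorem IsDatumOf.hasFiberRep [IsAlgClosed k] [IsMulCommutative A] {J : DynamicalTwist k A}
    {𝒟 : DynamicalDatum k A} (h : IsDatumOf J 𝒟) : HasFiberRep J 𝒟 := by
  obtain ⟨I, a, σ, hI, hblock, hstab, hsimple, -, hσ, hσl, hσr, hσK⟩ := h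
  obtain ⟨𝒟₀, τ₀, hτ₀⟩ := exists_hasFiberRep J
  -- The given ideals need only be translates of the support ideals of τ₀; this g accounts for the
  -- difference.
  obtain ⟨g, f₁, hf₁, hne⟩ : ∃ g, ∃ f ∈ I 1, τ₀ 1 1 (shift g f) ≠ 0 := by
    by_contra! h0
    refine (hI 1).prop.2 ((Submodule.eq_bot_iff _).2 fun f hf => ?_)
    have h1 := (hI 1).prop.1.1 hf
    rw [← weightFun_div_self 1] at h1
    exact hτ₀.injective 1 1 f h1 fun g => h0 g f hf
  obtain ⟨K₁, π₁, hτ₁⟩ := hτ₀.exists_shift g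
  change (fun χ ψ => τ₀ χ ψ ∘ₗ shift g : ∀ χ ψ, (G → k) →ₗ[k] (𝒟₀.V ψ →ₗ[k] 𝒟₀.V χ)) 1 1 f₁ ≠ 0
    at hne
  generalize (fun χ ψ => τ₀ χ ψ ∘ₗ shift g : ∀ χ ψ, (G → k) →ₗ[k] (𝒟₀.V ψ →ₗ[k] 𝒟₀.V χ)) = τ₁
    at hτ₁ hne
  have hI₁ := hτ₁.eq_fiberSupport_of_ne_zero (hI 1) hf₁ hne
  -- If τ₁ killed I χ, every product in the block from χ to 1 would be supported on K and killed by
  -- τ₁, and the block would vanish.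
  obtain rfl : I = fun χ => fiberSupport K₁ τ₁ χ χ := by
    funext χ
    obtain ⟨f, hf, h0⟩ : ∃ f ∈ I χ, τ₁ χ χ f ≠ 0 := by
      by_contra! h0
      refine hblock χ 1 (Submodule.span_eq_bot.2 ?_)
      rintro _ ⟨f, hf, x, hx, f', hf', rfl⟩
      rw [hI₁] at hf'
      have hfw := (hI χ).prop.1.1 hf
      rw [← weightFun_div_self χ] at hfw
      refine hτ₁.eq_zero_of_mem_support
        (hτ₁.starMul_mem_support_right (starMul_mem J 1 hfw hx) hf') ?_
      rw [hτ₁.map_mul χ 1 1 _ (starMul_mem J 1 hfw hx) _ hf'.1, hτ₁.map_mul χ χ 1 _ hfw _ hx,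
        h0 f hf, LinearMap.zero_comp, LinearMap.zero_comp]
    exact hτ₁.eq_fiberSupport_of_ne_zero (hI χ) hf h0
  have hK : 𝒟.K = K₁ := Subgroup.ext fun g =>
    (hstab 1 g).trans (hτ₁.mem_iff_map_fiberSupport 1 g).symm
  subst hK
  choose φ hφ using fun χ => hτ₁.exists_equiv_of_isSimpleOver (hsimple χ)
  have hone : ∀ h : G, h ∈ 𝒟.K ↔ 1 * h * 1⁻¹ ∈ 𝒟.K := fun h => by simp
  have hτ₂ := hτ₁.transport (π' := fun χ h => ((φ χ).symm.trans (π₁ χ h)).trans (φ χ)) 1 hone φ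
    fun χ ψ h T => by
      have hh : (⟨1 * (h : G) * 1⁻¹, (hone h).1 h.2⟩ : 𝒟.K) = h := Subtype.ext (by simp)
      rw [hh]
      ext v
      simp [LinearEquiv.arrowCongr_apply]
  have ha : ∀ χ (f : weightFun (1 : Dual k A)),
      (((φ χ).arrowCongr (φ χ)).toLinearMap ∘ₗ τ₁ χ χ ∘ₗ shift 1⁻¹) (f : G → k) = a χ f := by
    intro χ f
    refine LinearMap.ext fun v => ?_
    obtain ⟨w, rfl⟩ := (φ χ).surjective v
    rw [hφ, inv_one]
    simp [LinearEquiv.arrowCongr_apply, shift_one]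
  have hzero : ∀ χ ψ f,
      (((φ ψ).arrowCongr (φ χ)).toLinearMap ∘ₗ τ₁ χ ψ ∘ₗ shift 1⁻¹) f = 0 → τ₁ χ ψ f = 0 := by
    intro χ ψ f h0
    rw [inv_one, LinearMap.comp_apply, LinearMap.comp_apply, shift_one] at h0
    exact ((φ ψ).arrowCongr (φ χ)).map_eq_zero_iff.1 h0
  generalize hdef : (fun χ ψ => ((φ ψ).arrowCongr (φ χ)).toLinearMap ∘ₗ τ₁ χ ψ ∘ₗ shift 1⁻¹ :
    ∀ χ ψ, (G → k) →ₗ[k] (𝒟.V ψ →ₗ[k] 𝒟.V χ)) = τ₂ at hτ₂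
  generalize (fun χ h => ((φ χ).symm.trans (π₁ χ h)).trans (φ χ) :
    ∀ χ, 𝒟.K → 𝒟.V χ ≃ₗ[k] 𝒟.V χ) = π₂ at hτ₂
  have ha : ∀ χ (f : weightFun (1 : Dual k A)), τ₂ χ χ (f : G → k) = a χ f := fun χ f => by
    rw [← hdef, ← ha]
  have hzero : ∀ χ ψ f, τ₂ χ ψ f = 0 → τ₁ χ ψ f = 0 := fun χ ψ f h0 => by
    rw [← hdef] at h0
    exact hzero χ ψ f h0
  have hσmem : ∀ χ ψ T, σ χ ψ T ∈ fiberSupport 𝒟.K τ₁ χ ψ := fun χ ψ T =>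
    hτ₁.blockBimodule_le χ ψ ((hσ χ ψ).2 ▸ LinearMap.mem_range_self _ T)
  have hw : ∀ (χ : Dual k A) (f : weightFun (1 : Dual k A)), (f : G → k) ∈ weightFun (χ / χ) :=
    fun χ f => by
      rw [weightFun_div_self]
      exact f.2
  have hsurj : ∀ χ (S : Module.End k (𝒟.V χ)), ∃ f : weightFun (1 : Dual k A), a χ f = S := by
    intro χ S
    have hmem := hτ₂.lift_mem χ χ S
    rw [weightFun_div_self] at hmem
    exact ⟨⟨_, hmem⟩, by rw [← ha]; exact hτ₂.map_lift χ χ S⟩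
  have hl : ∀ χ ψ (S : Module.End k (𝒟.V χ)) T,
      τ₂ χ ψ (σ χ ψ (S ∘ₗ T)) = S ∘ₗ τ₂ χ ψ (σ χ ψ T) := by
    intro χ ψ S T
    obtain ⟨f, rfl⟩ := hsurj χ S
    rw [hσl, hτ₂.map_mul χ χ ψ _ (hw χ f) _ (hσmem χ ψ T).1, ha]
  have hr : ∀ χ ψ T (S : Module.End k (𝒟.V ψ)),
      τ₂ χ ψ (σ χ ψ (T ∘ₗ S)) = τ₂ χ ψ (σ χ ψ T) ∘ₗ S := by
    intro χ ψ T S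
    obtain ⟨f, rfl⟩ := hsurj ψ S
    rw [hσr, hτ₂.map_mul χ ψ ψ _ (hσmem χ ψ T).1 _ (hw ψ f), ha]
  have hq : ∀ χ ψ, Function.Surjective (τ₂ χ ψ ∘ₗ σ χ ψ) := by
    intro χ ψ
    rw [← LinearMap.injective_iff_surjective, injective_iff_map_eq_zero]
    intro T hT
    refine (injective_iff_map_eq_zero (σ χ ψ)).1 (hσ χ ψ).1 T ?_
    exact hτ₁.eq_zero_of_mem_support (hσmem χ ψ T) (hzero _ _ _ hT)
  -- The composites τ₂ ∘ σ are bijective and commute with left and right composition by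
  -- endomorphisms. Hence π₂ and the given π act equally on Hom(V_ψ, V_χ), although the operators
  -- themselves may differ by scalars.
  have hAd : ∀ χ ψ h (T : 𝒟.V ψ →ₗ[k] 𝒟.V χ), (π₂ ψ h).arrowCongr (π₂ χ h) T = (𝒟.π ψ h).arrowCongr (𝒟.π χ h) T := by
    intro χ ψ h T
    obtain ⟨T, rfl⟩ := hq χ ψ T
    rw [LinearMap.comp_apply, ← hτ₂.equivariant χ ψ h _ (hσmem χ ψ T).1, ← hσK]
    change τ₂ χ ψ (σ χ ψ ((𝒟.π χ h).toLinearMap ∘ₗ (T ∘ₗ (𝒟.π ψ h).symm.toLinearMap))) = _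
    rw [hl, hr]
    rfl
  exact ⟨τ₂, { hτ₂ with
    equivariant := fun χ ψ h f hf => by rw [hτ₂.equivariant χ ψ h f hf, hAd] }⟩

/-- A datum is obtained from a dynamical twist if and only if it carries a fibre representation of
the twist. -/
theorem isDatumOf_iff [IsAlgClosed k] [IsMulCommutative A] {J : DynamicalTwist k A}
    {𝒟 : DynamicalDatum k A} : IsDatumOf J 𝒟 ↔ HasFiberRep J 𝒟 :=
  ⟨IsDatumOf.hasFiberRep, HasFiberRep.isDatumOf⟩

end DatumUnique

end DynTwist

end

/-- The constructions of a dynamical datum from a dynamical twist and of a dynamical twist from a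
dynamical datum can always be carried out, their results are well defined up to isomorphism and
gauge equivalence and depend only on the classes, and the resulting maps `D` and `T` between
gauge equivalence classes of dynamical twists and isomorphism classes of dynamical data are
inverse to each other. -/
theorem theorem6p4 {k : Type*} [Field k] [IsAlgClosed k] [CharZero k]
    {G : Type*} [Group G] [Finite G] (A : Subgroup G) [IsMulCommutative A] :
    (∀ J : DynTwist.DynamicalTwist k A, ∃ 𝒟 : DynTwist.DynamicalDatum k A,
      DynTwist.IsDatumOf J 𝒟) ∧
    (∀ 𝒟 : DynTwist.DynamicalDatum k A, ∃ J : DynTwist.DynamicalTwist k A,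
      DynTwist.IsExchangeTwist 𝒟 J) ∧
    ∃ (D : DynTwist.TwistClass k A → DynTwist.DatumClass k A)
      (T : DynTwist.DatumClass k A → DynTwist.TwistClass k A),
      (∀ (J : DynTwist.DynamicalTwist k A) (𝒟 : DynTwist.DynamicalDatum k A),
        DynTwist.IsDatumOf J 𝒟 →
          D (Quotient.mk (DynTwist.gaugeSetoid k A) J) =
            Quotient.mk (DynTwist.datumSetoid k A) 𝒟) ∧
      (∀ (𝒟 : DynTwist.DynamicalDatum k A) (J : DynTwist.DynamicalTwist k A),
        DynTwist.IsExchangeTwist 𝒟 J →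
          T (Quotient.mk (DynTwist.datumSetoid k A) 𝒟) =
            Quotient.mk (DynTwist.gaugeSetoid k A) J) ∧
      Function.LeftInverse T D ∧ Function.RightInverse T D := by
  -- Only the relation `HasFiberRep` matters from here on. It is total on both sides, invariant
  -- under both equivalences, and determines each class from the other, so any choices define D and
  -- T and make them inverse.
  choose datum hdatum using DynTwist.exists_hasFiberRep (k := k) (A := A)
  choose twist htwist using DynTwist.exists_twist_hasFiberRep (k := k) (A := A)
  let D : DynTwist.TwistClass k A → DynTwist.DatumClass k A :=
    Quotient.lift (fun J => Quotient.mk (DynTwist.datumSetoid k A) (datum J)) fun J J' h =>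
      Quotient.sound (((hdatum J).of_gaugeEquivalent h).datumIso (hdatum J'))
  let T : DynTwist.DatumClass k A → DynTwist.TwistClass k A :=
    Quotient.lift (fun 𝒟 => Quotient.mk (DynTwist.gaugeSetoid k A) (twist 𝒟)) fun 𝒟 𝒟' h =>
      Quotient.sound (((htwist 𝒟).of_datumIso h).gaugeEquivalent (htwist 𝒟'))
  have hD : ∀ J 𝒟, DynTwist.HasFiberRep J 𝒟 → D (Quotient.mk (DynTwist.gaugeSetoid k A) J) =
      Quotient.mk (DynTwist.datumSetoid k A) 𝒟 :=
    fun J 𝒟 h => Quotient.sound ((hdatum J).datumIso h)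
  have hT : ∀ J 𝒟, DynTwist.HasFiberRep J 𝒟 → T (Quotient.mk (DynTwist.datumSetoid k A) 𝒟) =
      Quotient.mk (DynTwist.gaugeSetoid k A) J :=
    fun J 𝒟 h => Quotient.sound ((htwist 𝒟).gaugeEquivalent h)
  refine ⟨fun J => ⟨datum J, DynTwist.isDatumOf_iff.2 (hdatum J)⟩,
    fun 𝒟 => ⟨twist 𝒟, DynTwist.isExchangeTwist_iff.2 (htwist 𝒟)⟩, D, T,
    fun J 𝒟 h => hD J 𝒟 (DynTwist.isDatumOf_iff.1 h),
    fun 𝒟 J h => hT J 𝒟 (DynTwist.isExchangeTwist_iff.1 h), ?_, ?_⟩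
  · rintro ⟨J⟩
    exact (congrArg T (hD J _ (hdatum J))).trans (hT J _ (hdatum J))
  · rintro ⟨𝒟⟩
    exact (congrArg D (hT _ 𝒟 (htwist 𝒟))).trans (hD _ 𝒟 (htwist 𝒟))
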